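/- Let $(S,\mathcal F)$ be a measurable space (for instance a Hausdorff space with its Borel $\sigma$-field) and let $P$ be a probability measure on it. Let $b_n>0$ $(n\ge 1)$ satisfy $b_n\to 0$, $nb_n^2\to\infty$, $b_n/b_{n+1}\to 1$, and let $k_n$ be natural numbers with $k_n/n\to\nu$ for some $0<\nu<\infty$. Logarithms take values in $[-\infty,\infty]$, with $\log 0=-\infty$. Let $\Phi$ be the set of measurable $f:S\to\mathbb R$ with $\int f^2\,dP<\infty$ and $$\lim_{n\to\infty}\frac{1}{nb_n^2}\log\bigl(n\,P(|f|>b_n^{-1})\bigr)=-\infty .$$ Let $\Lambda_\Phi$ be the set of probability measures $Q$ on $S$ with $\int|f|\,dQ<\infty$ for all $f\in\Phi$, and let $\Lambda_{0\Phi}$ be the set of finite signed measures $G$ on $S$ with $G(S)=0$ and $\int|f|\,d|G|<\infty$ for all $f\in\Phi$, where $|G|$ is the total variation of $G$. The $\tau_\Phi$-topology (the $\sigma_\Phi$-field) on $\Lambda_{0\Phi}$ is the coarsest topology (the smallest $\sigma$-field) for which all maps $G\mapsto\int f\,dG$, $f\in\Phi$, are continuous (measurable); $\Lambda_{0\Phi}^2=\Lambda_{0\Phi}\times\Lambda_{0\Phi}$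 carries the product topology and the product $\sigma$-field. Put $$\rho_0^2(G,P)=\tfrac12\int\Bigl(\frac{dG}{dP}\Bigr)^2dP\ \text{ if } G\ll P,\qquad \rho_0^2(G,P)=\infty\ \text{ otherwise},$$ and, for $(G_2,G_1)\in\Lambda_{0\Phi}^2$ and $A\subset\Lambda_{0\Phi}^2$, $$\rho_{0b}^2\bigl((G_2,G_1),P\bigr)=\nu\,\rho_0^2(G_2,P)+\rho_0^2(G_1,P),\qquad \rho_{0b}^2(A,P)=\inf_{\bar G\in A}\rho_{0b}^2(\bar G,P),\qquad \inf\emptyset=\infty .$$ Let $H,H_1,H_2,\ldots\in\Lambda_{0\Phi}$ be such that (A) $P_n:=P+b_nH_n\in\Lambda_\Phi$ and $P+b_nH\in\Lambda_\Phi$ for all $n\ge1$, and $H_n\to H$ in the $\tau_\Phi$-topology; (B1) for every $f\in\Phi$, $\displaystyle\limsup_{n\to\infty}\sup_{m\ge1}\frac{1}{nb_n^2}\log\Bigl(nb_n\,|H_m|\bigl(|f|>b_n^{-1}\bigr)\Bigr)=-\infty .$ For each $n$ let $X_1,\ldots,X_n$ be i.i.d. with law $P_n$ and empirical measure $\widehat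 P_n$; given $X_1,\ldots,X_n$, let $X_1^*,\ldots,X_{k_n}^*$ be i.i.d. with law $\widehat P_n$, and let $P^*_{k_n}$ be their empirical measure. Write $\mathbf P_n$ for the joint law of the two samples, and let $\widetilde H=(0,H)\in\Lambda_{0\Phi}^2$. Then, for every measurable set $\bar\Omega_0\subset\Lambda_{0\Phi}^2$, $$\liminf_{n\to\infty}\frac1{nb_n^2}\log\mathbf P_n\Bigl(\bigl(P^*_{k_n}-\widehat P_n,\ \widehat P_n-P\bigr)\in b_n\bar\Omega_0\Bigr)\ \ge\ -\rho_{0b}^2\bigl(\operatorname{int}(\bar\Omega_0-\widetilde H),P\bigr)$$ and $$\limsup_{n\to\infty}\frac1{nb_n^2}\log\mathbf P_n\Bigl(\bigl(P^*_{k_n}-\widehat P_n,\ \widehat P_n-P\bigr)\in b_n\bar\Omega_0\Bigr)\ \le\ -\rho_{0b}^2\bigl(\operatorname{cl}(\bar\Omega_0-\widetilde H),P\bigr),$$ where the interior and the closure are taken in the product $\tau_\Phi$-topology. In particular this holds for $k_n=n$, with $\nu=1$. -/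

import Mathlib

open MeasureTheory ProbabilityTheory Filter Topology
open scoped ENNReal

noncomputable section

namespace BootstrapMDP

variable {S : Type*} [MeasurableSpace S]

/-- `(n β²)⁻¹ log x`, with `log 0 = -∞`; the values are extended real numbers. -/
def scaledLog (n : ℕ) (β : ℝ) (x : ℝ≥0∞) : EReal :=
  ((((n : ℝ) * β ^ 2)⁻¹ : ℝ) : EReal) * ENNReal.log x

/-- The class `Φ` of test functions: measurable `f` with `∫ f² dP < ∞` and
`(n b_n²)⁻¹ log (n P(|f| > b_n⁻¹)) → -∞`. -/
def Phi (P : ProbabilityMeasure S) (b : ℕ → ℝ) : Set (S → ℝ) :=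
  {f | Measurable f ∧ MemLp f 2 (P : Measure S) ∧
    Tendsto (fun n : ℕ => scaledLog n (b n)
      ((n : ℝ≥0∞) * (P : Measure S) {x | (b n)⁻¹ < |f x|})) atTop (𝓝 ⊥)}

/-- `Λ_Φ`: the probability measures that integrate every `f ∈ Φ`. -/
def Lambda (Φ : Set (S → ℝ)) : Set (ProbabilityMeasure S) :=
  {Q | ∀ f ∈ Φ, Integrable f (Q : Measure S)}

/-- `Λ_{0Φ}`: the (finite) signed measures `G` with `G(S) = 0` and `∫ |f| d|G| < ∞` for all
`f ∈ Φ`, where `|G|` is the total variation measure. -/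
def Lambda0 (Φ : Set (S → ℝ)) : Submodule ℝ (SignedMeasure S) where
  carrier := {G | G Set.univ = 0 ∧ ∀ f ∈ Φ, Integrable f G.variation}
  zero_mem' := by
    refine ⟨by simp, fun f _ => ?_⟩
    simp
  add_mem' := by
    rintro G G' ⟨hG, hGf⟩ ⟨hG', hGf'⟩
    refine ⟨by simp [hG, hG'], fun f hf => ?_⟩
    exact VectorMeasure.Integrable.add_vectorMeasure (hGf f hf) (hGf' f hf)
  smul_mem' := by
    rintro c G ⟨hG, hGf⟩
    refine ⟨by simp [hG], fun f hf => ?_⟩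
    exact VectorMeasure.Integrable.smul_vectorMeasure (hGf f hf) c

/-- The family `(∫ f dG)_{f ∈ Φ}` of integrals with respect to the signed measure `G`. -/
def pairing (Φ : Set (S → ℝ)) (G : Lambda0 Φ) : Φ → ℝ :=
  fun f => VectorMeasure.integral (G : SignedMeasure S) (f : S → ℝ) (ContinuousLinearMap.lsmul ℝ ℝ)

/-- The `τ_Φ`-topology: the coarsest one for which `G ↦ ∫ f dG` is continuous for all `f ∈ Φ`. -/
instance instTopologicalSpaceLambda0 (Φ : Set (S → ℝ)) : TopologicalSpace (Lambda0 Φ) :=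
  TopologicalSpace.induced (pairing Φ) Pi.topologicalSpace

/-- The `σ_Φ`-field: the smallest one for which `G ↦ ∫ f dG` is measurable for all `f ∈ Φ`. -/
instance instMeasurableSpaceLambda0 (Φ : Set (S → ℝ)) : MeasurableSpace (Lambda0 Φ) :=
  MeasurableSpace.comap (pairing Φ) MeasurableSpace.pi

open Classical in
/-- `ρ₀²(G, P) = ½ ∫ (dG/dP)² dP` if `G ≪ P`, and `∞` otherwise. -/
def rho0sq (G : SignedMeasure S) (P : ProbabilityMeasure S) : ℝ≥0∞ :=
  if G ≪ᵥ (P : Measure S).toENNRealVectorMeasure then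
    2⁻¹ * ∫⁻ x, ENNReal.ofReal (G.rnDeriv (P : Measure S) x ^ 2) ∂(P : Measure S)
  else ⊤

/-- The rate function `ν ρ₀²(G₂, P) + ρ₀²(G₁, P)` of a pair `(G₂, G₁)`. -/
def rho0bsq {Φ : Set (S → ℝ)} (ν : ℝ) (P : ProbabilityMeasure S)
    (G : Lambda0 Φ × Lambda0 Φ) : ℝ≥0∞ :=
  ENNReal.ofReal ν * rho0sq (G.1 : SignedMeasure S) P + rho0sq (G.2 : SignedMeasure S) P

/-- The infimum of the rate function over a set of pairs; it is `∞` on the empty set. -/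
def rho0bsqSet {Φ : Set (S → ℝ)} (ν : ℝ) (P : ProbabilityMeasure S)
    (Ω : Set (Lambda0 Φ × Lambda0 Φ)) : ℝ≥0∞ :=
  ⨅ G ∈ Ω, rho0bsq ν P G

/-- The empirical measure `n⁻¹ ∑ᵢ δ_{xᵢ}` of a sample of size `n` (the zero measure if `n = 0`). -/
def empirical {n : ℕ} (x : Fin n → S) : Measure S :=
  (n : ℝ≥0∞)⁻¹ • ∑ i, Measure.dirac (x i)

theorem empirical_univ_le {n : ℕ} (x : Fin n → S) : empirical x Set.univ ≤ 1 := by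
  simp [empirical, ENNReal.inv_mul_le_one]

instance instIsFiniteMeasureEmpirical {n : ℕ} (x : Fin n → S) :
    IsFiniteMeasure (empirical x) :=
  ⟨(empirical_univ_le x).trans_lt ENNReal.one_lt_top⟩

instance instIsProbabilityMeasureEmpirical {n : ℕ} [NeZero n] (x : Fin n → S) :
    IsProbabilityMeasure (empirical x) := by
  refine ⟨?_⟩
  simp [empirical, ENNReal.inv_mul_cancel (Nat.cast_ne_zero.2 (NeZero.ne n))]

theorem measurable_empirical {n : ℕ} :
    Measurable (fun x : Fin n → S => empirical x) := by
  refine Measure.measurable_of_measurable_coe _ fun s hs => ?_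
  simp only [empirical, Measure.smul_apply, Measure.finsetSum_apply, smul_eq_mul,
    Measure.dirac_apply' _ hs]
  refine Measurable.const_mul (Finset.measurable_sum _ fun i _ => ?_) _
  exact (measurable_one.indicator hs).comp (measurable_pi_apply i)

/-- The conditional law of the bootstrap sample: given the sample `x`, the law of `k` independent
random variables with distribution the empirical measure of `x`. -/
def bootstrapKernel (S : Type*) [MeasurableSpace S] (n k : ℕ) :
    Kernel (Fin n → S) (Fin k → S) where
  toFun x := Measure.pi fun _ => empirical x
  measurable' := by
    refine Measurable.measure_of_isPiSystem generateFrom_pi.symm isPiSystem_pi ?_ ?_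
    · rintro _ ⟨s, hs, rfl⟩
      simp only [Measure.pi_pi]
      exact Finset.measurable_prod _ fun i _ =>
        (Measure.measurable_coe (hs i (Set.mem_univ i))).comp measurable_empirical
    · simp only [Measure.pi_univ]
      exact Finset.measurable_prod _ fun i _ =>
        (Measure.measurable_coe MeasurableSet.univ).comp measurable_empirical

instance instIsFiniteKernelBootstrap (n k : ℕ) : IsFiniteKernel (bootstrapKernel S n k) := by
  refine ⟨1, ENNReal.one_lt_top, fun x => ?_⟩
  change Measure.pi (fun _ : Fin k => empirical x) Set.univ ≤ 1
  rw [Measure.pi_univ]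
  exact Finset.prod_le_one' fun i _ => empirical_univ_le x

/-- The joint law of `((X₁, …, X_n), (X*₁, …, X*_k))`, where `X₁, …, X_n` are i.i.d. with law `Q`
and, given these, `X*₁, …, X*_k` are i.i.d. with law the empirical measure of `X₁, …, X_n`. -/
def sampleLaw (Q : ProbabilityMeasure S) (n k : ℕ) :
    Measure ((Fin n → S) × (Fin k → S)) :=
  (Measure.pi fun _ : Fin n => (Q : Measure S)) ⊗ₘ bootstrapKernel S n k

/-- The event `(P*_k - P̂_n, P̂_n - P) ∈ β Ω`. -/
def deviationEvent {Φ : Set (S → ℝ)} (P : ProbabilityMeasure S) (β : ℝ)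
    (Ω : Set (Lambda0 Φ × Lambda0 Φ)) (n k : ℕ) : Set ((Fin n → S) × (Fin k → S)) :=
  {w | ∃ G ∈ Ω,
    (empirical w.2).toSignedMeasure - (empirical w.1).toSignedMeasure
      = β • (G.1 : SignedMeasure S) ∧
    (empirical w.1).toSignedMeasure - (P : Measure S).toSignedMeasure
      = β • (G.2 : SignedMeasure S)}

/-- Assumption A: for all `n ≥ 1`, `P_n = P + b_n H_n` and `P + b_n H` are probability measures in
`Λ_Φ`, and `H_n → H` in the `τ_Φ`-topology. -/
structure AssumptionA (P : ProbabilityMeasure S) (b : ℕ → ℝ) (Pn : ℕ → ProbabilityMeasure S)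
    (Hn : ℕ → Lambda0 (Phi P b)) (H : Lambda0 (Phi P b)) : Prop where
  eq_add : ∀ n, 1 ≤ n → (Pn n : Measure S).toSignedMeasure
    = (P : Measure S).toSignedMeasure + b n • (Hn n : SignedMeasure S)
  mem : ∀ n, 1 ≤ n → Pn n ∈ Lambda (Phi P b)
  limit_mem : ∀ n, 1 ≤ n → ∃ Q ∈ Lambda (Phi P b), (Q : Measure S).toSignedMeasure
    = (P : Measure S).toSignedMeasure + b n • (H : SignedMeasure S)
  tendsto : Tendsto Hn atTop (𝓝 H)

/-- Assumption B1: for every `f ∈ Φ`,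
`limsup_n sup_{m ≥ 1} (n b_n²)⁻¹ log (n b_n |H_m|(|f| > b_n⁻¹)) = -∞`. -/
def AssumptionB1 (P : ProbabilityMeasure S) (b : ℕ → ℝ)
    (Hn : ℕ → Lambda0 (Phi P b)) : Prop :=
  ∀ f ∈ Phi P b,
    limsup (fun n : ℕ => ⨆ (m : ℕ) (_ : 1 ≤ m), scaledLog n (b n)
      (ENNReal.ofReal (n * b n) *
        (Hn m : SignedMeasure S).variation {x | (b n)⁻¹ < |f x|})) atTop = ⊥

end BootstrapMDP

end

noncomputable section

namespace BootstrapMDP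

variable {S : Type*} [MeasurableSpace S]

/-! ### Scaled logarithms -/

theorem inv_mul_le_coe_iff {t : ℝ} (ht : 0 < t) (y : EReal) (a : ℝ) :
    ((t⁻¹ : ℝ) : EReal) * y ≤ a ↔ y ≤ ((t * a : ℝ) : EReal) := by
  have h : 0 < t⁻¹ := inv_pos.2 ht
  induction y with
  | bot => simp [EReal.coe_mul_bot_of_pos h]
  | top => simp [EReal.coe_mul_top_of_pos h, -EReal.coe_mul]
  | coe r =>
    rw [← EReal.coe_mul, EReal.coe_le_coe_iff, EReal.coe_le_coe_iff, inv_mul_le_iff₀ ht]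

theorem coe_le_inv_mul_iff {t : ℝ} (ht : 0 < t) (y : EReal) (a : ℝ) :
    (a : EReal) ≤ ((t⁻¹ : ℝ) : EReal) * y ↔ ((t * a : ℝ) : EReal) ≤ y := by
  have h : 0 < t⁻¹ := inv_pos.2 ht
  induction y with
  | bot => simp [EReal.coe_mul_bot_of_pos h, -EReal.coe_mul]
  | top => simp [EReal.coe_mul_top_of_pos h]
  | coe r =>
    rw [← EReal.coe_mul, EReal.coe_le_coe_iff, EReal.coe_le_coe_iff, le_inv_mul_iff₀ ht]

theorem log_ofReal_exp (a : ℝ) : ENNReal.log (ENNReal.ofReal (Real.exp a)) = a := by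
  rw [ENNReal.log_ofReal_of_pos (Real.exp_pos a), Real.log_exp]

theorem scaledLog_le_iff {n : ℕ} {β : ℝ} (h : 0 < (n : ℝ) * β ^ 2) (x : ℝ≥0∞) (a : ℝ) :
    scaledLog n β x ≤ a ↔ x ≤ ENNReal.ofReal (Real.exp (n * β ^ 2 * a)) := by
  rw [scaledLog, inv_mul_le_coe_iff h, ← log_ofReal_exp, ENNReal.log_le_log_iff]

theorem le_scaledLog_iff {n : ℕ} {β : ℝ} (h : 0 < (n : ℝ) * β ^ 2) (x : ℝ≥0∞) (a : ℝ) :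
    a ≤ scaledLog n β x ↔ ENNReal.ofReal (Real.exp (n * β ^ 2 * a)) ≤ x := by
  rw [scaledLog, coe_le_inv_mul_iff h, ← log_ofReal_exp, ENNReal.log_le_log_iff]

/-- The standing assumptions on the normalising sequence. -/
structure Normalizing (b : ℕ → ℝ) : Prop where
  pos : ∀ n, 1 ≤ n → 0 < b n
  zero : Tendsto b atTop (𝓝 0)
  speed : Tendsto (fun n : ℕ => (n : ℝ) * b n ^ 2) atTop atTop

namespace Normalizing

variable {b : ℕ → ℝ}

theorem eventually_pos (hb : Normalizing b) : ∀ᶠ n in atTop, 0 < b n :=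
  (eventually_ge_atTop 1).mono hb.pos

theorem eventually_speed_pos (hb : Normalizing b) : ∀ᶠ n : ℕ in atTop, 0 < (n : ℝ) * b n ^ 2 :=
  hb.speed.eventually_gt_atTop 0

theorem inv_tendsto (hb : Normalizing b) : Tendsto (fun n => (b n)⁻¹) atTop atTop :=
  (tendsto_nhdsWithin_iff.2 ⟨hb.zero, hb.eventually_pos⟩).inv_tendsto_nhdsGT_zero

end Normalizing

/-- The event probabilities `p n` are eventually at most `exp (- a n b_n²)`. -/
def ExpBound (b : ℕ → ℝ) (p : ℕ → ℝ≥0∞) (a : ℝ) : Prop :=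
  ∀ᶠ n : ℕ in atTop, p n ≤ ENNReal.ofReal (Real.exp (n * b n ^ 2 * (-a)))

theorem ExpBound.mono {b : ℕ → ℝ} {p q : ℕ → ℝ≥0∞} {a : ℝ} (h : ExpBound b p a)
    (hq : ∀ᶠ n in atTop, q n ≤ p n) : ExpBound b q a := by
  filter_upwards [h, hq] with n h1 h2 using h2.trans h1

theorem ExpBound.anti {b : ℕ → ℝ} {p : ℕ → ℝ≥0∞} {a a' : ℝ} (h : ExpBound b p a) (ha : a' ≤ a) :
    ExpBound b p a' := by
  filter_upwards [h] with n hn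
  refine hn.trans (ENNReal.ofReal_le_ofReal (Real.exp_le_exp.2 ?_))
  exact mul_le_mul_of_nonneg_left (by linarith) (by positivity)

theorem ExpBound.add {b : ℕ → ℝ} (hb : Normalizing b) {p q : ℕ → ℝ≥0∞} {a a' : ℝ}
    (hp : ExpBound b p a) (hq : ExpBound b q a) (ha : a' < a) :
    ExpBound b (fun n => p n + q n) a' := by
  filter_upwards [hp, hq, hb.speed.eventually_ge_atTop (Real.log 2 / (a - a'))] with n h1 h2 h3
  refine (add_le_add h1 h2).trans ?_
  rw [← ENNReal.ofReal_add (Real.exp_pos _).le (Real.exp_pos _).le]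
  refine ENNReal.ofReal_le_ofReal ?_
  rw [div_le_iff₀ (by linarith)] at h3
  have : (n : ℝ) * b n ^ 2 * (-a') ≥ Real.log 2 + n * b n ^ 2 * (-a) := by linarith
  calc _ = Real.exp (Real.log 2 + n * b n ^ 2 * (-a)) := by
        rw [Real.exp_add, Real.exp_log two_pos]; ring
    _ ≤ _ := Real.exp_le_exp.2 this

theorem ExpBound.finset_sum {b : ℕ → ℝ} (hb : Normalizing b) {ι : Type*} (s : Finset ι)
    {p : ι → ℕ → ℝ≥0∞} {a : ℝ} (hp : ∀ i ∈ s, ∃ a' > a, ExpBound b (p i) a') :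
    ∃ a' > a, ExpBound b (fun n => ∑ i ∈ s, p i n) a' := by
  classical
  induction s using Finset.induction_on with
  | empty => exact ⟨a + 1, by simp, by simp [ExpBound]⟩
  | insert i s hi ih =>
    obtain ⟨a₁, h₁, hp₁⟩ := ih fun j hj => hp j (Finset.mem_insert_of_mem hj)
    obtain ⟨a₂, h₂, hp₂⟩ := hp i (Finset.mem_insert_self i s)
    obtain ⟨a₃, h₃, h₃'⟩ := exists_between (lt_min h₁ h₂)
    refine ⟨a₃, h₃, ?_⟩
    simp only [Finset.sum_insert hi]
    exact (hp₂.anti (min_le_right _ _)).add hb (hp₁.anti (min_le_left _ _)) h₃'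

/-- Superexponential smallness at speed `n b_n²`. -/
def SuperSmall (b : ℕ → ℝ) (p : ℕ → ℝ≥0∞) : Prop := ∀ a : ℝ, ExpBound b p a

theorem SuperSmall.mono {b : ℕ → ℝ} {p q : ℕ → ℝ≥0∞} (h : SuperSmall b p)
    (hq : ∀ᶠ n in atTop, q n ≤ p n) : SuperSmall b q := fun a => (h a).mono hq

theorem SuperSmall.add {b : ℕ → ℝ} (hb : Normalizing b) {p q : ℕ → ℝ≥0∞}
    (hp : SuperSmall b p) (hq : SuperSmall b q) : SuperSmall b (fun n => p n + q n) :=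
  fun a => (hp (a + 1)).add hb (hq (a + 1)) (by linarith)

theorem superSmall_iff_tendsto_scaledLog {b : ℕ → ℝ} (hb : Normalizing b) {p : ℕ → ℝ≥0∞} :
    SuperSmall b p ↔ Tendsto (fun n => scaledLog n (b n) (p n)) atTop (𝓝 ⊥) := by
  rw [EReal.tendsto_nhds_bot_iff_real]
  constructor
  · intro h x
    filter_upwards [h (-(x - 1)), hb.eventually_speed_pos] with n hn hpos
    rw [neg_neg, ← scaledLog_le_iff hpos] at hn
    exact hn.trans_lt (by exact_mod_cast sub_one_lt x)
  · intro h a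
    filter_upwards [h (-a), hb.eventually_speed_pos] with n hn hpos
    exact (scaledLog_le_iff hpos _ _).1 hn.le

/-! ### Integration against signed measures -/

/-- The integral of a real function against a signed measure. -/
def sint (G : SignedMeasure S) (f : S → ℝ) : ℝ :=
  VectorMeasure.integral G f (ContinuousLinearMap.lsmul ℝ ℝ)

theorem sint_toSignedMeasure (μ : Measure S) [IsFiniteMeasure μ] (f : S → ℝ) :
    sint μ.toSignedMeasure f = ∫ x, f x ∂μ := by
  have h : (ContinuousLinearMap.lsmul ℝ ℝ : ℝ →L[ℝ] ℝ →L[ℝ] ℝ)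
      = (ContinuousLinearMap.lsmul ℝ ℝ).flip := by
    ext; simp
  rw [sint, h, VectorMeasure.integral_toSignedMeasure]

theorem sint_add_left {G G' : SignedMeasure S} {f : S → ℝ} (h : Integrable f G.variation)
    (h' : Integrable f G'.variation) : sint (G + G') f = sint G f + sint G' f :=
  VectorMeasure.integral_add_vectorMeasure h h'

theorem sint_sub_left {G G' : SignedMeasure S} {f : S → ℝ} (h : Integrable f G.variation)
    (h' : Integrable f G'.variation) : sint (G - G') f = sint G f - sint G' f :=
  VectorMeasure.integral_sub_vectorMeasure h h'

theorem sint_smul_left (G : SignedMeasure S) (c : ℝ) (f : S → ℝ) :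
    sint (c • G) f = c * sint G f :=
  VectorMeasure.integral_smul_vectorMeasure f c

theorem sint_add {G : SignedMeasure S} {f g : S → ℝ} (h : Integrable f G.variation)
    (h' : Integrable g G.variation) : sint G (fun x => f x + g x) = sint G f + sint G g :=
  VectorMeasure.integral_add h h'

theorem sint_sub {G : SignedMeasure S} {f g : S → ℝ} (h : Integrable f G.variation)
    (h' : Integrable g G.variation) : sint G (fun x => f x - g x) = sint G f - sint G g :=
  VectorMeasure.integral_sub h h'

theorem sint_const_mul (G : SignedMeasure S) (c : ℝ) (f : S → ℝ) :
    sint G (fun x => c * f x) = c * sint G f :=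
  VectorMeasure.integral_fun_smul G _ c f

theorem abs_sint_le (G : SignedMeasure S) (f : S → ℝ) :
    |sint G f| ≤ ∫ x, |f x| ∂G.variation := by
  refine (VectorMeasure.norm_integral_le_integral_norm (μ := G) (f := f)
    (B := ContinuousLinearMap.lsmul ℝ ℝ)).trans ?_
  simp

instance isFiniteMeasure_variation (G : SignedMeasure S) : IsFiniteMeasure G.variation := by
  rw [← SignedMeasure.totalVariation_eq_variation]
  unfold SignedMeasure.totalVariation
  infer_instance

theorem variation_eq_jordan (G : SignedMeasure S) :
    G.variation = G.toJordanDecomposition.posPart + G.toJordanDecomposition.negPart :=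
  (SignedMeasure.totalVariation_eq_variation G).symm

theorem sint_eq_jordan {G : SignedMeasure S} {f : S → ℝ} (hf : Integrable f G.variation) :
    sint G f = ∫ x, f x ∂G.toJordanDecomposition.posPart
      - ∫ x, f x ∂G.toJordanDecomposition.negPart := by
  rw [variation_eq_jordan] at hf
  conv_lhs => rw [← G.toSignedMeasure_toJordanDecomposition]
  rw [JordanDecomposition.toSignedMeasure, sint_sub_left, sint_toSignedMeasure,
    sint_toSignedMeasure]
  · simpa using hf.left_of_add_measure
  · simpa using hf.right_of_add_measure

/-- A polar decomposition of a signed measure: `G = s · |G|` with a measurable sign `s`. -/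
theorem exists_sign (G : SignedMeasure S) : ∃ s : S → ℝ, Measurable s ∧ (∀ x, |s x| ≤ 1) ∧
    ∀ f : S → ℝ, Integrable f G.variation →
      sint G (fun x => s x * f x) = ∫ x, f x ∂G.variation := by
  classical
  obtain ⟨u, hu, hpos, hneg⟩ := G.toJordanDecomposition.mutuallySingular
  refine ⟨fun x => if x ∈ u then -1 else 1, Measurable.ite hu measurable_const measurable_const,
    fun x => by beta_reduce; split_ifs <;> simp, fun f hf => ?_⟩
  have hs : Measurable fun x => if x ∈ u then (-1 : ℝ) else 1 :=
    Measurable.ite hu measurable_const measurable_const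
  have hsf : Integrable (fun x => (if x ∈ u then (-1 : ℝ) else 1) * f x) G.variation :=
    hf.bdd_mul (c := 1) hs.aestronglyMeasurable
      (Eventually.of_forall fun x => by split_ifs <;> simp)
  rw [sint_eq_jordan hsf]
  have h1 : ∫ x, (if x ∈ u then (-1 : ℝ) else 1) * f x ∂G.toJordanDecomposition.posPart
      = ∫ x, f x ∂G.toJordanDecomposition.posPart := by
    refine integral_congr_ae ?_
    have : ∀ᵐ x ∂G.toJordanDecomposition.posPart, x ∉ u := by
      simpa [ae_iff] using hpos
    filter_upwards [this] with x hx
    simp [hx]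
  have h2 : ∫ x, (if x ∈ u then (-1 : ℝ) else 1) * f x ∂G.toJordanDecomposition.negPart
      = - ∫ x, f x ∂G.toJordanDecomposition.negPart := by
    rw [← integral_neg]
    refine integral_congr_ae ?_
    have : ∀ᵐ x ∂G.toJordanDecomposition.negPart, x ∈ u := by
      simpa [ae_iff] using! hneg
    filter_upwards [this] with x hx
    simp [hx]
  rw [variation_eq_jordan] at hf ⊢
  rw [h1, h2, integral_add_measure hf.left_of_add_measure hf.right_of_add_measure]
  ring

theorem integrable_variation_withDensity {μ : Measure S} {g f : S → ℝ} (hg : Integrable g μ)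
    (hf : Measurable f) (hfg : Integrable (fun x => f x * g x) μ) :
    Integrable f (μ.withDensityᵥ g).variation := by
  rw [Measure.variation_withDensityᵥ hg]
  rw [integrable_withDensity_iff_integrable_smul₀' hg.aestronglyMeasurable.enorm (by simp)]
  refine hfg.norm.mono' ?_ ?_
  · exact (hg.aestronglyMeasurable.norm).smul hf.aestronglyMeasurable |>.congr (by simp; rfl)
  · refine Eventually.of_forall fun x => ?_
    simp [mul_comm]

theorem sint_withDensity {μ : Measure S} {g f : S → ℝ} (hg : Integrable g μ) (hf : Measurable f)
    (hfg : Integrable (fun x => f x * g x) μ) :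
    sint (μ.withDensityᵥ g) f = ∫ x, f x * g x ∂μ := by
  have hp : IsFiniteMeasure (μ.withDensity fun x => ENNReal.ofReal (g x)) :=
    isFiniteMeasure_withDensity_ofReal hg.2
  have hn : IsFiniteMeasure (μ.withDensity fun x => ENNReal.ofReal (-g x)) :=
    isFiniteMeasure_withDensity_ofReal hg.neg.2
  have key : ∀ h : S → ℝ, Integrable h μ → (∀ x, |h x| ≤ |g x|) →
      Integrable f (μ.withDensity fun x => ENNReal.ofReal (h x)) ∧
      Integrable (fun x => max (h x) 0 * f x) μ ∧
      ∫ x, f x ∂(μ.withDensity fun x => ENNReal.ofReal (h x)) = ∫ x, max (h x) 0 * f x ∂μ := by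
    intro h hh hle
    have hm := hh.aestronglyMeasurable.aemeasurable
    have hi : Integrable (fun x => max (h x) 0 * f x) μ := by
      refine hfg.norm.mono' ((hm.max aemeasurable_const).mul hf.aemeasurable).aestronglyMeasurable
        (Eventually.of_forall fun x => ?_)
      rw [norm_mul, norm_mul, mul_comm]
      refine mul_le_mul_of_nonneg_left ?_ (norm_nonneg _)
      rw [Real.norm_eq_abs, Real.norm_eq_abs, abs_of_nonneg (le_max_right _ _)]
      exact max_le ((le_abs_self _).trans (hle x)) (abs_nonneg _)
    refine ⟨?_, hi, ?_⟩
    · rw [integrable_withDensity_iff_integrable_smul₀' hm.ennreal_ofReal (by simp)]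
      simpa [ENNReal.toReal_ofReal'] using hi
    · rw [integral_withDensity_eq_integral_toReal_smul₀ hm.ennreal_ofReal (by simp)]
      simp [ENNReal.toReal_ofReal']
  obtain ⟨i1, j1, e1⟩ := key g hg fun _ => le_rfl
  obtain ⟨i2, j2, e2⟩ := key (fun x => -g x) hg.neg fun x => by simp
  rw [withDensityᵥ_eq_withDensity_pos_part_sub_withDensity_neg_part hg, sint_sub_left (by simpa)
    (by simpa), sint_toSignedMeasure, sint_toSignedMeasure, e1, e2, ← integral_sub j1 j2]
  refine integral_congr_ae (Eventually.of_forall fun x => ?_)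
  change max (g x) 0 * f x - max (-g x) 0 * f x = f x * g x
  rw [← sub_mul, max_zero_sub_max_neg_zero_eq_self, mul_comm]

/-! ### The class of test functions -/

section Phi

variable {P : ProbabilityMeasure S} {b : ℕ → ℝ}

theorem mem_Phi_iff (hb : Normalizing b) {f : S → ℝ} :
    f ∈ Phi P b ↔ Measurable f ∧ MemLp f 2 (P : Measure S) ∧
      SuperSmall b (fun n => (n : ℝ≥0∞) * (P : Measure S) {x | (b n)⁻¹ < |f x|}) := by
  rw [superSmall_iff_tendsto_scaledLog hb]
  rfl

theorem Phi.of_abs_le (hb : Normalizing b) {f g : S → ℝ} (hf : f ∈ Phi P b) (hg : Measurable g)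
    (hle : ∀ x, |g x| ≤ |f x|) : g ∈ Phi P b := by
  rw [mem_Phi_iff hb] at hf ⊢
  refine ⟨hg, hf.2.1.mono hg.aestronglyMeasurable (Eventually.of_forall hle),
    hf.2.2.mono (Eventually.of_forall fun n => ?_)⟩
  exact mul_le_mul_right (measure_mono fun x hx => lt_of_lt_of_le hx (hle x)) _

theorem Phi.sup (hb : Normalizing b) {f g : S → ℝ} (hf : f ∈ Phi P b) (hg : g ∈ Phi P b) :
    (fun x => max |f x| |g x|) ∈ Phi P b := by
  rw [mem_Phi_iff hb] at hf hg ⊢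
  have hm : Measurable fun x => max |f x| |g x| := hf.1.abs.max hg.1.abs
  refine ⟨hm, (hf.2.1.abs.add hg.2.1.abs).mono hm.aestronglyMeasurable
    (Eventually.of_forall fun x => ?_), (hf.2.2.add hb hg.2.2).mono
    (Eventually.of_forall fun n => ?_)⟩
  · have h1 := abs_nonneg (f x)
    have h2 := abs_nonneg (g x)
    simp only [Pi.add_apply, Pi.abs_apply, Real.norm_eq_abs]
    rw [abs_of_nonneg (le_max_of_le_left h1), abs_of_nonneg (add_nonneg h1 h2)]
    exact max_le (by linarith) (by linarith)
  · rw [← mul_add]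
    gcongr
    refine (measure_mono ?_).trans (measure_union_le _ _)
    intro x hx
    simp only [Set.mem_ofPred_eq, Set.mem_union] at hx ⊢
    rw [abs_of_nonneg (le_max_of_le_left (abs_nonneg _))] at hx
    exact lt_max_iff.1 hx

theorem Phi.of_bounded (hb : Normalizing b) {f : S → ℝ} (hf : Measurable f) {C : ℝ}
    (hC : ∀ x, |f x| ≤ C) : f ∈ Phi P b := by
  rw [mem_Phi_iff hb]
  refine ⟨hf, MemLp.of_bound hf.aestronglyMeasurable C (Eventually.of_forall hC), fun a => ?_⟩
  filter_upwards [hb.inv_tendsto.eventually_ge_atTop C] with n hn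
  have : {x | (b n)⁻¹ < |f x|} = ∅ := by
    ext x
    simpa using (hC x).trans hn
  simp [this]

theorem Phi.exists_dominating (hb : Normalizing b) (J : Finset (S → ℝ))
    (hJ : ∀ f ∈ J, f ∈ Phi P b) :
    ∃ F ∈ Phi P b, (∀ x, 1 ≤ F x) ∧ ∀ f ∈ J, ∀ x, |f x| ≤ F x := by
  classical
  induction J using Finset.induction_on with
  | empty =>
    exact ⟨fun _ => 1, Phi.of_bounded hb measurable_const (C := 1) (by simp), by simp, by simp⟩
  | insert g J hg ih =>
    obtain ⟨F, hF, h1, hJF⟩ := ih fun f hf => hJ f (Finset.mem_insert_of_mem hf)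
    refine ⟨_, Phi.sup hb hF (hJ g (Finset.mem_insert_self _ _)),
      fun x => le_max_of_le_left ((h1 x).trans (le_abs_self _)), fun f hf x => ?_⟩
    rcases Finset.mem_insert.1 hf with rfl | hf
    · exact le_max_right _ _
    · exact le_max_of_le_left ((hJF f hf x).trans (le_abs_self _))

end Phi

/-! ### Uniform integrability of a setwise convergent sequence of signed measures -/

theorem integrable_of_abs_le {μ : Measure S} {F h : S → ℝ} (hF : Integrable F μ)
    (hh : Measurable h) (hle : ∀ x, |h x| ≤ F x) : Integrable h μ :=
  hF.mono' hh.aestronglyMeasurable (Eventually.of_forall hle)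

theorem tendsto_setIntegral_gt_atTop {μ : Measure S} {F h : S → ℝ} (hFm : Measurable F)
    (hh : Integrable h μ) :
    Tendsto (fun T : ℝ => ∫ x in {x | T < F x}, h x ∂μ) atTop (𝓝 0) := by
  have hm : ∀ T : ℝ, MeasurableSet {x | T < F x} := fun T => measurableSet_lt measurable_const hFm
  have := tendsto_integral_filter_of_dominated_convergence (μ := μ) (l := atTop)
    (F := fun (T : ℝ) x => {x | T < F x}.indicator h x) (f := fun _ => (0 : ℝ)) (fun x => ‖h x‖)
    (Eventually.of_forall fun T => hh.aestronglyMeasurable.indicator (hm T))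
    (Eventually.of_forall fun T => Eventually.of_forall fun x => norm_indicator_le_norm_self _ _)
    hh.norm
    (Eventually.of_forall fun x => tendsto_const_nhds.congr' <| by
      filter_upwards [eventually_ge_atTop (F x)] with T hT
      rw [Set.indicator_of_notMem]
      simpa using hT)
  simpa [integral_indicator, hm] using this

theorem exists_gliding_hump {F : S → ℝ} (hFm : Measurable F) (hF0 : ∀ x, 0 ≤ F x)
    (D : ℕ → SignedMeasure S) (hD : ∀ n, Integrable F (D n).variation)
    (hlim : ∀ h : S → ℝ, Measurable h → (∀ x, |h x| ≤ F x) →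
      Tendsto (fun n => sint (D n) h) atTop (𝓝 0))
    {ε : ℝ} (hε : 0 < ε)
    (hbig : ∀ T : ℝ, ∃ᶠ n in atTop, ε < ∫ x in {x | T < F x}, F x ∂(D n).variation)
    (N : ℕ) (T : ℝ) (A : S → ℝ) (hA : Measurable A) (hAF : ∀ x, |A x| ≤ F x)
    (hA0 : ∀ x, T < F x → A x = 0) :
    ∃ (n : ℕ) (T' : ℝ) (A' : S → ℝ), N ≤ n ∧ T + 1 ≤ T' ∧ Measurable A' ∧ (∀ x, |A' x| ≤ F x) ∧
      (∀ x, T' < F x → A' x = 0) ∧ (∀ x, F x ≤ T → A' x = A x) ∧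
      ∀ h : S → ℝ, Measurable h → (∀ x, |h x| ≤ F x) → (∀ x, F x ≤ T' → h x = A' x) →
        ε / 4 ≤ sint (D n) h := by
  classical
  have h1 : ∀ᶠ n in atTop, |sint (D n) A| < ε / 4 := by
    have := (hlim A hA hAF).abs
    rw [abs_zero] at this
    exact this.eventually_lt_const (by linarith)
  obtain ⟨n, ⟨hnb, hnA⟩, hnN⟩ := (((hbig T).and_eventually h1).and_eventually
    (eventually_ge_atTop N)).exists
  obtain ⟨T', hT', hTT'⟩ := (((tendsto_setIntegral_gt_atTop hFm (hD n)).eventually_lt_const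
    (show (0 : ℝ) < ε / 8 by linarith)).and (eventually_ge_atTop (T + 1))).exists
  obtain ⟨s, hs, hs1, hsint⟩ := exists_sign (D n)
  set μ := (D n).variation with hμ
  set B : S → ℝ := fun x => if T < F x ∧ F x ≤ T' then s x * F x else 0 with hB
  have hmid : MeasurableSet {x | T < F x ∧ F x ≤ T'} :=
    (measurableSet_lt measurable_const hFm).inter (measurableSet_le hFm measurable_const)
  have hBm : Measurable B := Measurable.ite hmid (hs.mul hFm) measurable_const
  have hBF : ∀ x, |B x| ≤ F x := by
    intro x
    simp only [hB]
    split_ifs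
    · rw [abs_mul, abs_of_nonneg (hF0 x)]
      exact mul_le_of_le_one_left (hF0 x) (hs1 x)
    · simpa using hF0 x
  have hsum : ∀ x, |A x + B x| ≤ F x := by
    intro x
    by_cases hx : T < F x
    · rw [hA0 x hx, zero_add]; exact hBF x
    · have : B x = 0 := by simp [hB, hx]
      rw [this, add_zero]; exact hAF x
  refine ⟨n, T', fun x => A x + B x, hnN, hTT', hA.add hBm, hsum, ?_, ?_, ?_⟩
  · intro x hx
    have h2 : B x = 0 := by simp [hB, not_le.2 hx]
    beta_reduce
    rw [h2, hA0 x (by linarith), add_zero]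
  · intro x hx
    have h2 : B x = 0 := by simp [hB, not_lt.2 hx]
    beta_reduce
    rw [h2, add_zero]
  · intro h hh hhF hhA
    have iA : Integrable A μ := integrable_of_abs_le (hD n) hA hAF
    have iB : Integrable B μ := integrable_of_abs_le (hD n) hBm hBF
    have ih : Integrable h μ := integrable_of_abs_le (hD n) hh hhF
    have iAB : Integrable (fun x => A x + B x) μ := iA.add iB
    have e1 : sint (D n) (fun x => h x - (A x + B x)) = sint (D n) h
        - (sint (D n) A + sint (D n) B) := by
      rw [sint_sub ih iAB, sint_add iA iB]
    have e2 : |sint (D n) (fun x => h x - (A x + B x))| ≤ ε / 4 := by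
      refine (abs_sint_le _ _).trans ?_
      calc ∫ x, |h x - (A x + B x)| ∂μ
          ≤ ∫ x, {x | T' < F x}.indicator (fun x => 2 * F x) x ∂μ := by
            refine integral_mono (ih.sub iAB).abs
              (((hD n).const_mul 2).indicator (measurableSet_lt measurable_const hFm)) fun x => ?_
            by_cases hx : T' < F x
            · rw [Set.indicator_of_mem (show x ∈ {x | T' < F x} from hx)]
              refine (abs_sub _ _).trans ?_
              linarith [hhF x, hsum x]
            · rw [Set.indicator_of_notMem (show x ∉ {x | T' < F x} from hx),
                hhA x (not_lt.1 hx)]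
              simp
        _ = 2 * ∫ x in {x | T' < F x}, F x ∂μ := by
            rw [integral_indicator (measurableSet_lt measurable_const hFm), integral_const_mul]
        _ ≤ ε / 4 := by linarith
    have e3 : sint (D n) B = ∫ x in {x | T < F x}, F x ∂μ - ∫ x in {x | T' < F x}, F x ∂μ := by
      have : B = fun x => s x * ({x | T < F x ∧ F x ≤ T'}.indicator F x) := by
        ext x
        simp only [hB, Set.indicator_apply, Set.mem_ofPred_eq]
        split_ifs <;> simp
      rw [this, hsint _ ((hD n).indicator hmid), integral_indicator hmid]
      have hsplit : {x | T < F x} = {x | T < F x ∧ F x ≤ T'} ∪ {x | T' < F x} := by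
        ext x
        simp only [Set.mem_ofPred_eq, Set.mem_union]
        constructor
        · intro hx
          by_cases h' : F x ≤ T'
          · exact Or.inl ⟨hx, h'⟩
          · exact Or.inr (not_le.1 h')
        · rintro (hx | hx)
          · exact hx.1
          · linarith
      rw [hsplit, setIntegral_union _ (measurableSet_lt measurable_const hFm)
        (hD n).integrableOn (hD n).integrableOn]
      · ring
      · rw [Set.disjoint_left]
        rintro x ⟨_, h2⟩ h3
        exact absurd h3 (not_lt.2 h2)
    have e4 := abs_le.1 e2
    have e5 := abs_lt.1 hnA
    rw [e1] at e4
    linarith [e4.1, e5.1]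

theorem eventually_tail_le_of_tendsto_zero {F : S → ℝ} (hFm : Measurable F) (hF0 : ∀ x, 0 ≤ F x)
    (D : ℕ → SignedMeasure S) (hD : ∀ n, Integrable F (D n).variation)
    (hlim : ∀ h : S → ℝ, Measurable h → (∀ x, |h x| ≤ F x) →
      Tendsto (fun n => sint (D n) h) atTop (𝓝 0))
    {ε : ℝ} (hε : 0 < ε) :
    ∃ T : ℝ, ∀ᶠ n in atTop, ∫ x in {x | T < F x}, F x ∂(D n).variation ≤ ε := by
  classical
  by_contra hcon
  have hbig : ∀ T : ℝ, ∃ᶠ n in atTop, ε < ∫ x in {x | T < F x}, F x ∂(D n).variation := by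
    intro T
    exact (not_eventually.1 fun h => hcon ⟨T, h⟩).mono fun n hn => not_le.1 hn
  let Adm := {p : ℝ × (S → ℝ) // Measurable p.2 ∧ (∀ x, |p.2 x| ≤ F x) ∧
    ∀ x, p.1 < F x → p.2 x = 0}
  have step : ∀ (N : ℕ) (p : Adm), ∃ q : Adm, p.1.1 + 1 ≤ q.1.1 ∧
      (∀ x, F x ≤ p.1.1 → q.1.2 x = p.1.2 x) ∧ ∃ n, N ≤ n ∧
      ∀ h : S → ℝ, Measurable h → (∀ x, |h x| ≤ F x) → (∀ x, F x ≤ q.1.1 → h x = q.1.2 x) →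
        ε / 4 ≤ sint (D n) h := by
    rintro N ⟨⟨T, A⟩, hA, hAF, hA0⟩
    obtain ⟨n, T', A', hn, hT, hA', hAF', hA0', hAA, hh⟩ :=
      exists_gliding_hump hFm hF0 D hD hlim hε hbig N T A hA hAF hA0
    exact ⟨⟨⟨T', A'⟩, hA', hAF', hA0'⟩, hT, hAA, n, hn, hh⟩
  choose next hnext1 hnext2 hnext3 using step
  let p0 : Adm := ⟨(0, fun _ => 0), measurable_const, by simpa using hF0, by simp⟩
  let p : ℕ → Adm := fun j => Nat.rec p0 (fun i q => next i q) j
  have hp : ∀ j, p (j + 1) = next j (p j) := fun j => rfl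
  have hT : ∀ j : ℕ, (j : ℝ) ≤ (p j).1.1 := by
    intro j
    induction j with
    | zero => simp [p, p0]
    | succ j ih =>
      rw [hp]
      push_cast
      linarith [hnext1 j (p j)]
  have hmono : ∀ i j, i ≤ j → (p i).1.1 ≤ (p j).1.1 := by
    intro i j hij
    induction j, hij using Nat.le_induction with
    | base => exact le_rfl
    | succ j _ ih => rw [hp]; linarith [hnext1 j (p j)]
  have hagree : ∀ i j, i ≤ j → ∀ x, F x ≤ (p i).1.1 → (p j).1.2 x = (p i).1.2 x := by
    intro i j hij x hx
    induction j, hij using Nat.le_induction with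
    | base => rfl
    | succ j hij ih => rw [hp, hnext2 j (p j) x (hx.trans (hmono i j hij)), ih]
  let h : S → ℝ := fun x => (p ⌈F x⌉₊).1.2 x
  have hh : ∀ j x, F x ≤ (p j).1.1 → h x = (p j).1.2 x := by
    intro j x hx
    have h1 : F x ≤ (p ⌈F x⌉₊).1.1 := (Nat.le_ceil _).trans (hT _)
    rcases le_total j ⌈F x⌉₊ with hj | hj
    · exact hagree _ _ hj x hx
    · exact (hagree _ _ hj x h1).symm
  have hhm : Measurable h := by
    refine measurable_of_tendsto_metrizable (f := fun j => (p j).1.2) (fun j => (p j).2.1) ?_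
    rw [tendsto_pi_nhds]
    intro x
    refine tendsto_const_nhds.congr' ?_
    filter_upwards [eventually_ge_atTop ⌈F x⌉₊] with j hj
    exact hh j x ((Nat.le_ceil _).trans ((hT _).trans (hmono _ _ hj)))
  have hhF : ∀ x, |h x| ≤ F x := fun x => (p ⌈F x⌉₊).2.2.1 x
  obtain ⟨N, hN⟩ := eventually_atTop.1
    ((hlim h hhm hhF).eventually_lt_const (show (0 : ℝ) < ε / 4 by linarith))
  obtain ⟨n, hn, hnh⟩ := hnext3 N (p N)
  have := hnh h hhm hhF (fun x hx => hh (N + 1) x hx)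
  linarith [hN n hn]

/-! ### Triangular arrays -/

/-- A triangular array of laws `Q n` that is close to `P`, as seen by functions dominated by
multiples of `F` and truncated to `{F ≤ b_n⁻¹}`. -/
structure RegularArray (P : Measure S) (b : ℕ → ℝ) (Q : ℕ → Measure S) (F : S → ℝ) : Prop where
  normalizing : Normalizing b
  meas : Measurable F
  one_le : ∀ x, 1 ≤ F x
  sq : Integrable (fun x => F x ^ 2) P
  tail : SuperSmall b (fun n => (n : ℝ≥0∞) * Q n {x | (b n)⁻¹ < F x})
  unif : ∀ ε > 0, ∃ T : ℝ, ∀ᶠ n in atTop,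
    ∫ x in {x | T < F x ∧ F x ≤ (b n)⁻¹}, F x ^ 2 ∂Q n ≤ ε
  bdd : ∀ h : S → ℝ, Measurable h → (∃ C, ∀ x, |h x| ≤ C) →
    Tendsto (fun n => ∫ x, h x ∂Q n) atTop (𝓝 (∫ x, h x ∂P))

/-- A function bounded on a measurable set is integrable there. -/
theorem integrableOn_of_bound {μ : Measure S} [IsFiniteMeasure μ] {s : Set S}
    (hs : MeasurableSet s) {f : S → ℝ} (hf : Measurable f) {C : ℝ} (hC : ∀ x ∈ s, |f x| ≤ C) :
    IntegrableOn f s μ :=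
  IntegrableOn.of_bound (measure_lt_top _ _) hf.aestronglyMeasurable C
    ((ae_restrict_iff' hs).2 (Eventually.of_forall hC))

namespace RegularArray

variable {P : Measure S} {b : ℕ → ℝ} {Q : ℕ → Measure S} {F : S → ℝ}

theorem measurableSet_trunc (h : RegularArray P b Q F) (n : ℕ) :
    MeasurableSet {x | F x ≤ (b n)⁻¹} := measurableSet_le h.meas measurable_const

theorem integrable_of_le_sq (h : RegularArray P b Q F) {ψ : S → ℝ} (hψ : Measurable ψ) {C : ℝ}
    (hC : ∀ x, |ψ x| ≤ C * F x ^ 2) : Integrable ψ P :=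
  integrable_of_abs_le (h.sq.const_mul C) hψ hC

theorem le_sq (h : RegularArray P b Q F) (x : S) : F x ≤ F x ^ 2 := by
  nlinarith [h.one_le x]

theorem one_le_sq (h : RegularArray P b Q F) (x : S) : 1 ≤ F x ^ 2 := by
  nlinarith [h.one_le x]

/-- Convergence of truncated integrals along the array. -/
theorem tendsto_setIntegral [IsProbabilityMeasure P] [∀ n, IsProbabilityMeasure (Q n)]
    (h : RegularArray P b Q F) {ψ : ℕ → S → ℝ} {φ : S → ℝ} {C : ℝ}
    (hψm : ∀ n, Measurable (ψ n)) (hφm : Measurable φ)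
    (hψ : ∀ᶠ n in atTop, ∀ x, F x ≤ (b n)⁻¹ → |ψ n x| ≤ C * F x ^ 2)
    (hφ : ∀ x, |φ x| ≤ C * F x ^ 2)
    (hlim : ∀ T ε : ℝ, 0 < ε → ∀ᶠ n in atTop, ∀ x, F x ≤ T → |ψ n x - φ x| ≤ ε) :
    Tendsto (fun n => ∫ x in {x | F x ≤ (b n)⁻¹}, ψ n x ∂Q n) atTop (𝓝 (∫ x, φ x ∂P)) := by
  have hFm := h.meas
  rcases isEmpty_or_nonempty S with hS | ⟨⟨x₀⟩⟩
  · have : P Set.univ = 0 := by simp [Set.eq_empty_of_isEmpty]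
    simp at this
  have hC0 : 0 ≤ C := by
    have h1 := (abs_nonneg _).trans (hφ x₀)
    exact nonneg_of_mul_nonneg_left h1 (by linarith [h.one_le_sq x₀])
  rw [Metric.tendsto_atTop']
  intro ε hε
  set δ := ε / (4 * (C + 1)) with hδ
  have hδ0 : 0 < δ := by positivity
  have hCδ : C * δ ≤ ε / 4 := by
    rw [hδ, ← mul_div_assoc, div_le_div_iff₀ (by positivity) (by positivity)]
    nlinarith
  have hδε : δ ≤ ε / 4 := by
    rw [hδ, div_le_div_iff₀ (by positivity) (by positivity)]
    nlinarith
  obtain ⟨T₁, hT₁⟩ := h.unif δ hδ0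
  obtain ⟨T, hT, hTT₁⟩ := (((tendsto_setIntegral_gt_atTop hFm h.sq).eventually_lt_const hδ0).and
    (eventually_ge_atTop T₁)).exists
  have hA : MeasurableSet {x | F x ≤ T} := measurableSet_le hFm measurable_const
  have hφA : ∀ x ∈ {x | F x ≤ T}, |φ x| ≤ C * T ^ 2 := by
    intro x hx
    refine (hφ x).trans (mul_le_mul_of_nonneg_left ?_ hC0)
    exact pow_le_pow_left₀ (by linarith [h.one_le x]) hx 2
  have hbdd := h.bdd ({x | F x ≤ T}.indicator φ) (hφm.indicator hA) ⟨C * T ^ 2, fun x => by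
    by_cases hx : x ∈ {x | F x ≤ T}
    · rw [Set.indicator_of_mem hx]; exact hφA x hx
    · rw [Set.indicator_of_notMem hx, abs_zero]; positivity⟩
  have hbdd' := Metric.tendsto_nhds.1 hbdd (ε / 4) (by linarith)
  obtain ⟨N, hN⟩ := eventually_atTop.1 (((hT₁.and hψ).and ((hlim T δ hδ0).and hbdd')).and
    (h.normalizing.inv_tendsto.eventually_ge_atTop T))
  refine ⟨N, fun n hn => ?_⟩
  obtain ⟨⟨⟨h1, h2⟩, h3, h4⟩, h5⟩ := hN n (le_of_lt hn)
  have hB : MeasurableSet {x | T < F x ∧ F x ≤ (b n)⁻¹} :=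
    (measurableSet_lt measurable_const hFm).inter (measurableSet_le hFm measurable_const)
  have hB1 : MeasurableSet {x | T₁ < F x ∧ F x ≤ (b n)⁻¹} :=
    (measurableSet_lt measurable_const hFm).inter (measurableSet_le hFm measurable_const)
  have hsplit : {x | F x ≤ (b n)⁻¹} = {x | F x ≤ T} ∪ {x | T < F x ∧ F x ≤ (b n)⁻¹} := by
    ext x
    simp only [Set.mem_ofPred_eq, Set.mem_union]
    constructor
    · intro hx
      rcases le_or_gt (F x) T with h' | h'
      · exact Or.inl h'
      · exact Or.inr ⟨h', hx⟩
    · rintro (hx | hx)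
      · exact hx.trans h5
      · exact hx.2
  have hdisj : Disjoint {x | F x ≤ T} {x | T < F x ∧ F x ≤ (b n)⁻¹} := by
    rw [Set.disjoint_left]
    rintro x hx ⟨hx', _⟩
    exact absurd hx (not_le.2 hx')
  have hsqb : ∀ x, F x ≤ (b n)⁻¹ → F x ^ 2 ≤ (b n)⁻¹ ^ 2 := fun x hx =>
    pow_le_pow_left₀ (by linarith [h.one_le x]) hx 2
  have iψA : IntegrableOn (ψ n) {x | F x ≤ T} (Q n) :=
    integrableOn_of_bound hA (hψm n) (C := C * (b n)⁻¹ ^ 2) fun x hx =>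
      (h2 x (le_trans hx h5)).trans (mul_le_mul_of_nonneg_left (hsqb x (le_trans hx h5)) hC0)
  have iψB : IntegrableOn (ψ n) {x | T < F x ∧ F x ≤ (b n)⁻¹} (Q n) :=
    integrableOn_of_bound hB (hψm n) (C := C * (b n)⁻¹ ^ 2) fun x hx =>
      (h2 x hx.2).trans (mul_le_mul_of_nonneg_left (hsqb x hx.2) hC0)
  have iφA : IntegrableOn φ {x | F x ≤ T} (Q n) := integrableOn_of_bound hA hφm hφA
  have iF : ∀ T', IntegrableOn (fun x => F x ^ 2) {x | T' < F x ∧ F x ≤ (b n)⁻¹} (Q n) := by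
    intro T'
    refine integrableOn_of_bound ((measurableSet_lt measurable_const hFm).inter
      (measurableSet_le hFm measurable_const)) (hFm.pow_const 2) (C := (b n)⁻¹ ^ 2) fun x hx => ?_
    rw [abs_of_nonneg (sq_nonneg _)]
    exact hsqb x hx.2
  have iφ : Integrable φ P := h.integrable_of_le_sq hφm hφ
  rw [hsplit, setIntegral_union hdisj hB iψA iψB, Real.dist_eq]
  have e1 : |∫ x in {x | F x ≤ T}, ψ n x ∂Q n - ∫ x in {x | F x ≤ T}, φ x ∂Q n| ≤ ε / 4 := by
    rw [← integral_sub iψA iφA, ← Real.norm_eq_abs]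
    refine (norm_setIntegral_le_of_norm_le_const (C := δ) (measure_lt_top _ _)
      (fun x hx => h3 x hx)).trans ?_
    exact (mul_le_of_le_one_right hδ0.le measureReal_le_one).trans hδε
  have e2 : |∫ x in {x | T < F x ∧ F x ≤ (b n)⁻¹}, ψ n x ∂Q n| ≤ ε / 4 := by
    rw [← Real.norm_eq_abs]
    calc _ ≤ ∫ x in {x | T < F x ∧ F x ≤ (b n)⁻¹}, C * F x ^ 2 ∂Q n := by
          refine norm_integral_le_of_norm_le ((iF T).const_mul C) ?_
          exact (ae_restrict_iff' hB).2 (Eventually.of_forall fun x hx => h2 x hx.2)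
      _ = C * ∫ x in {x | T < F x ∧ F x ≤ (b n)⁻¹}, F x ^ 2 ∂Q n := integral_const_mul _ _
      _ ≤ C * δ := by
          refine mul_le_mul_of_nonneg_left (le_trans ?_ h1) hC0
          refine setIntegral_mono_set (iF T₁) (Eventually.of_forall fun x => sq_nonneg _) ?_
          exact Eventually.of_forall fun x hx => ⟨lt_of_le_of_lt hTT₁ hx.1, hx.2⟩
      _ ≤ ε / 4 := hCδ
  have e3 : |∫ x in {x | F x ≤ T}, φ x ∂Q n - ∫ x in {x | F x ≤ T}, φ x ∂P| < ε / 4 := by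
    rw [Real.dist_eq, integral_indicator hA, integral_indicator hA] at h4
    exact h4
  have e4 : |∫ x, φ x ∂P - ∫ x in {x | F x ≤ T}, φ x ∂P| ≤ ε / 4 := by
    have hc : {x | F x ≤ T}ᶜ = {x | T < F x} := by
      ext x
      simp
    rw [← integral_add_compl hA iφ, add_sub_cancel_left, hc, ← Real.norm_eq_abs]
    calc _ ≤ ∫ x in {x | T < F x}, C * F x ^ 2 ∂P := by
          refine norm_integral_le_of_norm_le (h.sq.integrableOn.const_mul C) ?_
          exact Eventually.of_forall fun x => hφ x
      _ = C * ∫ x in {x | T < F x}, F x ^ 2 ∂P := integral_const_mul _ _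
      _ ≤ C * δ := mul_le_mul_of_nonneg_left hT.le hC0
      _ ≤ ε / 4 := hCδ
  rw [abs_le] at e1 e2 e4
  rw [abs_lt] at e3 ⊢
  constructor <;> linarith [e1.1, e1.2, e2.1, e2.2, e3.1, e3.2, e4.1, e4.2]

end RegularArray

/-! ### The array of the moderate deviation setting is regular -/

section Assumptions

variable {P : ProbabilityMeasure S} {b : ℕ → ℝ} {Pn : ℕ → ProbabilityMeasure S}
  {Hn : ℕ → Lambda0 (Phi P b)} {H : Lambda0 (Phi P b)}

theorem continuous_sint {Φ : Set (S → ℝ)} {f : S → ℝ} (hf : f ∈ Φ) :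
    Continuous fun G : Lambda0 Φ => sint (G : SignedMeasure S) f :=
  (continuous_apply (A := fun _ : Φ => ℝ) (⟨f, hf⟩ : Φ)).comp
    (continuous_induced_dom (f := pairing Φ))

theorem AssumptionA.tendsto_sint (hA : AssumptionA P b Pn Hn H) {f : S → ℝ} (hf : f ∈ Phi P b) :
    Tendsto (fun n => sint (Hn n : SignedMeasure S) f) atTop (𝓝 (sint (H : SignedMeasure S) f)) :=
  ((continuous_sint hf).tendsto H).comp hA.tendsto

theorem integrable_of_mem_Phi (hb : Normalizing b) {f : S → ℝ} (hf : f ∈ Phi P b) :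
    Integrable f (P : Measure S) :=
  ((mem_Phi_iff hb).1 hf).2.1.integrable (by norm_num)

theorem AssumptionA.integral_eq (hA : AssumptionA P b Pn Hn H) (hb : Normalizing b) {n : ℕ}
    (hn : 1 ≤ n) {f : S → ℝ} (hf : f ∈ Phi P b) :
    ∫ x, f x ∂(Pn n : Measure S) = ∫ x, f x ∂(P : Measure S) + b n * sint (Hn n) f := by
  have h1 : Integrable f (P : Measure S) := integrable_of_mem_Phi hb hf
  rw [← sint_toSignedMeasure, hA.eq_add n hn, sint_add_left (by simpa using h1) ?_,
    sint_toSignedMeasure, sint_smul_left]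
  exact VectorMeasure.Integrable.smul_vectorMeasure ((Hn n).2.2 f hf) (b n)

theorem AssumptionA.eventually_tail_le (hA : AssumptionA P b Pn Hn H) (hb : Normalizing b)
    {F : S → ℝ} (hF : F ∈ Phi P b) (hF0 : ∀ x, 0 ≤ F x) {ε : ℝ} (hε : 0 < ε) :
    ∃ T : ℝ, ∀ᶠ n in atTop,
      ∫ x in {x | T < F x}, F x ∂(Hn n : SignedMeasure S).variation ≤ ε := by
  have hFm := ((mem_Phi_iff hb).1 hF).1
  obtain ⟨T₁, hT₁⟩ := eventually_tail_le_of_tendsto_zero hFm hF0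
    (fun n => ((Hn n - H : Lambda0 (Phi P b)) : SignedMeasure S))
    (fun n => (Hn n - H).2.2 F hF) (fun h hh hle => by
      have hh' : h ∈ Phi P b := Phi.of_abs_le hb hF hh fun x => (hle x).trans (le_abs_self _)
      have := (hA.tendsto_sint hh').sub_const (sint (H : SignedMeasure S) h)
      rw [sub_self] at this
      refine this.congr fun n => ?_
      rw [Submodule.coe_sub, sint_sub_left ((Hn n).2.2 h hh') (H.2.2 h hh')]) (half_pos hε)
  obtain ⟨T, hT, hTT⟩ := (((tendsto_setIntegral_gt_atTop hFm (H.2.2 F hF)).eventually_le_const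
    (half_pos hε)).and (eventually_ge_atTop T₁)).exists
  refine ⟨T, ?_⟩
  filter_upwards [hT₁] with n hn
  set D : SignedMeasure S := ((Hn n - H : Lambda0 (Phi P b)) : SignedMeasure S)
  have hle : (Hn n : SignedMeasure S).variation ≤ D.variation
      + (H : SignedMeasure S).variation := by
    have : (Hn n : SignedMeasure S) = D + H := by simp [D]
    rw [this]
    exact VectorMeasure.variation_add_le
  have iD : Integrable F D.variation := (Hn n - H).2.2 F hF
  have iH : Integrable F (H : SignedMeasure S).variation := H.2.2 F hF
  calc _ ≤ ∫ x in {x | T < F x}, F x ∂(D.variation + (H : SignedMeasure S).variation) :=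
        integral_mono_measure (Measure.restrict_mono le_rfl hle)
          (Eventually.of_forall hF0) (iD.add_measure iH).integrableOn
    _ = ∫ x in {x | T < F x}, F x ∂D.variation
        + ∫ x in {x | T < F x}, F x ∂(H : SignedMeasure S).variation := by
        rw [Measure.restrict_add, integral_add_measure iD.integrableOn iH.integrableOn]
    _ ≤ ∫ x in {x | T₁ < F x}, F x ∂D.variation + ε / 2 := by
        refine add_le_add (setIntegral_mono_set iD.integrableOn (Eventually.of_forall hF0) ?_) hT
        exact Eventually.of_forall fun x hx => lt_of_le_of_lt hTT hx
    _ ≤ ε := by linarith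

theorem AssumptionA.measure_le (hA : AssumptionA P b Pn Hn H) (hb : Normalizing b) {n : ℕ}
    (hn : 1 ≤ n) {s : Set S} (hs : MeasurableSet s) :
    (Pn n : Measure S) s ≤ (P : Measure S) s
      + ENNReal.ofReal (b n) * (Hn n : SignedMeasure S).variation s := by
  have h := congrArg (fun G : SignedMeasure S => G s) (hA.eq_add n hn)
  simp only [Measure.toSignedMeasure_apply_measurable hs, FunLike.coe_add, FunLike.coe_smul,
    Pi.add_apply, Pi.smul_apply, smul_eq_mul] at h
  have h2 : (Hn n : SignedMeasure S) s ≤ (Hn n : SignedMeasure S).variation.real s :=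
    (Real.le_norm_self _).trans (VectorMeasure.norm_measure_le_variation (measure_ne_top _ _))
  have h3 : (Pn n : Measure S).real s ≤ (P : Measure S).real s
      + b n * (Hn n : SignedMeasure S).variation.real s := by
    rw [h]
    have := hb.pos n hn
    gcongr
  rw [← ofReal_measureReal (μ := (Pn n : Measure S)), ← ofReal_measureReal (μ := (P : Measure S)),
    ← ofReal_measureReal (μ := (Hn n : SignedMeasure S).variation),
    ← ENNReal.ofReal_mul (hb.pos n hn).le, ← ENNReal.ofReal_add measureReal_nonneg
      (mul_nonneg (hb.pos n hn).le measureReal_nonneg)]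
  exact ENNReal.ofReal_le_ofReal h3

theorem AssumptionA.superSmall_tail (hA : AssumptionA P b Pn Hn H) (hb : Normalizing b)
    (hB1 : AssumptionB1 P b Hn) {F : S → ℝ} (hF : F ∈ Phi P b) :
    SuperSmall b (fun n => (n : ℝ≥0∞) * (Pn n : Measure S) {x | (b n)⁻¹ < |F x|}) := by
  have hF' := (mem_Phi_iff hb).1 hF
  have h2 : SuperSmall b (fun n => ENNReal.ofReal (n * b n) *
      (Hn n : SignedMeasure S).variation {x | (b n)⁻¹ < |F x|}) := by
    intro a
    have : ∀ᶠ n : ℕ in atTop, (⨆ (m : ℕ) (_ : 1 ≤ m), scaledLog n (b n)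
      (ENNReal.ofReal (n * b n) * (Hn m : SignedMeasure S).variation {x | (b n)⁻¹ < |F x|}))
        < ((-a : ℝ) : EReal) := by
      refine eventually_lt_of_limsup_lt ?_
      rw [hB1 F hF]
      exact EReal.bot_lt_coe _
    filter_upwards [this, hb.eventually_speed_pos, eventually_ge_atTop 1] with n hn hpos hn1
    refine (scaledLog_le_iff hpos _ _).1 (le_trans ?_ hn.le)
    exact le_iSup₂_of_le n hn1 le_rfl
  refine (hF'.2.2.add hb h2).mono ?_
  filter_upwards [eventually_ge_atTop 1] with n hn
  have hm : MeasurableSet {x | (b n)⁻¹ < |F x|} := measurableSet_lt measurable_const hF'.1.abs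
  refine (mul_le_mul_right (hA.measure_le hb hn hm) _).trans ?_
  rw [mul_add, ← mul_assoc, ENNReal.ofReal_mul (by positivity), ENNReal.ofReal_natCast]

theorem AssumptionA.regularArray (hA : AssumptionA P b Pn Hn H) (hb : Normalizing b)
    (hB1 : AssumptionB1 P b Hn) {F : S → ℝ} (hF : F ∈ Phi P b) (hF1 : ∀ x, 1 ≤ F x) :
    RegularArray (P : Measure S) b (fun n => (Pn n : Measure S)) F := by
  have hF' := (mem_Phi_iff hb).1 hF
  have hF0 : ∀ x, 0 ≤ F x := fun x => zero_le_one.trans (hF1 x)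
  refine ⟨hb, hF'.1, hF1, hF'.2.1.integrable_sq, ?_, ?_, ?_⟩
  · simpa only [abs_of_nonneg (hF0 _)] using hA.superSmall_tail hb hB1 hF
  · intro ε hε
    obtain ⟨T₁, hT₁⟩ := hA.eventually_tail_le hb hF hF0 (half_pos hε)
    obtain ⟨T, hT, hTT⟩ := (((tendsto_setIntegral_gt_atTop hF'.1
      hF'.2.1.integrable_sq).eventually_le_const
      (half_pos hε)).and (eventually_ge_atTop T₁)).exists
    refine ⟨T, ?_⟩
    filter_upwards [hT₁, eventually_ge_atTop 1] with n hn hn1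
    have hbn := hb.pos n hn1
    have hB : MeasurableSet {x | T < F x ∧ F x ≤ (b n)⁻¹} :=
      (measurableSet_lt measurable_const hF'.1).inter (measurableSet_le hF'.1 measurable_const)
    have hmem : {x | T < F x ∧ F x ≤ (b n)⁻¹}.indicator (fun x => F x ^ 2) ∈ Phi P b := by
      refine Phi.of_bounded hb ((hF'.1.pow_const 2).indicator hB) (C := (b n)⁻¹ ^ 2) fun x => ?_
      by_cases hx : x ∈ {x | T < F x ∧ F x ≤ (b n)⁻¹}
      · rw [Set.indicator_of_mem hx, abs_of_nonneg (sq_nonneg _)]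
        exact pow_le_pow_left₀ (hF0 x) hx.2 2
      · rw [Set.indicator_of_notMem hx, abs_zero]
        positivity
    rw [← integral_indicator hB, hA.integral_eq hb hn1 hmem, integral_indicator hB]
    have e1 : ∫ x in {x | T < F x ∧ F x ≤ (b n)⁻¹}, F x ^ 2 ∂(P : Measure S) ≤ ε / 2 := by
      refine le_trans ?_ hT
      refine setIntegral_mono_set hF'.2.1.integrable_sq.integrableOn
        (Eventually.of_forall fun x => sq_nonneg _) (Eventually.of_forall fun x hx => hx.1)
    have iF : Integrable F (Hn n : SignedMeasure S).variation := (Hn n).2.2 F hF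
    have e2 : b n * sint (Hn n) ({x | T < F x ∧ F x ≤ (b n)⁻¹}.indicator (fun x => F x ^ 2))
        ≤ ε / 2 := by
      rw [← sint_const_mul]
      refine ((le_abs_self _).trans (abs_sint_le _ _)).trans (le_trans ?_ hn)
      rw [← integral_indicator (measurableSet_lt measurable_const hF'.1)]
      refine integral_mono_of_nonneg (Eventually.of_forall fun x => abs_nonneg _)
        (iF.indicator (measurableSet_lt measurable_const hF'.1)) (Eventually.of_forall fun x => ?_)
      beta_reduce
      by_cases hx : x ∈ {x | T < F x ∧ F x ≤ (b n)⁻¹}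
      · rw [Set.indicator_of_mem hx, Set.indicator_of_mem (show x ∈ {x | T₁ < F x} from
          lt_of_le_of_lt hTT hx.1), abs_of_nonneg (by positivity)]
        have : b n * F x ≤ 1 := by
          have := mul_le_mul_of_nonneg_left hx.2 hbn.le
          rwa [mul_inv_cancel₀ hbn.ne'] at this
        nlinarith [hF0 x]
      · rw [Set.indicator_of_notMem hx, mul_zero, abs_zero]
        exact Set.indicator_nonneg (fun x _ => hF0 x) x
    linarith
  · rintro h hm ⟨C, hC⟩
    have hmem : h ∈ Phi P b := Phi.of_bounded hb hm hC
    have := (hb.zero.mul (hA.tendsto_sint hmem)).const_add (∫ x, h x ∂(P : Measure S))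
    rw [zero_mul, add_zero] at this
    refine this.congr' ?_
    filter_upwards [eventually_ge_atTop 1] with n hn
    exact (hA.integral_eq hb hn hmem).symm

theorem integrable_variation_of_abs_le (G : Lambda0 (Phi P b))
    {F f : S → ℝ} (hF : F ∈ Phi P b) (hf : Measurable f) {C : ℝ} (hfC : ∀ x, |f x| ≤ C * F x) :
    Integrable f (G : SignedMeasure S).variation :=
  integrable_of_abs_le ((G.2.2 F hF).const_mul C) hf hfC

theorem div_mem_Phi (hb : Normalizing b) {F f : S → ℝ} (hF : F ∈ Phi P b) (hF0 : ∀ x, 0 ≤ F x)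
    (hf : Measurable f) {C : ℝ} (hC : 0 < C) (hfC : ∀ x, |f x| ≤ C * F x) :
    (fun x => C⁻¹ * f x) ∈ Phi P b := by
  refine Phi.of_abs_le hb hF (hf.const_mul _) fun x => ?_
  rw [abs_mul, abs_of_pos (inv_pos.2 hC), inv_mul_le_iff₀ hC, abs_of_nonneg (hF0 x)]
  exact hfC x

theorem AssumptionA.tendsto_drift (hA : AssumptionA P b Pn Hn H) (hb : Normalizing b)
    {F f : S → ℝ} (hF : F ∈ Phi P b) (hF0 : ∀ x, 0 ≤ F x)
    (hf : Measurable f) {C : ℝ} (hC : 0 < C) (hfC : ∀ x, |f x| ≤ C * F x) :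
    Tendsto (fun n => (∫ x in {x | F x ≤ (b n)⁻¹}, f x ∂(Pn n : Measure S)
      - ∫ x, f x ∂(P : Measure S)) / b n) atTop (𝓝 (sint (H : SignedMeasure S) f)) := by
  have hF' := (mem_Phi_iff hb).1 hF
  have hscale : ∀ (G : SignedMeasure S) (g : S → ℝ),
      sint G g = C * sint G (fun x => C⁻¹ * g x) := by
    intro G g
    rw [sint_const_mul, mul_inv_cancel_left₀ hC.ne']
  have hlim : Tendsto (fun n => sint (Hn n : SignedMeasure S) f) atTop
      (𝓝 (sint (H : SignedMeasure S) f)) := by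
    simp only [hscale _ f]
    exact (hA.tendsto_sint (div_mem_Phi hb hF hF0 hf hC hfC)).const_mul C
  have hms : ∀ n, MeasurableSet {x | (b n)⁻¹ < F x} := fun n =>
    measurableSet_lt measurable_const hF'.1
  have iF : Integrable F (P : Measure S) := integrable_of_mem_Phi hb hF
  have if' : Integrable f (P : Measure S) := integrable_of_abs_le (iF.const_mul C) hf hfC
  -- the part of the drift that is cut off
  have hcut : Tendsto (fun n => sint (Hn n : SignedMeasure S) ({x | (b n)⁻¹ < F x}.indicator f))
      atTop (𝓝 0) := by
    rw [Metric.tendsto_nhds]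
    intro ε hε
    obtain ⟨T, hT⟩ := hA.eventually_tail_le hb hF hF0 (show 0 < ε / (2 * C) by positivity)
    filter_upwards [hT, hb.inv_tendsto.eventually_ge_atTop T] with n hn hTn
    rw [Real.dist_eq, sub_zero]
    have iFn : Integrable F (Hn n : SignedMeasure S).variation := (Hn n).2.2 F hF
    have hTm : MeasurableSet {x | T < F x} := measurableSet_lt measurable_const hF'.1
    calc _ ≤ ∫ x, |{x | (b n)⁻¹ < F x}.indicator f x| ∂(Hn n : SignedMeasure S).variation :=
          abs_sint_le _ _
      _ ≤ ∫ x, {x | T < F x}.indicator (fun x => C * F x) x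
            ∂(Hn n : SignedMeasure S).variation := by
          refine integral_mono_of_nonneg (Eventually.of_forall fun x => abs_nonneg _)
            ((iFn.const_mul C).indicator hTm) (Eventually.of_forall fun x => ?_)
          beta_reduce
          by_cases hx : x ∈ {x | (b n)⁻¹ < F x}
          · rw [Set.indicator_of_mem hx, Set.indicator_of_mem (show x ∈ {x | T < F x} from
              lt_of_le_of_lt hTn hx)]
            exact hfC x
          · rw [Set.indicator_of_notMem hx, abs_zero]
            exact Set.indicator_nonneg (fun x _ => mul_nonneg hC.le (hF0 x)) x
      _ = C * ∫ x in {x | T < F x}, F x ∂(Hn n : SignedMeasure S).variation := by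
          rw [integral_indicator hTm, integral_const_mul]
      _ ≤ C * (ε / (2 * C)) := mul_le_mul_of_nonneg_left hn hC.le
      _ < ε := by
          have : C * (ε / (2 * C)) = ε / 2 := by field_simp
          linarith
  have hcutP : Tendsto (fun n => (∫ x in {x | (b n)⁻¹ < F x}, f x ∂(P : Measure S)) / b n)
      atTop (𝓝 0) := by
    have h0 := ((tendsto_setIntegral_gt_atTop hF'.1 hF'.2.1.integrable_sq).comp
      hb.inv_tendsto).const_mul C
    rw [mul_zero] at h0
    refine squeeze_zero_norm' ?_ h0
    filter_upwards [eventually_ge_atTop 1] with n hn1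
    have hbn := hb.pos n hn1
    rw [norm_div, Real.norm_eq_abs (b n), abs_of_pos hbn, div_le_iff₀ hbn, Function.comp_apply,
      mul_assoc, mul_comm _ (b n), ← mul_assoc, ← integral_const_mul]
    refine norm_integral_le_of_norm_le (hF'.2.1.integrable_sq.const_mul _).integrableOn ?_
    refine (ae_restrict_iff' (hms n)).2 (Eventually.of_forall fun x hx => (hfC x).trans ?_)
    have : 1 ≤ b n * F x := by
      have := mul_le_mul_of_nonneg_left (le_of_lt hx) hbn.le
      rwa [mul_inv_cancel₀ hbn.ne'] at this
    have h2 : F x ≤ b n * F x ^ 2 := by nlinarith [hF0 x]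
    nlinarith
  have := (hlim.sub hcut).sub hcutP
  rw [sub_zero, sub_zero] at this
  refine this.congr' ?_
  filter_upwards [eventually_ge_atTop 1] with n hn1
  have hbn := hb.pos n hn1
  have hc : {x | (b n)⁻¹ < F x} = {x | F x ≤ (b n)⁻¹}ᶜ := by
    ext x
    simp
  have ht : MeasurableSet {x | F x ≤ (b n)⁻¹} := measurableSet_le hF'.1 measurable_const
  have hdom : ∀ x, |{x | F x ≤ (b n)⁻¹}.indicator f x| ≤ C * F x := fun x => by
    refine le_trans ?_ (hfC x)
    exact norm_indicator_le_norm_self f x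
  have e1 : ∫ x in {x | F x ≤ (b n)⁻¹}, f x ∂(Pn n : Measure S)
      = ∫ x in {x | F x ≤ (b n)⁻¹}, f x ∂(P : Measure S)
        + b n * sint (Hn n) ({x | F x ≤ (b n)⁻¹}.indicator f) := by
    have hm := div_mem_Phi hb hF hF0 (hf.indicator ht) hC hdom
    have := hA.integral_eq hb hn1 hm
    rw [integral_const_mul, integral_const_mul, sint_const_mul, integral_indicator ht,
      integral_indicator ht] at this
    have h2 := congrArg (fun t => C * t) this
    simp only [mul_add] at h2
    rw [mul_inv_cancel_left₀ hC.ne', mul_inv_cancel_left₀ hC.ne',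
      mul_left_comm C (b n), mul_inv_cancel_left₀ hC.ne'] at h2
    exact h2
  have e2 : sint (Hn n : SignedMeasure S) ({x | F x ≤ (b n)⁻¹}.indicator f)
      = sint (Hn n : SignedMeasure S) f
        - sint (Hn n : SignedMeasure S) ({x | (b n)⁻¹ < F x}.indicator f) := by
    have i1 := integrable_variation_of_abs_le (Hn n) hF hf hfC
    rw [← sint_sub i1 (i1.indicator (hms n))]
    congr 1
    ext x
    rw [hc, Set.indicator_compl]
    simp
  rw [e1, e2, ← integral_add_compl ht if', ← hc]
  field_simp
  ring

end Assumptions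

/-! ### Elementary estimates for the exponential -/

theorem abs_exp_sub_one_sub_le (x : ℝ) : |Real.exp x - 1 - x| ≤ x ^ 2 * Real.exp |x| := by
  have h := Complex.norm_exp_sub_sum_le_norm_mul_exp (x : ℂ) 2
  simp only [Finset.sum_range_succ, Finset.sum_range_zero, pow_zero, Nat.factorial, pow_one,
    Nat.cast_one, div_one, zero_add, Nat.succ_eq_add_one, mul_one] at h
  rw [Complex.norm_real, Real.norm_eq_abs, sq_abs] at h
  rw [← Real.norm_eq_abs, ← Complex.norm_real]
  push_cast
  rwa [sub_sub]

theorem abs_exp_sub_quadratic_le (x : ℝ) :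
    |Real.exp x - 1 - x - x ^ 2 / 2| ≤ |x| ^ 3 * Real.exp |x| := by
  have h := Complex.norm_exp_sub_sum_le_norm_mul_exp (x : ℂ) 3
  simp only [Finset.sum_range_succ, Finset.sum_range_zero, pow_zero, Nat.factorial, pow_one,
    Nat.cast_one, div_one, zero_add, Nat.succ_eq_add_one, mul_one] at h
  rw [Complex.norm_real, Real.norm_eq_abs] at h
  rw [← Real.norm_eq_abs, ← Complex.norm_real]
  push_cast
  convert h using 2
  push_cast
  ring

theorem pow_le_exp_mul_sub_one {a : ℝ} (ha : 0 ≤ a) (N : ℕ) :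
    a ^ N ≤ Real.exp (N * (a - 1)) := by
  rw [Real.exp_nat_mul]
  exact pow_le_pow_left₀ ha (by linarith [Real.add_one_le_exp (a - 1)]) N

/-! ### Empirical means and product measures -/

/-- The empirical mean of `f` over the sample `x`. -/
def avg {n : ℕ} (x : Fin n → S) (f : S → ℝ) : ℝ := (n : ℝ)⁻¹ * ∑ i, f (x i)

theorem integral_empirical {n : ℕ} (x : Fin n → S) {f : S → ℝ} (hf : Measurable f) :
    ∫ y, f y ∂(empirical x) = avg x f := by
  rw [empirical, integral_smul_measure, integral_finsetSum_measure]
  · simp [avg, integral_dirac' _ _ hf.stronglyMeasurable]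
  · exact fun i _ => integrable_dirac' hf.stronglyMeasurable (by simp)

theorem integrable_empirical {n : ℕ} (x : Fin n → S) {f : S → ℝ} (hf : Measurable f) :
    Integrable f (empirical x) := by
  rcases Nat.eq_zero_or_pos n with rfl | hn
  · simp [empirical]
  · refine Integrable.smul_measure ?_ (by simp [hn.ne'])
    rw [integrable_finsetSum_measure]
    exact fun i _ => integrable_dirac' hf.stronglyMeasurable (by simp)

theorem measurable_avg {n : ℕ} {f : S → ℝ} (hf : Measurable f) :
    Measurable fun x : Fin n → S => avg x f :=
  (Finset.measurable_sum _ fun i _ => hf.comp (measurable_pi_apply i)).const_mul _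

theorem natCast_mul_avg {S : Type*} {n : ℕ} (hn : 1 ≤ n) (x : Fin n → S) (f : S → ℝ) :
    (n : ℝ) * avg x f = ∑ i, f (x i) := by
  have : (n : ℝ) ≠ 0 := by positivity
  rw [avg, mul_inv_cancel_left₀ this]

theorem avg_congr {S : Type*} {n : ℕ} {x : Fin n → S} {f g : S → ℝ} (h : ∀ i, f (x i) = g (x i)) :
    avg x f = avg x g := by
  simp [avg, h]

theorem avg_neg {S : Type*} {n : ℕ} (x : Fin n → S) (f : S → ℝ) :
    avg x (fun y => -f y) = -avg x f := by
  simp [avg]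

theorem lintegral_pi_exp {N : ℕ} (Q : Measure S) [IsProbabilityMeasure Q] {h : S → ℝ}
    (hexp : Integrable (fun x => Real.exp (h x)) Q) (c : ℝ) :
    ∫⁻ x : Fin N → S, ENNReal.ofReal (Real.exp (c + ∑ i, h (x i))) ∂(Measure.pi fun _ => Q)
      = ENNReal.ofReal (Real.exp c * (∫ x, Real.exp (h x) ∂Q) ^ N) := by
  have hi : Integrable (fun x : Fin N → S => ∏ i, Real.exp (h (x i))) (Measure.pi fun _ => Q) :=
    Integrable.fintype_prod fun _ => hexp
  have : ∀ x : Fin N → S, Real.exp (c + ∑ i, h (x i)) = Real.exp c * ∏ i, Real.exp (h (x i)) := by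
    intro x
    rw [Real.exp_add, Real.exp_sum]
  simp only [this]
  rw [← ofReal_integral_eq_lintegral_ofReal (hi.const_mul _)
    (Eventually.of_forall fun x => by positivity), integral_const_mul,
    integral_fintype_prod_eq_pow (fun x => Real.exp (h x)), Fintype.card_fin]

theorem chernoff {N : ℕ} (Q : Measure S) [IsProbabilityMeasure Q] {h : S → ℝ}
    (hexp : Integrable (fun x => Real.exp (h x)) Q) (c : ℝ) :
    Measure.pi (fun _ : Fin N => Q) {x | c ≤ ∑ i, h (x i)}
      ≤ ENNReal.ofReal (Real.exp (-c + N * (∫ x, Real.exp (h x) ∂Q - 1))) := by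
  calc Measure.pi (fun _ : Fin N => Q) {x | c ≤ ∑ i, h (x i)}
      ≤ Measure.pi (fun _ : Fin N => Q)
          {x | 1 ≤ ENNReal.ofReal (Real.exp (-c + ∑ i, h (x i)))} := by
        refine measure_mono fun x hx => ?_
        have hx' : c ≤ ∑ i, h (x i) := hx
        change (1 : ℝ≥0∞) ≤ _
        rw [← ENNReal.ofReal_one]
        exact ENNReal.ofReal_le_ofReal (Real.one_le_exp (by linarith))
    _ ≤ ∫⁻ x : Fin N → S, ENNReal.ofReal (Real.exp (-c + ∑ i, h (x i)))
          ∂(Measure.pi fun _ => Q) := by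
        have := mul_meas_ge_le_lintegral₀ (μ := Measure.pi (fun _ : Fin N => Q))
          (f := fun x => ENNReal.ofReal (Real.exp (-c + ∑ i, h (x i)))) (by
            have hae : AEMeasurable (fun x => Real.exp (h x)) Q :=
              hexp.aestronglyMeasurable.aemeasurable
            have : (fun x : Fin N → S => Real.exp (-c + ∑ i, h (x i)))
                = fun x => Real.exp (-c) * ∏ i, Real.exp (h (x i)) := by
              ext x
              rw [Real.exp_add, Real.exp_sum]
            refine AEMeasurable.ennreal_ofReal ?_
            rw [this]
            refine AEMeasurable.const_mul ?_ _
            refine Finset.aemeasurable_fun_prod _ fun i _ => ?_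
            exact hae.comp_quasiMeasurePreserving
              (measurePreserving_eval (fun _ : Fin N => Q) i).quasiMeasurePreserving) 1
        simpa using this
    _ ≤ _ := by
        rw [lintegral_pi_exp Q hexp]
        refine ENNReal.ofReal_le_ofReal ?_
        rw [Real.exp_add]
        exact mul_le_mul_of_nonneg_left (pow_le_exp_mul_sub_one
          (integral_nonneg fun _ => (Real.exp_pos _).le) N) (Real.exp_pos _).le

theorem pi_exists_le {N : ℕ} (Q : Measure S) [IsProbabilityMeasure Q] (s : Set S) :
    Measure.pi (fun _ : Fin N => Q) {x | ∃ i, x i ∈ s} ≤ N * Q s := by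
  have : {x : Fin N → S | ∃ i, x i ∈ s} = ⋃ i, {x | x i ∈ s} := by
    ext x
    simp
  rw [this]
  refine (measure_iUnion_fintype_le _ _).trans ?_
  calc ∑ i, Measure.pi (fun _ : Fin N => Q) {x | x i ∈ s} ≤ ∑ _i : Fin N, Q s := by
        refine Finset.sum_le_sum fun i _ => ?_
        have hmp := measurePreserving_eval (fun _ : Fin N => Q) i
        rw [← measure_toMeasurable s, ← hmp.measure_preimage
          (measurableSet_toMeasurable _ _).nullMeasurableSet]
        exact measure_mono fun x hx => subset_toMeasurable _ _ hx
    _ = N * Q s := by simp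

/-! ### The filter of superexponentially likely properties of samples -/

/-- The sets of samples whose complement has superexponentially small probability. -/
def superexp (Q : ℕ → Measure S) {b : ℕ → ℝ} (hb : Normalizing b) : Filter (Σ n, Fin n → S) where
  sets := {A | SuperSmall b fun n => Measure.pi (fun _ : Fin n => Q n) {x | ⟨n, x⟩ ∉ A}}
  univ_sets := fun a => by simp [ExpBound]
  sets_of_superset := fun {A B} hA hAB => SuperSmall.mono hA
    (Eventually.of_forall fun n => measure_mono fun x hx hx' => hx (hAB hx'))
  inter_sets := fun {A B} hA hB => (SuperSmall.add hb hA hB).mono <| by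
    refine Eventually.of_forall fun n => (measure_mono ?_).trans (measure_union_le _ _)
    intro x hx
    by_cases h : (⟨n, x⟩ : Σ n, Fin n → S) ∈ A
    · exact Or.inr fun h' => hx ⟨h, h'⟩
    · exact Or.inl h

theorem eventually_superexp_iff {Q : ℕ → Measure S} {b : ℕ → ℝ} {hb : Normalizing b}
    {p : (Σ n, Fin n → S) → Prop} : (∀ᶠ w in superexp Q hb, p w) ↔
      SuperSmall b fun n => Measure.pi (fun _ : Fin n => Q n) {x | ¬ p ⟨n, x⟩} := Iff.rfl

theorem tendsto_fst_superexp (Q : ℕ → Measure S) {b : ℕ → ℝ} (hb : Normalizing b) :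
    Tendsto Sigma.fst (superexp Q hb) atTop := by
  rw [tendsto_atTop]
  intro N
  rw [eventually_superexp_iff]
  intro a
  filter_upwards [eventually_ge_atTop N] with n hn
  simp [hn]

namespace RegularArray

variable {P : Measure S} {b : ℕ → ℝ} {Q : ℕ → Measure S} {F : S → ℝ}

theorem mul_le_one (h : RegularArray P b Q F) {n : ℕ} (hn : 1 ≤ n) {x : S}
    (hx : F x ≤ (b n)⁻¹) : b n * F x ≤ 1 := by
  have hbn := h.normalizing.pos n hn
  have := mul_le_mul_of_nonneg_left hx hbn.le
  rwa [mul_inv_cancel₀ hbn.ne'] at this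

variable [∀ n, IsProbabilityMeasure (Q n)]

theorem eventually_trunc (h : RegularArray P b Q F) :
    ∀ᶠ w in superexp Q h.normalizing, ∀ i, F (w.2 i) ≤ (b w.1)⁻¹ := by
  rw [eventually_superexp_iff]
  refine h.tail.mono (Eventually.of_forall fun n => ?_)
  refine le_trans (measure_mono fun x hx => ?_) (pi_exists_le (Q n) {x | (b n)⁻¹ < F x})
  simpa using hx

theorem integrableOn_trunc (h : RegularArray P b Q F) {n : ℕ} {ψ : S → ℝ} {C : ℝ}
    (hψm : Measurable ψ) (hψ : ∀ x, F x ≤ (b n)⁻¹ → |ψ x| ≤ C * F x ^ 2) :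
    IntegrableOn ψ {x | F x ≤ (b n)⁻¹} (Q n) := by
  refine integrableOn_of_bound (h.measurableSet_trunc n) hψm (C := |C| * (b n)⁻¹ ^ 2) fun x hx => ?_
  refine (hψ x hx).trans ?_
  refine mul_le_mul (le_abs_self _) ?_ (sq_nonneg _) (abs_nonneg _)
  exact pow_le_pow_left₀ (by linarith [h.one_le x]) hx 2

variable [IsProbabilityMeasure P]

theorem tendsto_setIntegral_exp (h : RegularArray P b Q F) {ψ : ℕ → S → ℝ} {C L : ℝ}
    (hψm : ∀ n, Measurable (ψ n))
    (hψ : ∀ᶠ n in atTop, ∀ x, F x ≤ (b n)⁻¹ → |ψ n x| ≤ C * F x ^ 2)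
    (hL : Tendsto (fun n => ∫ x in {x | F x ≤ (b n)⁻¹}, ψ n x ∂Q n) atTop (𝓝 L))
    {t : ℝ} (ht : 0 < t) :
    Tendsto (fun n => ∫ x in {x | F x ≤ (b n)⁻¹}, (Real.exp (t * b n ^ 2 * ψ n x) - 1) / b n ^ 2
      ∂Q n) atTop (𝓝 (t * L)) := by
  set R : ℕ → S → ℝ := fun n x => (Real.exp (t * b n ^ 2 * ψ n x) - 1) / b n ^ 2 - t * ψ n x
    with hR
  have hRm : ∀ n, Measurable (R n) := fun n =>
    ((((hψm n).const_mul _).exp.sub_const 1).div_const _).sub ((hψm n).const_mul t)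
  set K : ℝ := t ^ 2 * C ^ 2 * Real.exp (t * |C|) with hK
  have hK0 : 0 ≤ K := by positivity
  have hRb : ∀ᶠ n in atTop, ∀ x, F x ≤ (b n)⁻¹ → |R n x| ≤ K * (b n ^ 2 * F x ^ 4) := by
    filter_upwards [hψ, eventually_ge_atTop 1] with n hn hn1 x hx
    have hbn := h.normalizing.pos n hn1
    have hbF := h.mul_le_one hn1 hx
    have hF := h.one_le x
    have hψx : |ψ n x| ≤ |C| * F x ^ 2 :=
      (hn x hx).trans (mul_le_mul_of_nonneg_right (le_abs_self C) (sq_nonneg _))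
    have hsq : ψ n x ^ 2 ≤ C ^ 2 * F x ^ 4 := by
      rw [← sq_abs, ← sq_abs C]
      calc |ψ n x| ^ 2 ≤ (|C| * F x ^ 2) ^ 2 := pow_le_pow_left₀ (abs_nonneg _) hψx 2
        _ = |C| ^ 2 * F x ^ 4 := by ring
    have hy : |t * b n ^ 2 * ψ n x| ≤ t * |C| := by
      rw [abs_mul, abs_of_pos (by positivity)]
      have : (b n * F x) ^ 2 ≤ 1 := pow_le_one₀ (by positivity) hbF
      calc t * b n ^ 2 * |ψ n x| ≤ t * b n ^ 2 * (|C| * F x ^ 2) := by gcongr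
        _ = t * |C| * (b n * F x) ^ 2 := by ring
        _ ≤ t * |C| * 1 := by gcongr
        _ = t * |C| := mul_one _
    have e : R n x = (Real.exp (t * b n ^ 2 * ψ n x) - 1 - t * b n ^ 2 * ψ n x) / b n ^ 2 := by
      simp only [hR]
      field_simp
    rw [e, abs_div, abs_of_pos (show 0 < b n ^ 2 by positivity), div_le_iff₀ (by positivity)]
    calc _ ≤ (t * b n ^ 2 * ψ n x) ^ 2 * Real.exp |t * b n ^ 2 * ψ n x| :=
          abs_exp_sub_one_sub_le _
      _ ≤ (t * b n ^ 2 * ψ n x) ^ 2 * Real.exp (t * |C|) := by gcongr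
      _ = t ^ 2 * b n ^ 4 * ψ n x ^ 2 * Real.exp (t * |C|) := by ring
      _ ≤ t ^ 2 * b n ^ 4 * (C ^ 2 * F x ^ 4) * Real.exp (t * |C|) := by gcongr
      _ = K * (b n ^ 2 * F x ^ 4) * b n ^ 2 := by rw [hK]; ring
  have hRb' : ∀ᶠ n in atTop, ∀ x, F x ≤ (b n)⁻¹ → |R n x| ≤ K * F x ^ 2 := by
    filter_upwards [hRb, eventually_ge_atTop 1] with n hn hn1 x hx
    refine (hn x hx).trans (mul_le_mul_of_nonneg_left ?_ hK0)
    have hbn := h.normalizing.pos n hn1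
    have hF := h.one_le x
    have : (b n * F x) ^ 2 ≤ 1 := pow_le_one₀ (by positivity) (h.mul_le_one hn1 hx)
    nlinarith [sq_nonneg (F x)]
  have hR0 : Tendsto (fun n => ∫ x in {x | F x ≤ (b n)⁻¹}, R n x ∂Q n) atTop (𝓝 0) := by
    have := h.tendsto_setIntegral (φ := fun _ => 0) hRm measurable_const hRb'
      (fun x => by simpa using mul_nonneg hK0 (sq_nonneg _)) ?_
    · simpa using this
    · intro T ε hε
      have h0 : Tendsto (fun n => K * (b n ^ 2 * T ^ 4)) atTop (𝓝 0) := by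
        have := ((h.normalizing.zero.pow 2).mul_const (T ^ 4)).const_mul K
        simpa using this
      filter_upwards [hRb, h0.eventually_le_const hε,
        h.normalizing.inv_tendsto.eventually_ge_atTop T] with n h1 h2 h3 x hx
      rw [sub_zero]
      refine (h1 x (hx.trans h3)).trans (le_trans ?_ h2)
      have hF := h.one_le x
      gcongr
  have := hR0.add (hL.const_mul t)
  rw [zero_add] at this
  refine this.congr' ?_
  filter_upwards [hψ, hRb'] with n h1 h2
  have i1 : IntegrableOn (ψ n) {x | F x ≤ (b n)⁻¹} (Q n) := h.integrableOn_trunc (hψm n) h1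
  have i2 : IntegrableOn (R n) {x | F x ≤ (b n)⁻¹} (Q n) := h.integrableOn_trunc (hRm n) h2
  rw [← integral_const_mul, ← integral_add i2 (i1.const_mul t)]
  refine integral_congr_ae (Eventually.of_forall fun x => ?_)
  simp only [hR]
  ring

theorem integral_exp_indicator_sub_one {μ : Measure S} [IsProbabilityMeasure μ] {s : Set S}
    (hs : MeasurableSet s) {h : S → ℝ} (hm : Measurable h) {C : ℝ} (hC : ∀ x ∈ s, |h x| ≤ C) :
    Integrable (fun x => Real.exp (s.indicator h x)) μ ∧
      ∫ x, Real.exp (s.indicator h x) ∂μ - 1 = ∫ x in s, (Real.exp (h x) - 1) ∂μ := by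
  have hi : Integrable (fun x => Real.exp (s.indicator h x)) μ := by
    refine Integrable.of_bound (hm.indicator hs).exp.aestronglyMeasurable (Real.exp |C|)
      (Eventually.of_forall fun x => ?_)
    rw [Real.norm_eq_abs, Real.abs_exp]
    refine Real.exp_le_exp.2 ?_
    by_cases hx : x ∈ s
    · rw [Set.indicator_of_mem hx]
      exact (le_abs_self _).trans ((hC x hx).trans (le_abs_self _))
    · rw [Set.indicator_of_notMem hx]
      positivity
  refine ⟨hi, ?_⟩
  have h1 : (1 : ℝ) = ∫ _, (1 : ℝ) ∂μ := by simp
  conv_lhs => rw [h1]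
  rw [← integral_sub hi (integrable_const _), ← integral_indicator hs]
  refine integral_congr_ae (Eventually.of_forall fun x => ?_)
  by_cases hx : x ∈ s <;> simp [hx]

theorem eventually_avg_lt (h : RegularArray P b Q F) {ψ : ℕ → S → ℝ} {C L : ℝ}
    (hψm : ∀ n, Measurable (ψ n))
    (hψ : ∀ᶠ n in atTop, ∀ x, F x ≤ (b n)⁻¹ → |ψ n x| ≤ C * F x ^ 2)
    (hL : Tendsto (fun n => ∫ x in {x | F x ≤ (b n)⁻¹}, ψ n x ∂Q n) atTop (𝓝 L))
    {δ : ℝ} (hδ : 0 < δ) :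
    ∀ᶠ w in superexp Q h.normalizing, avg w.2 (ψ w.1) < L + δ := by
  have key : ∀ᶠ w in superexp Q h.normalizing,
      ¬ (((w.1 : ℝ) * (L + δ)) ≤ ∑ i, {x | F x ≤ (b w.1)⁻¹}.indicator (ψ w.1) (w.2 i)) := by
    rw [eventually_superexp_iff]
    intro a
    set t : ℝ := 2 * (|a| + 1) / δ with ht
    have ht0 : 0 < t := by positivity
    have hlim := h.tendsto_setIntegral_exp hψm hψ hL ht0
    filter_upwards [hψ, hlim.eventually_le_const (show t * L < t * L + t * (δ / 2) by
      have := mul_pos ht0 (half_pos hδ); linarith), eventually_ge_atTop 1] with n h1 h2 hn1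
    have hbn := h.normalizing.pos n hn1
    have hms := h.measurableSet_trunc n
    obtain ⟨hi, he⟩ := integral_exp_indicator_sub_one (μ := Q n) hms
      ((hψm n).const_mul (t * b n ^ 2)) (C := t * b n ^ 2 * (|C| * (b n)⁻¹ ^ 2)) (fun x hx => by
        rw [abs_mul, abs_of_pos (show 0 < t * b n ^ 2 by positivity)]
        refine mul_le_mul_of_nonneg_left ((h1 x hx).trans ?_) (by positivity)
        refine mul_le_mul (le_abs_self _) ?_ (sq_nonneg _) (abs_nonneg _)
        exact pow_le_pow_left₀ (by linarith [h.one_le x]) hx 2)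
    have hch := chernoff (N := n) (Q n) hi (t * b n ^ 2 * (n * (L + δ)))
    refine (measure_mono fun x hx => ?_).trans (hch.trans (ENNReal.ofReal_le_ofReal
      (Real.exp_le_exp.2 ?_)))
    · simp only [not_not, Set.mem_ofPred_eq] at hx
      have := mul_le_mul_of_nonneg_left hx (show 0 ≤ t * b n ^ 2 by positivity)
      refine this.trans (le_of_eq ?_)
      rw [Finset.mul_sum]
      refine Finset.sum_congr rfl fun i _ => ?_
      by_cases hxi : x i ∈ {x | F x ≤ (b n)⁻¹}
      · simp only [Set.indicator_of_mem hxi]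
      · simp only [Set.indicator_of_notMem hxi, mul_zero]
    · have hE : ∫ x in {x | F x ≤ (b n)⁻¹}, (Real.exp (t * b n ^ 2 * ψ n x) - 1) ∂Q n
          = b n ^ 2 * ∫ x in {x | F x ≤ (b n)⁻¹},
            (Real.exp (t * b n ^ 2 * ψ n x) - 1) / b n ^ 2 ∂Q n := by
        rw [integral_div, mul_div_cancel₀ _ (by positivity)]
      rw [he, hE]
      have hnb : 0 ≤ (n : ℝ) * b n ^ 2 := by positivity
      have h3 := mul_le_mul_of_nonneg_left h2 hnb
      have htδ : t * (δ / 2) = |a| + 1 := by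
        rw [ht]
        field_simp
      have h4 : (n : ℝ) * b n ^ 2 * a ≤ n * b n ^ 2 * (|a| + 1) :=
        mul_le_mul_of_nonneg_left (by linarith [le_abs_self a]) hnb
      rw [← htδ] at h4
      nlinarith
  filter_upwards [key, h.eventually_trunc, (tendsto_fst_superexp Q h.normalizing).eventually
    (eventually_ge_atTop 1)] with w h1 h2 h3
  have hw : (0 : ℝ) < w.1 := by exact_mod_cast h3
  rw [not_le] at h1
  have : ∑ i, {x | F x ≤ (b w.1)⁻¹}.indicator (ψ w.1) (w.2 i) = ∑ i, ψ w.1 (w.2 i) :=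
    Finset.sum_congr rfl fun i _ => Set.indicator_of_mem (s := {x | F x ≤ (b w.1)⁻¹}) (h2 i) _
  rw [this, ← natCast_mul_avg h3] at h1
  exact lt_of_mul_lt_mul_left h1 hw.le

/-- A superexponential law of large numbers for empirical means. -/
theorem tendsto_avg (h : RegularArray P b Q F) {ψ : ℕ → S → ℝ} {C L : ℝ}
    (hψm : ∀ n, Measurable (ψ n))
    (hψ : ∀ᶠ n in atTop, ∀ x, F x ≤ (b n)⁻¹ → |ψ n x| ≤ C * F x ^ 2)
    (hL : Tendsto (fun n => ∫ x in {x | F x ≤ (b n)⁻¹}, ψ n x ∂Q n) atTop (𝓝 L)) :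
    Tendsto (fun w : Σ n, Fin n → S => avg w.2 (ψ w.1)) (superexp Q h.normalizing) (𝓝 L) := by
  rw [Metric.tendsto_nhds]
  intro δ hδ
  have h2 := h.eventually_avg_lt (ψ := fun n x => -ψ n x) (C := C) (L := -L)
    (fun n => (hψm n).neg) (by simpa using hψ) (by simpa [integral_neg] using hL.neg) hδ
  filter_upwards [h.eventually_avg_lt hψm hψ hL hδ, h2] with w h3 h4
  rw [avg_neg] at h4
  rw [Real.dist_eq, abs_lt]
  constructor <;> linarith

/-- The superexponential law of large numbers for a fixed function. -/
theorem tendsto_avg_const (h : RegularArray P b Q F) {ψ : S → ℝ} {C : ℝ}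
    (hψm : Measurable ψ) (hψ : ∀ x, |ψ x| ≤ C * F x ^ 2) :
    Tendsto (fun w : Σ n, Fin n → S => avg w.2 ψ) (superexp Q h.normalizing)
      (𝓝 (∫ x, ψ x ∂P)) :=
  h.tendsto_avg (ψ := fun _ => ψ) (fun _ => hψm) (Eventually.of_forall fun _ x _ => hψ x)
    (h.tendsto_setIntegral (fun _ => hψm) hψm (Eventually.of_forall fun _ x _ => hψ x) hψ
      fun T ε hε => Eventually.of_forall fun n x _ => by simpa using hε.le)

end RegularArray

/-! ### The exponential bound for half-spaces -/

theorem bootstrapKernel_apply {n k : ℕ} (x : Fin n → S) :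
    bootstrapKernel S n k x = Measure.pi fun _ => empirical x := rfl

theorem avg_add {S : Type*} {n : ℕ} (x : Fin n → S) (f g : S → ℝ) :
    avg x (fun y => f y + g y) = avg x f + avg x g := by
  simp [avg, Finset.sum_add_distrib, mul_add]

theorem avg_const_mul {S : Type*} {n : ℕ} (x : Fin n → S) (c : ℝ) (f : S → ℝ) :
    avg x (fun y => c * f y) = c * avg x f := by
  simp only [avg, ← Finset.mul_sum]
  ring

theorem avg_const {S : Type*} {n : ℕ} (hn : 1 ≤ n) (x : Fin n → S) (c : ℝ) :
    avg x (fun _ => c) = c := by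
  have : (n : ℝ) ≠ 0 := by positivity
  simp [avg, this]

namespace RegularArray

variable {P : Measure S} {b : ℕ → ℝ} {F : S → ℝ}

section

variable {Q : ℕ → Measure S}

theorem expm1_bound (h : RegularArray P b Q F) {n : ℕ} (hn : 1 ≤ n) {f : S → ℝ} {C : ℝ}
    (hfC : ∀ x, |f x| ≤ C * F x) {s M : ℝ} (hs : |s| ≤ M) {x : S} (hx : F x ≤ (b n)⁻¹) :
    |(Real.exp (s * b n * f x) - 1 - s * b n * f x) / b n ^ 2|
      ≤ M ^ 2 * C ^ 2 * Real.exp (M * |C|) * F x ^ 2 := by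
  have hbn := h.normalizing.pos n hn
  have hF := h.one_le x
  have hM : 0 ≤ M := (abs_nonneg _).trans hs
  have hf : |f x| ≤ |C| * F x := (hfC x).trans (by gcongr; exact le_abs_self C)
  have hbF := h.mul_le_one hn hx
  have hy : |s * b n * f x| ≤ M * |C| := by
    rw [abs_mul, abs_mul, abs_of_pos hbn]
    calc |s| * b n * |f x| ≤ M * b n * (|C| * F x) := by gcongr
      _ = M * |C| * (b n * F x) := by ring
      _ ≤ M * |C| * 1 := by gcongr
      _ = _ := mul_one _
  have hs2 : s ^ 2 ≤ M ^ 2 := by rw [← sq_abs]; gcongr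
  have hf2 : f x ^ 2 ≤ C ^ 2 * F x ^ 2 := by
    rw [← sq_abs, ← sq_abs C, ← mul_pow]; gcongr
  rw [abs_div, abs_of_pos (show 0 < b n ^ 2 by positivity), div_le_iff₀ (by positivity)]
  calc _ ≤ (s * b n * f x) ^ 2 * Real.exp |s * b n * f x| := abs_exp_sub_one_sub_le _
    _ ≤ (s * b n * f x) ^ 2 * Real.exp (M * |C|) := by gcongr
    _ = s ^ 2 * b n ^ 2 * f x ^ 2 * Real.exp (M * |C|) := by ring
    _ ≤ M ^ 2 * b n ^ 2 * (C ^ 2 * F x ^ 2) * Real.exp (M * |C|) := by gcongr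
    _ = _ := by ring

theorem tendsto_setIntegral_expm1 [IsProbabilityMeasure P] [∀ n, IsProbabilityMeasure (Q n)]
    (h : RegularArray P b Q F) {f : S → ℝ} (hf : Measurable f)
    {C : ℝ} (hfC : ∀ x, |f x| ≤ C * F x) {s : ℕ → ℝ} {s₀ : ℝ} (hs : Tendsto s atTop (𝓝 s₀)) :
    Tendsto (fun n => ∫ x in {x | F x ≤ (b n)⁻¹},
      (Real.exp (s n * b n * f x) - 1 - s n * b n * f x) / b n ^ 2 ∂Q n) atTop
      (𝓝 (s₀ ^ 2 / 2 * ∫ x, f x ^ 2 ∂P)) := by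
  rw [← integral_const_mul]
  set M : ℝ := |s₀| + 1 with hM
  have hM1 : 1 ≤ M := by rw [hM]; linarith [abs_nonneg s₀]
  have hsM : ∀ᶠ n in atTop, |s n| ≤ M := hs.abs.eventually_le_const (by rw [hM]; linarith)
  have hs₀ : |s₀| ≤ M := by rw [hM]; linarith
  have hs₀2 : s₀ ^ 2 ≤ M ^ 2 := by rw [← sq_abs]; gcongr
  have hf2 : ∀ x, f x ^ 2 ≤ C ^ 2 * F x ^ 2 := fun x => by
    rw [← sq_abs, ← mul_pow]
    exact pow_le_pow_left₀ (abs_nonneg _) (hfC x) 2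
  refine h.tendsto_setIntegral (C := M ^ 2 * C ^ 2 * Real.exp (M * |C|))
    (fun n => (((hf.const_mul _).exp.sub_const 1).sub (hf.const_mul _)).div_const _)
    ((hf.pow_const 2).const_mul _) ?_ ?_ ?_
  · filter_upwards [hsM, eventually_ge_atTop 1] with n h1 h2 x hx
    exact h.expm1_bound h2 hfC h1 hx
  · intro x
    rw [abs_of_nonneg (by positivity)]
    have h1 : 1 ≤ Real.exp (M * |C|) := Real.one_le_exp (by positivity)
    calc s₀ ^ 2 / 2 * f x ^ 2 ≤ M ^ 2 * (C ^ 2 * F x ^ 2) := by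
          refine mul_le_mul ?_ (hf2 x) (sq_nonneg _) (sq_nonneg _)
          linarith [sq_nonneg s₀]
      _ = M ^ 2 * C ^ 2 * 1 * F x ^ 2 := by ring
      _ ≤ _ := by gcongr
  · intro T ε hε
    have l1 : Tendsto (fun n => M ^ 3 * |C| ^ 3 * T ^ 3 * Real.exp (M * |C|) * b n) atTop (𝓝 0) := by
      simpa using h.normalizing.zero.const_mul (M ^ 3 * |C| ^ 3 * T ^ 3 * Real.exp (M * |C|))
    have l2 : Tendsto (fun n => |s n ^ 2 / 2 - s₀ ^ 2 / 2| * (C ^ 2 * T ^ 2)) atTop (𝓝 0) := by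
      have := ((((hs.pow 2).div_const 2).sub_const (s₀ ^ 2 / 2)).abs).mul_const (C ^ 2 * T ^ 2)
      simpa using this
    filter_upwards [hsM, eventually_ge_atTop 1, l1.eventually_le_const (half_pos hε),
      l2.eventually_le_const (half_pos hε), h.normalizing.inv_tendsto.eventually_ge_atTop T]
      with n h1 h2 h3 h4 h5 x hx
    have hbn := h.normalizing.pos n h2
    have hF := h.one_le x
    have hfa : |f x| ≤ |C| * F x := (hfC x).trans (by gcongr; exact le_abs_self C)
    have hbF := h.mul_le_one h2 (hx.trans h5)
    have hy : |s n * b n * f x| ≤ M * |C| := by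
      rw [abs_mul, abs_mul, abs_of_pos hbn]
      calc |s n| * b n * |f x| ≤ M * b n * (|C| * F x) := by gcongr
        _ = M * |C| * (b n * F x) := by ring
        _ ≤ M * |C| * 1 := by gcongr
        _ = _ := mul_one _
    have hy' : |s n * b n * f x| ≤ M * b n * (|C| * T) := by
      rw [abs_mul, abs_mul, abs_of_pos hbn]
      calc |s n| * b n * |f x| ≤ M * b n * (|C| * F x) := by gcongr
        _ ≤ _ := by gcongr
    have e : (Real.exp (s n * b n * f x) - 1 - s n * b n * f x) / b n ^ 2 - s₀ ^ 2 / 2 * f x ^ 2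
        = (Real.exp (s n * b n * f x) - 1 - s n * b n * f x - (s n * b n * f x) ^ 2 / 2) / b n ^ 2
          + (s n ^ 2 / 2 - s₀ ^ 2 / 2) * f x ^ 2 := by
      field_simp
      ring
    rw [e]
    refine (abs_add_le _ _).trans ?_
    have e1 : |(Real.exp (s n * b n * f x) - 1 - s n * b n * f x - (s n * b n * f x) ^ 2 / 2)
        / b n ^ 2| ≤ ε / 2 := by
      refine le_trans ?_ h3
      rw [abs_div, abs_of_pos (show 0 < b n ^ 2 by positivity), div_le_iff₀ (by positivity)]
      calc _ ≤ |s n * b n * f x| ^ 3 * Real.exp |s n * b n * f x| := abs_exp_sub_quadratic_le _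
        _ ≤ (M * b n * (|C| * T)) ^ 3 * Real.exp (M * |C|) :=
            mul_le_mul (pow_le_pow_left₀ (abs_nonneg _) hy' 3) (Real.exp_le_exp.2 hy)
              (Real.exp_pos _).le (pow_nonneg ((abs_nonneg _).trans hy') 3)
        _ = _ := by ring
    have e2 : |(s n ^ 2 / 2 - s₀ ^ 2 / 2) * f x ^ 2| ≤ ε / 2 := by
      refine le_trans ?_ h4
      rw [abs_mul, abs_of_nonneg (sq_nonneg (f x))]
      refine mul_le_mul_of_nonneg_left ((hf2 x).trans ?_) (abs_nonneg _)
      gcongr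
    linarith

end

variable {Pn : ℕ → ProbabilityMeasure S} [IsProbabilityMeasure P]

/-- The conditional Chernoff bound for the bootstrap sample. -/
theorem bootstrap_chernoff {n k : ℕ} (hn : 1 ≤ n) (hk : 1 ≤ k) (x : Fin n → S) {f : S → ℝ}
    (hf : Measurable f) {β s : ℝ} (hβ : 0 < β) (hs : 0 < s) (z : ℝ) :
    Measure.pi (fun _ : Fin k => empirical x) {y | z ≤ avg y f - avg x f}
      ≤ ENNReal.ofReal (Real.exp (k * β ^ 2 *
        avg x (fun y => (Real.exp (s * β * f y) - 1 - s * β * f y) / β ^ 2) - k * s * β * z)) := by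
  have : NeZero n := ⟨by omega⟩
  have hk0 : (0 : ℝ) < k := by exact_mod_cast hk
  have hm : Measurable fun y => Real.exp (s * β * f y) := (hf.const_mul _).exp
  have hch := chernoff (N := k) (empirical x) (h := fun y => s * β * f y)
    (integrable_empirical x hm) (k * s * β * (z + avg x f))
  refine (measure_mono fun y hy => ?_).trans (hch.trans (le_of_eq ?_))
  · have hy' : z ≤ avg y f - avg x f := hy
    change _ ≤ ∑ i, s * β * f (y i)
    rw [← Finset.mul_sum, ← natCast_mul_avg hk]
    have := mul_le_mul_of_nonneg_left (show z + avg x f ≤ avg y f by linarith)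
      (show 0 ≤ k * s * β by positivity)
    linarith
  · congr 2
    rw [integral_empirical x hm]
    have e : (fun y => Real.exp (s * β * f y)) = fun y =>
        β ^ 2 * ((Real.exp (s * β * f y) - 1 - s * β * f y) / β ^ 2) + (s * β * f y + 1) := by
      ext y
      field_simp
      ring
    rw [e, avg_add, avg_const_mul, avg_add, avg_const_mul, avg_const hn]
    ring

theorem halfspace_bound (h : RegularArray P b (fun n => (Pn n : Measure S)) F) {f g : S → ℝ}
    (hf : Measurable f) (hg : Measurable g) {C : ℝ} (hfC : ∀ x, |f x| ≤ C * F x)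
    (hgC : ∀ x, |g x| ≤ C * F x) {D : ℝ}
    (hD : Tendsto (fun n => (∫ x in {x | F x ≤ (b n)⁻¹}, g x ∂(Pn n : Measure S)
      - ∫ x, g x ∂P) / b n) atTop (𝓝 D)) {k : ℕ → ℕ} {ν : ℝ} (hν : 0 < ν)
    (hk : Tendsto (fun n : ℕ => (k n : ℝ) / (n : ℝ)) atTop (𝓝 ν)) {t c a : ℝ} (ht : 0 < t)
    (ha : a < t * (c - D) - t ^ 2 / 2 * ((∫ x, f x ^ 2 ∂P) / ν + ∫ x, g x ^ 2 ∂P)) :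
    ExpBound b (fun n => sampleLaw (Pn n) n (k n)
      {w | c * b n ≤ avg w.2 f - avg w.1 f + (avg w.1 g - ∫ x, g x ∂P)}) a := by
  have hb := h.normalizing
  set L : ℝ := (t / ν) ^ 2 / 2 * ∫ x, f x ^ 2 ∂P with hLdef
  set V : ℝ := ∫ x, g x ^ 2 ∂P with hV
  set s : ℕ → ℝ := fun n => t * ((k n : ℝ) / n)⁻¹ with hsdef
  have hs : Tendsto s atTop (𝓝 (t / ν)) := by
    rw [div_eq_mul_inv]
    exact (hk.inv₀ hν.ne').const_mul t
  have hkpos : ∀ᶠ n in atTop, 1 ≤ k n := by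
    filter_upwards [hk.eventually_const_lt hν] with n hn
    by_contra h0
    have : k n = 0 := by omega
    simp [this] at hn
  have hexp : ν * L - t * c + (t ^ 2 / 2 * V + t * D) < -a := by
    have : ν * L = t ^ 2 / 2 * ((∫ x, f x ^ 2 ∂P) / ν) := by
      rw [hLdef]
      field_simp
    rw [this]
    linarith
  obtain ⟨a₁, ha₁, ha₂⟩ := exists_between hexp
  obtain ⟨a', ha', haa'⟩ := exists_between ha₂
  set δ : ℝ := (a₁ - (ν * L - t * c + (t ^ 2 / 2 * V + t * D))) / ν with hδ
  have hδ0 : 0 < δ := div_pos (by linarith) hν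
  set r : ℕ → S → ℝ := fun n x =>
    (Real.exp (s n * b n * f x) - 1 - s n * b n * f x) / b n ^ 2 with hr
  have hrm : ∀ n, Measurable (r n) := fun n =>
    (((hf.const_mul _).exp.sub_const 1).sub (hf.const_mul _)).div_const _
  have hrL := h.tendsto_setIntegral_expm1 hf hfC hs
  have hravg := h.eventually_avg_lt (C := (|t / ν| + 1) ^ 2 * C ^ 2 * Real.exp ((|t / ν| + 1) * |C|))
    hrm (by
      filter_upwards [hs.abs.eventually_le_const (lt_add_one |t / ν|), eventually_ge_atTop 1]
        with n h1 h2 x hx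
      exact h.expm1_bound h2 hfC h1 hx) hrL hδ0
  have hgood := h.eventually_trunc.and hravg
  rw [eventually_superexp_iff] at hgood
  set Bad : (n : ℕ) → Set (Fin n → S) := fun n =>
    {x | ¬ ((∀ i, F (x i) ≤ (b n)⁻¹) ∧ avg x (r n) < L + δ)} with hBad
  have hgL := h.tendsto_setIntegral_expm1 hg hgC (tendsto_const_nhds (x := t))
  -- the limiting exponent
  have hlim : Tendsto (fun n => (k n : ℝ) / n * (L + δ) - t * c
      + (∫ x in {x | F x ≤ (b n)⁻¹}, (Real.exp (t * b n * g x) - 1 - t * b n * g x) / b n ^ 2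
          ∂(Pn n : Measure S)
        + t * ((∫ x in {x | F x ≤ (b n)⁻¹}, g x ∂(Pn n : Measure S) - ∫ x, g x ∂P) / b n)))
      atTop (𝓝 a₁) := by
    have := ((hk.mul_const (L + δ)).sub_const (t * c)).add (hgL.add (hD.const_mul t))
    convert this using 2
    rw [hδ]
    field_simp
    ring
  refine (((hgood (a + 1)).anti (min_le_left (a + 1) (-a'))).add hb (a' := a)
    (q := fun n => ENNReal.ofReal (Real.exp (n * b n ^ 2 * a'))) ?_
    (lt_min (lt_add_one a) (by linarith))).mono ?_
  · refine Eventually.of_forall fun n => ENNReal.ofReal_le_ofReal (Real.exp_le_exp.2 ?_)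
    exact mul_le_mul_of_nonneg_left (by linarith [min_le_right (a + 1) (-a')]) (by positivity)
  filter_upwards [hlim.eventually_le_const ha', hkpos, eventually_ge_atTop 1] with n hn hkn hn1
  have hbn := hb.pos n hn1
  have hn0 : (0 : ℝ) < n := by exact_mod_cast hn1
  have hk0 : (0 : ℝ) < k n := by exact_mod_cast hkn
  have hsn : 0 < s n := by simp only [hsdef]; positivity
  have hks : k n * s n = t * n := by
    simp only [hsdef]
    field_simp
  have : NeZero n := ⟨by omega⟩
  have hms := h.measurableSet_trunc n
  set γ : S → ℝ := {x | F x ≤ (b n)⁻¹}.indicator (fun x => t * b n * g x) with hγ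
  set c₀ : ℝ := k n * b n ^ 2 * (L + δ) - t * n * b n * (c * b n + ∫ x, g x ∂P) with hc₀
  have hEm : MeasurableSet {w : (Fin n → S) × (Fin (k n) → S) |
      c * b n ≤ avg w.2 f - avg w.1 f + (avg w.1 g - ∫ x, g x ∂P)} :=
    measurableSet_le measurable_const ((((measurable_avg hf).comp measurable_snd).sub
      ((measurable_avg hf).comp measurable_fst)).add
      (((measurable_avg hg).comp measurable_fst).sub_const _))
  have hcond : ∀ x : Fin n → S, bootstrapKernel S n (k n) x (Prod.mk x ⁻¹'
      {w | c * b n ≤ avg w.2 f - avg w.1 f + (avg w.1 g - ∫ x, g x ∂P)})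
      ≤ (toMeasurable (Measure.pi fun _ : Fin n => (Pn n : Measure S)) (Bad n)).indicator 1 x
        + ENNReal.ofReal (Real.exp (c₀ + ∑ i, γ (x i))) := by
    intro x
    rw [bootstrapKernel_apply]
    by_cases hx : x ∈ Bad n
    · refine le_add_right ?_
      rw [Set.indicator_of_mem (subset_toMeasurable _ _ hx)]
      exact prob_le_one
    · have hx' : (∀ i, F (x i) ≤ (b n)⁻¹) ∧ avg x (r n) < L + δ := by
        simpa only [hBad, Set.mem_ofPred_eq, not_not] using hx
      refine le_add_left ?_
      have hset : Prod.mk x ⁻¹' {w : (Fin n → S) × (Fin (k n) → S) |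
          c * b n ≤ avg w.2 f - avg w.1 f + (avg w.1 g - ∫ x, g x ∂P)}
          = {y | c * b n - (avg x g - ∫ x, g x ∂P) ≤ avg y f - avg x f} := by
        ext y
        simp only [Set.mem_preimage, Set.mem_ofPred_eq]
        constructor <;> intro hy <;> linarith
      rw [hset]
      refine (bootstrap_chernoff hn1 hkn x hf hbn hsn _).trans
        (ENNReal.ofReal_le_ofReal (Real.exp_le_exp.2 ?_))
      have hsum : ∑ i, γ (x i) = t * b n * (n * avg x g) := by
        rw [natCast_mul_avg hn1, Finset.mul_sum]
        exact Finset.sum_congr rfl fun i _ =>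
          Set.indicator_of_mem (s := {x | F x ≤ (b n)⁻¹}) (hx'.1 i) _
      rw [hsum, hks, hc₀]
      have := mul_le_mul_of_nonneg_left hx'.2.le (show 0 ≤ k n * b n ^ 2 by positivity)
      simp only [hr] at this
      linarith
  obtain ⟨hi, he⟩ := integral_exp_indicator_sub_one (μ := (Pn n : Measure S)) hms
    (hg.const_mul (t * b n)) (C := t * b n * (|C| * (b n)⁻¹)) (fun x hx => by
      rw [abs_mul, abs_of_pos (show 0 < t * b n by positivity)]
      refine mul_le_mul_of_nonneg_left ((hgC x).trans ?_) (by positivity)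
      exact mul_le_mul (le_abs_self _) hx (by linarith [h.one_le x]) (abs_nonneg _))
  have hq : ∫⁻ x : Fin n → S, ENNReal.ofReal (Real.exp (c₀ + ∑ i, γ (x i)))
      ∂(Measure.pi fun _ => (Pn n : Measure S)) ≤ ENNReal.ofReal (Real.exp (n * b n ^ 2 * a')) := by
    rw [lintegral_pi_exp _ hi]
    refine ENNReal.ofReal_le_ofReal ?_
    refine (mul_le_mul_of_nonneg_left (pow_le_exp_mul_sub_one
      (integral_nonneg fun _ => (Real.exp_pos _).le) n) (Real.exp_pos _).le).trans ?_
    rw [← Real.exp_add]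
    refine Real.exp_le_exp.2 ?_
    rw [he]
    have ig : IntegrableOn g {x | F x ≤ (b n)⁻¹} (Pn n : Measure S) :=
      h.integrableOn_trunc (C := |C|) hg fun x _ => (hgC x).trans
        (mul_le_mul (le_abs_self _) (h.le_sq x) (by linarith [h.one_le x]) (abs_nonneg _))
    have ir : IntegrableOn (fun x => (Real.exp (t * b n * g x) - 1 - t * b n * g x) / b n ^ 2)
        {x | F x ≤ (b n)⁻¹} (Pn n : Measure S) :=
      h.integrableOn_trunc ((((hg.const_mul _).exp.sub_const 1).sub (hg.const_mul _)).div_const _)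
        fun x hx => h.expm1_bound hn1 hgC (le_refl |t|) hx
    have e : ∫ x in {x | F x ≤ (b n)⁻¹}, (Real.exp (t * b n * g x) - 1) ∂(Pn n : Measure S)
        = b n ^ 2 * ∫ x in {x | F x ≤ (b n)⁻¹},
            (Real.exp (t * b n * g x) - 1 - t * b n * g x) / b n ^ 2 ∂(Pn n : Measure S)
          + t * b n * ∫ x in {x | F x ≤ (b n)⁻¹}, g x ∂(Pn n : Measure S) := by
      rw [← integral_const_mul, ← integral_const_mul, ← integral_add (ir.const_mul _)
        (ig.const_mul _)]
      refine integral_congr_ae (Eventually.of_forall fun x => ?_)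
      field_simp
      ring
    rw [e, hc₀]
    refine le_trans (le_of_eq ?_) (mul_le_mul_of_nonneg_left hn
      (show 0 ≤ (n : ℝ) * b n ^ 2 by positivity))
    field_simp
    ring
  rw [sampleLaw, Measure.compProd_apply hEm]
  refine (lintegral_mono hcond).trans ?_
  rw [lintegral_add_left (measurable_one.indicator (measurableSet_toMeasurable _ _)),
    lintegral_indicator_one (measurableSet_toMeasurable _ _), measure_toMeasurable]
  exact add_le_add le_rfl hq

end RegularArray

/-! ### The linear span of the test functions -/

/-- The functions dominated by a multiple of a test function; this is the linear span of `Φ`. -/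
def testSpace (P : ProbabilityMeasure S) {b : ℕ → ℝ} (hb : Normalizing b) :
    Submodule ℝ (S → ℝ) where
  carrier := {f | Measurable f ∧ ∃ F ∈ Phi P b, (∀ x, 1 ≤ F x) ∧ ∃ C > 0, ∀ x, |f x| ≤ C * F x}
  zero_mem' := ⟨measurable_const, fun _ => 1, Phi.of_bounded hb measurable_const (C := 1) (by simp),
    by simp, 1, one_pos, by simp⟩
  add_mem' := by
    rintro f g ⟨hf, F, hF, hF1, C, hC, hfC⟩ ⟨hg, G, hG, hG1, C', hC', hgC⟩
    refine ⟨hf.add hg, _, Phi.sup hb hF hG, fun x => le_max_of_le_left ((hF1 x).trans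
      (le_abs_self _)), C + C', add_pos hC hC', fun x => (abs_add_le _ _).trans ?_⟩
    rw [add_mul]
    refine add_le_add ((hfC x).trans ?_) ((hgC x).trans ?_)
    · exact mul_le_mul_of_nonneg_left ((le_abs_self _).trans (le_max_left _ _)) hC.le
    · exact mul_le_mul_of_nonneg_left ((le_abs_self _).trans (le_max_right _ _)) hC'.le
  smul_mem' := by
    rintro c f ⟨hf, F, hF, hF1, C, hC, hfC⟩
    refine ⟨hf.const_smul c, F, hF, hF1, (|c| + 1) * C, by positivity, fun x => ?_⟩
    have h0 := hF1 x
    simp only [Pi.smul_apply, smul_eq_mul, abs_mul, mul_assoc]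
    exact mul_le_mul (by linarith) (hfC x) (abs_nonneg _) (by positivity)

namespace testSpace

variable {P : ProbabilityMeasure S} {b : ℕ → ℝ} {hb : Normalizing b}

theorem mem_of_mem_Phi {f : S → ℝ} (hf : f ∈ Phi P b) : f ∈ testSpace P hb := by
  obtain ⟨F, hF, hF1, hfF⟩ := Phi.exists_dominating hb {f} (by simpa using hf)
  exact ⟨((mem_Phi_iff hb).1 hf).1, F, hF, hF1, 1, one_pos, by simpa using hfF⟩

theorem mem_of_bounded {f : S → ℝ} (hf : Measurable f) {C : ℝ} (hC : ∀ x, |f x| ≤ C) :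
    f ∈ testSpace P hb := mem_of_mem_Phi (Phi.of_bounded hb hf hC)

theorem memLp (f : testSpace P hb) : MemLp (f : S → ℝ) 2 (P : Measure S) := by
  obtain ⟨hf, F, hF, hF1, C, hC, hfC⟩ := f.2
  refine (((mem_Phi_iff hb).1 hF).2.1.const_mul C).mono hf.aestronglyMeasurable
    (Eventually.of_forall fun x => (hfC x).trans (le_abs_self _))

theorem integrable_variation (f : testSpace P hb) (G : Lambda0 (Phi P b)) :
    Integrable (f : S → ℝ) (G : SignedMeasure S).variation := by
  obtain ⟨hf, F, hF, hF1, C, hC, hfC⟩ := f.2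
  exact integrable_variation_of_abs_le G hF hf hfC

/-- The natural map into `L²(P)`. -/
def toL2 (P : ProbabilityMeasure S) {b : ℕ → ℝ} (hb : Normalizing b) :
    testSpace P hb →ₗ[ℝ] Lp ℝ 2 (P : Measure S) where
  toFun f := (memLp f).toLp _
  map_add' _ _ := rfl
  map_smul' _ _ := rfl

theorem norm_toL2_sq (f : testSpace P hb) :
    ‖toL2 P hb f‖ ^ 2 = ∫ x, (f : S → ℝ) x ^ 2 ∂(P : Measure S) := by
  rw [← real_inner_self_eq_norm_sq, L2.inner_def]
  refine integral_congr_ae ?_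
  filter_upwards [(memLp f).coeFn_toLp] with x hx
  change inner ℝ ((memLp f).toLp _ x) ((memLp f).toLp _ x) = _
  rw [hx]
  simp [sq]

theorem denseRange_toL2 : DenseRange (toL2 P hb) := by
  refine (Lp.simpleFunc.denseRange (E := ℝ) (μ := (P : Measure S)) (p := 2) (by simp)).mono ?_
  rintro _ ⟨f, rfl⟩
  have hm := (Lp.simpleFunc.toSimpleFunc f).measurable
  obtain ⟨C, hC⟩ := (Lp.simpleFunc.toSimpleFunc f).exists_forall_norm_le
  refine ⟨⟨_, mem_of_bounded hm hC⟩, ?_⟩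
  refine Lp.ext ?_
  refine (MemLp.coeFn_toLp (memLp (P := P) (hb := hb) ⟨_, mem_of_bounded hm hC⟩)).trans ?_
  exact Lp.simpleFunc.toSimpleFunc_eq_toFun f

/-- Riesz representation of functionals on the test functions that are bounded in `L²(P)`. -/
theorem exists_density (ξ : testSpace P hb →ₗ[ℝ] ℝ) {C : ℝ}
    (hξ : ∀ f, |ξ f| ≤ C * ‖toL2 P hb f‖) :
    ∃ g : Lp ℝ 2 (P : Measure S), ∀ f, ξ f = inner ℝ g (toL2 P hb f) := by
  refine ⟨(InnerProductSpace.toDual ℝ _).symm (ξ.extendOfNorm (toL2 P hb)), fun f => ?_⟩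
  rw [InnerProductSpace.toDual_symm_apply, LinearMap.extendOfNorm_eq denseRange_toL2 ⟨C, hξ⟩]

theorem inner_toL2 (g : Lp ℝ 2 (P : Measure S)) (f : testSpace P hb) :
    inner ℝ g (toL2 P hb f) = ∫ x, (f : S → ℝ) x * g x ∂(P : Measure S) := by
  rw [L2.inner_def]
  refine integral_congr_ae ?_
  filter_upwards [(memLp f).coeFn_toLp] with x hx
  change inner ℝ (g x) ((memLp f).toLp _ x) = _
  rw [hx]
  simp

theorem le_of_inner_le {ν α : ℝ} (hν : 0 < ν) (hα : 0 ≤ α) {g₂ g₁ : Lp ℝ 2 (P : Measure S)}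
    (h : ∀ f g : testSpace P hb, inner ℝ g₂ (toL2 P hb f) + inner ℝ g₁ (toL2 P hb g)
      ≤ √(2 * α * (‖toL2 P hb f‖ ^ 2 / ν + ‖toL2 P hb g‖ ^ 2))) :
    ν * ‖g₂‖ ^ 2 + ‖g₁‖ ^ 2 ≤ 2 * α := by
  have hall : ∀ p : Lp ℝ 2 (P : Measure S) × Lp ℝ 2 (P : Measure S),
      inner ℝ g₂ p.1 + inner ℝ g₁ p.2 ≤ √(2 * α * (‖p.1‖ ^ 2 / ν + ‖p.2‖ ^ 2)) := by
    intro p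
    refine (denseRange_toL2 (P := P) (hb := hb)).prodMap (denseRange_toL2 (P := P) (hb := hb))
      |>.induction_on p ?_ fun q => h q.1 q.2
    exact isClosed_le (by fun_prop) (by fun_prop)
  have h1 := hall (ν • g₂, g₁)
  simp only [inner_smul_right, real_inner_self_eq_norm_sq, norm_smul, Real.norm_eq_abs, mul_pow,
    sq_abs] at h1
  have h2 : ν ^ 2 * ‖g₂‖ ^ 2 / ν = ν * ‖g₂‖ ^ 2 := by field_simp
  rw [h2] at h1
  set X := ν * ‖g₂‖ ^ 2 + ‖g₁‖ ^ 2 with hX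
  have hX0 : 0 ≤ X := by positivity
  have h3 := Real.le_sqrt' (y := 2 * α * X) (x := X)
  rcases hX0.eq_or_lt with h0 | h0
  · rw [← h0]; positivity
  · have := (h3 h0).1 h1
    nlinarith

end testSpace

/-! ### Densities and the rate function -/

theorem rho0sq_withDensity {P : ProbabilityMeasure S} {g : S → ℝ} (hg : MemLp g 2 (P : Measure S)) :
    rho0sq ((P : Measure S).withDensityᵥ g) P
      = ENNReal.ofReal (2⁻¹ * ∫ x, g x ^ 2 ∂(P : Measure S)) := by
  have hac := Measure.withDensityᵥ_absolutelyContinuous (P : Measure S) g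
  have hgi : Integrable g (P : Measure S) := hg.integrable (by norm_num)
  rw [rho0sq, if_pos hac, ENNReal.ofReal_mul (by norm_num), ofReal_integral_eq_lintegral_ofReal
    hg.integrable_sq (Eventually.of_forall fun x => sq_nonneg _)]
  congr 1
  · rw [ENNReal.ofReal_inv_of_pos (by norm_num)]; simp
  · refine lintegral_congr_ae ?_
    have := (SignedMeasure.integrable_rnDeriv ((P : Measure S).withDensityᵥ g)
      (P : Measure S)).ae_eq_of_withDensityᵥ_eq hgi
      (SignedMeasure.withDensityᵥ_rnDeriv_eq _ _ hac)
    filter_upwards [this] with x hx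
    rw [hx]

theorem rho0bsq_eq {P : ProbabilityMeasure S} {Φ : Set (S → ℝ)} {ν : ℝ} (hν : 0 < ν)
    {G : Lambda0 Φ × Lambda0 Φ} {g₂ g₁ : S → ℝ} (hg₂ : MemLp g₂ 2 (P : Measure S))
    (hg₁ : MemLp g₁ 2 (P : Measure S))
    (h₂ : (G.1 : SignedMeasure S) = (P : Measure S).withDensityᵥ g₂)
    (h₁ : (G.2 : SignedMeasure S) = (P : Measure S).withDensityᵥ g₁) :
    rho0bsq ν P G = ENNReal.ofReal (2⁻¹ * (ν * ∫ x, g₂ x ^ 2 ∂(P : Measure S)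
      + ∫ x, g₁ x ^ 2 ∂(P : Measure S))) := by
  have i2 : 0 ≤ ∫ x, g₂ x ^ 2 ∂(P : Measure S) := integral_nonneg fun _ => sq_nonneg _
  have i1 : 0 ≤ ∫ x, g₁ x ^ 2 ∂(P : Measure S) := integral_nonneg fun _ => sq_nonneg _
  rw [rho0bsq, h₂, h₁, rho0sq_withDensity hg₂, rho0sq_withDensity hg₁, ← ENNReal.ofReal_mul hν.le,
    ← ENNReal.ofReal_add (by positivity) (by positivity)]
  congr 1
  ring

theorem sint_one {G : SignedMeasure S} : sint G (fun _ => 1) = G Set.univ := by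
  rw [sint, VectorMeasure.integral_const]
  simp

theorem withDensity_mem_Lambda0 {P : ProbabilityMeasure S} {b : ℕ → ℝ} (hb : Normalizing b)
    {g : S → ℝ} (hg : MemLp g 2 (P : Measure S)) (h0 : ∫ x, g x ∂(P : Measure S) = 0) :
    (P : Measure S).withDensityᵥ g ∈ Lambda0 (Phi P b) := by
  have hgi : Integrable g (P : Measure S) := hg.integrable (by norm_num)
  refine ⟨?_, fun f hf => ?_⟩
  · rw [withDensityᵥ_apply hgi MeasurableSet.univ]
    simpa using h0
  · have hf' := (mem_Phi_iff hb).1 hf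
    exact integrable_variation_withDensity hgi hf'.1 (hf'.2.1.integrable_mul hg)

/-! ### Covering closed sets by half-spaces -/

section Cover

variable {P : ProbabilityMeasure S} {b : ℕ → ℝ}

theorem exists_tendsto_of_bounded {ι : Type*} (u : Ultrafilter ι) {f : ι → ℝ} {M : ℝ}
    (h : ∀ᶠ i in (u : Filter ι), |f i| ≤ M) : ∃ l, Tendsto f u (𝓝 l) := by
  obtain ⟨l, _, hl⟩ := (isCompact_Icc (a := -M) (b := M)).ultrafilter_le_nhds (u.map f) (by
    rw [le_principal_iff]
    exact h.mono fun i hi => abs_le.1 hi)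
  exact ⟨l, hl⟩

theorem tendsto_Lambda0_iff {Φ : Set (S → ℝ)} {ι : Type*} {l : Filter ι} {G : ι → Lambda0 Φ}
    {G₀ : Lambda0 Φ} : Tendsto G l (𝓝 G₀) ↔
      ∀ f ∈ Φ, Tendsto (fun i => sint (G i : SignedMeasure S) f) l
        (𝓝 (sint (G₀ : SignedMeasure S) f)) := by
  rw [nhds_induced, tendsto_comap_iff, tendsto_pi_nhds]
  exact ⟨fun h f hf => h ⟨f, hf⟩, fun h f => h f f.2⟩

theorem exists_ultrafilter_mem {X ι : Type*} {K : Set X} {U : ι → Set X}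
    (h : ∀ s : Finset ι, ∃ x ∈ K, ∀ i ∈ s, x ∈ U i) :
    ∃ u : Ultrafilter X, K ∈ u ∧ ∀ i, U i ∈ u := by
  classical
  have hdir : Directed (· ≥ ·) fun s : Finset ι => 𝓟 (K ∩ ⋂ i ∈ s, U i) := by
    intro s t
    refine ⟨s ∪ t, ?_, ?_⟩ <;> simp only [ge_iff_le, principal_mono]
    · exact Set.inter_subset_inter_right _
        (Set.biInter_subset_biInter_left fun i hi => Finset.mem_union_left _ hi)
    · exact Set.inter_subset_inter_right _
        (Set.biInter_subset_biInter_left fun i hi => Finset.mem_union_right _ hi)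
  have hne : NeBot (⨅ s : Finset ι, 𝓟 (K ∩ ⋂ i ∈ s, U i)) :=
    iInf_neBot_of_directed' hdir fun s => principal_neBot_iff.2 <| by
      obtain ⟨x, hx, hxs⟩ := h s
      exact ⟨x, hx, Set.mem_iInter₂.2 hxs⟩
  have hu : ∀ s : Finset ι, K ∩ ⋂ i ∈ s, U i ∈
      Ultrafilter.of (⨅ s : Finset ι, 𝓟 (K ∩ ⋂ i ∈ s, U i)) := fun s =>
    Ultrafilter.of_le _ (mem_iInf_of_mem s (mem_principal_self _))
  exact ⟨_, mem_of_superset (hu ∅) Set.inter_subset_left, fun i =>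
    mem_of_superset (hu {i}) fun x hx => by simpa using hx.2⟩

theorem sint_zero_right (G : SignedMeasure S) : sint G (0 : S → ℝ) = 0 :=
  VectorMeasure.integral_zero

theorem sint_neg_right (G : SignedMeasure S) (f : S → ℝ) : sint G (-f) = -sint G f := by
  have := sint_const_mul G (-1) f
  simpa using! this

/-- An ultrafilter along which the signed measures are bounded in the dual of `L²(P)` converges to
a signed measure with a density in `L²(P)`. -/
theorem exists_limit_density {hb : Normalizing b} {X : Type*} (u : Ultrafilter X)
    (m : X → Lambda0 (Phi P b)) {C : ℝ}
    (h : ∀ (f : testSpace P hb) (c : ℝ), C * ‖testSpace.toL2 P hb f‖ < c →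
      ∀ᶠ i in (u : Filter X), sint (m i : SignedMeasure S) f < c) :
    ∃ (g : Lp ℝ 2 (P : Measure S)) (G : Lambda0 (Phi P b)),
      (G : SignedMeasure S) = (P : Measure S).withDensityᵥ g ∧ Tendsto m u (𝓝 G) ∧
      ∀ f : testSpace P hb, Tendsto (fun i => sint (m i : SignedMeasure S) f) u
        (𝓝 (inner ℝ g (testSpace.toL2 P hb f))) := by
  have hlim : ∀ f : testSpace P hb, ∃ l,
      Tendsto (fun i => sint (m i : SignedMeasure S) f) u (𝓝 l) := by
    intro f
    refine exists_tendsto_of_bounded u (M := C * ‖testSpace.toL2 P hb f‖ + 1) ?_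
    filter_upwards [h f _ (lt_add_one _), h (-f) _ (lt_add_one _)] with i h1 h2
    rw [Submodule.coe_neg, sint_neg_right, map_neg, norm_neg] at h2
    rw [abs_le]
    constructor <;> linarith
  choose ξ hξ using hlim
  have hadd : ∀ f g : testSpace P hb, ξ (f + g) = ξ f + ξ g := by
    intro f g
    have hfg := hξ (f + g)
    have hsum : (fun i => sint (m i : SignedMeasure S) ((f + g : testSpace P hb) : S → ℝ))
        = fun i => sint (m i : SignedMeasure S) f + sint (m i : SignedMeasure S) g := by
      funext i
      have hcoe : ((f + g : testSpace P hb) : S → ℝ)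
          = fun x => (f : S → ℝ) x + (g : S → ℝ) x := rfl
      rw [hcoe, sint_add (testSpace.integrable_variation f (m i))
        (testSpace.integrable_variation g (m i))]
    rw [hsum] at hfg
    exact tendsto_nhds_unique hfg ((hξ f).add (hξ g))
  have hsmul : ∀ (c : ℝ) (f : testSpace P hb), ξ (c • f) = c • ξ f := by
    intro c f
    have hcf := hξ (c • f)
    have hmul : (fun i => sint (m i : SignedMeasure S) ((c • f : testSpace P hb) : S → ℝ))
        = fun i => c * sint (m i : SignedMeasure S) f := by
      funext i
      have hcoe : ((c • f : testSpace P hb) : S → ℝ) = fun x => c * (f : S → ℝ) x := rfl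
      rw [hcoe, sint_const_mul]
    rw [hmul] at hcf
    exact tendsto_nhds_unique hcf ((hξ f).const_mul c)
  let ξL : testSpace P hb →ₗ[ℝ] ℝ := { toFun := ξ, map_add' := hadd, map_smul' := hsmul }
  have hle : ∀ f, ξL f ≤ C * ‖testSpace.toL2 P hb f‖ := by
    intro f
    refine le_of_forall_gt_imp_ge_of_dense fun c hc => ?_
    exact le_of_tendsto (hξ f) ((h f c hc).mono fun i hi => hi.le)
  obtain ⟨g, hg⟩ := testSpace.exists_density ξL (C := C) fun f => by
    have h1 := hle f
    have h2 := hle (-f)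
    rw [map_neg, map_neg, norm_neg] at h2
    rw [abs_le]
    constructor <;> linarith
  have hξg : ∀ f : testSpace P hb, Tendsto (fun i => sint (m i : SignedMeasure S) f) u
      (𝓝 (inner ℝ g (testSpace.toL2 P hb f))) := fun f => by
    rw [← hg]
    exact hξ f
  have mg : MemLp g 2 (P : Measure S) := Lp.memLp g
  have hz : ∫ x, g x ∂(P : Measure S) = 0 := by
    have h1 := hξg ⟨fun _ => 1, testSpace.mem_of_bounded measurable_const (C := 1) (by simp)⟩
    have h2 : ∀ i, sint (m i : SignedMeasure S) (fun _ => 1) = 0 :=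
      fun i => sint_one.trans (m i).2.1
    simp only [h2, testSpace.inner_toL2, one_mul] at h1
    exact tendsto_nhds_unique h1 tendsto_const_nhds
  refine ⟨g, ⟨_, withDensity_mem_Lambda0 hb mg hz⟩, rfl, ?_, hξg⟩
  rw [tendsto_Lambda0_iff]
  intro f hf
  have hf' := (mem_Phi_iff hb).1 hf
  have h1 := hξg ⟨f, testSpace.mem_of_mem_Phi hf⟩
  rw [testSpace.inner_toL2] at h1
  rwa [sint_withDensity (mg.integrable (by norm_num)) hf'.1 (hf'.2.1.integrable_mul mg)]

theorem exists_halfspace_cover (hb : Normalizing b) {ν α : ℝ} (hν : 0 < ν) (hα : 0 ≤ α)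
    {K : Set (Lambda0 (Phi P b) × Lambda0 (Phi P b))} (hK : IsClosed K)
    (hKα : ENNReal.ofReal α < rho0bsqSet ν P K) :
    ∃ s : Finset (testSpace P hb × testSpace P hb × ℝ),
      (∀ i ∈ s, √(2 * α * ((∫ x, (i.1 : S → ℝ) x ^ 2 ∂(P : Measure S)) / ν
        + ∫ x, (i.2.1 : S → ℝ) x ^ 2 ∂(P : Measure S))) < i.2.2) ∧
      ∀ G ∈ K, ∃ i ∈ s, i.2.2 ≤ sint (G.1 : SignedMeasure S) i.1
        + sint (G.2 : SignedMeasure S) i.2.1 := by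
  classical
  by_contra hcon
  push Not at hcon
  obtain ⟨R, hR⟩ : ∃ R : testSpace P hb → testSpace P hb → ℝ, ∀ f g, R f g
      = √(2 * α * (‖testSpace.toL2 P hb f‖ ^ 2 / ν + ‖testSpace.toL2 P hb g‖ ^ 2)) :=
    ⟨_, fun _ _ => rfl⟩
  obtain ⟨u, huK, hu⟩ := exists_ultrafilter_mem (K := K)
    (ι := {i : testSpace P hb × testSpace P hb × ℝ // R i.1 i.2.1 < i.2.2})
    (U := fun i => {G | sint (G.1 : SignedMeasure S) i.1.1
      + sint (G.2 : SignedMeasure S) i.1.2.1 < i.1.2.2}) (by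
    intro s
    obtain ⟨G, hG, hGs⟩ := hcon (s.image Subtype.val) (by
      intro i hi
      obtain ⟨j, _, rfl⟩ := Finset.mem_image.1 hi
      have := j.2
      rw [hR, testSpace.norm_toL2_sq, testSpace.norm_toL2_sq] at this
      exact this)
    exact ⟨G, hG, fun i hi => hGs i.1 (Finset.mem_image_of_mem _ hi)⟩)
  have hhalf : ∀ (f g : testSpace P hb) (c : ℝ), R f g < c →
      ∀ᶠ G in (u : Filter (Lambda0 (Phi P b) × Lambda0 (Phi P b))),
      sint (G.1 : SignedMeasure S) (f : S → ℝ) + sint (G.2 : SignedMeasure S) (g : S → ℝ) < c :=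
    fun f g c hc => hu ⟨(f, g, c), hc⟩
  obtain ⟨g₂, G₂, hG₂, hconv₂, hlim₂⟩ := exists_limit_density (hb := hb) u (fun G => G.1)
    (C := √(2 * α / ν)) fun f c hc => by
      have hRf : R f 0 = √(2 * α / ν) * ‖testSpace.toL2 P hb f‖ := by
        rw [hR, map_zero, norm_zero, zero_pow two_ne_zero, add_zero, ← mul_div_assoc,
          mul_div_right_comm, Real.sqrt_mul (by positivity), Real.sqrt_sq (norm_nonneg _)]
      filter_upwards [hhalf f 0 c (hRf ▸ hc)] with G hG
      rwa [Submodule.coe_zero, sint_zero_right, add_zero] at hG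
  obtain ⟨g₁, G₁, hG₁, hconv₁, hlim₁⟩ := exists_limit_density (hb := hb) u (fun G => G.2)
    (C := √(2 * α)) fun f c hc => by
      have hRf : R 0 f = √(2 * α) * ‖testSpace.toL2 P hb f‖ := by
        rw [hR, map_zero, norm_zero, zero_pow two_ne_zero, zero_div, zero_add,
          Real.sqrt_mul (by positivity), Real.sqrt_sq (norm_nonneg _)]
      filter_upwards [hhalf 0 f c (hRf ▸ hc)] with G hG
      rwa [Submodule.coe_zero, sint_zero_right, zero_add] at hG
  have hbound := testSpace.le_of_inner_le hν hα (g₂ := g₂) (g₁ := g₁) (hb := hb) fun f g => by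
    rw [← hR]
    refine le_of_forall_gt_imp_ge_of_dense fun c hc => ?_
    exact le_of_tendsto ((hlim₂ f).add (hlim₁ g)) ((hhalf f g c hc).mono fun G hG => hG.le)
  have hconv : Tendsto (fun G => G) (u : Filter (Lambda0 (Phi P b) × Lambda0 (Phi P b)))
      (𝓝 (G₂, G₁)) := hconv₂.prodMk_nhds hconv₁
  have hmem : (G₂, G₁) ∈ K := hK.mem_of_tendsto hconv huK
  have hrate : rho0bsq ν P (G₂, G₁) ≤ ENNReal.ofReal α := by
    rw [rho0bsq_eq hν (Lp.memLp g₂) (Lp.memLp g₁) hG₂ hG₁]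
    refine ENNReal.ofReal_le_ofReal ?_
    have hn : ∀ g : Lp ℝ 2 (P : Measure S), ∫ x, g x ^ 2 ∂(P : Measure S) = ‖g‖ ^ 2 := by
      intro g
      rw [← real_inner_self_eq_norm_sq, L2.inner_def]
      simp [sq]
    rw [hn, hn]
    linarith
  exact absurd (hKα.trans_le (iInf₂_le _ hmem)) (not_lt.2 hrate)

end Cover

/-! ### The upper bound -/

section UpperBound

variable {P : ProbabilityMeasure S} {b : ℕ → ℝ} {Pn : ℕ → ProbabilityMeasure S}
  {Hn : ℕ → Lambda0 (Phi P b)} {H : Lambda0 (Phi P b)} {k : ℕ → ℕ} {ν : ℝ}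

theorem sampleLaw_le_one (Q : ProbabilityMeasure S) (n k : ℕ) (s : Set ((Fin n → S) × (Fin k → S))) :
    sampleLaw Q n k s ≤ 1 := by
  refine (measure_mono (Set.subset_univ s)).trans ?_
  rw [sampleLaw, Measure.compProd_apply MeasurableSet.univ]
  refine (lintegral_mono (g := fun _ => 1) fun x => ?_).trans (by simp)
  change Measure.pi (fun _ : Fin k => empirical x) _ ≤ 1
  refine (measure_mono (Set.subset_univ _)).trans ?_
  rw [Measure.pi_univ]
  exact Finset.prod_le_one' fun i _ => empirical_univ_le x

theorem exists_lt_mul_sub {α c V : ℝ} (hα : 0 ≤ α) (hV : 0 ≤ V) (h : √(2 * α * V) < c) :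
    ∃ t > 0, α < t * c - t ^ 2 / 2 * V := by
  have hc : 0 < c := (Real.sqrt_nonneg _).trans_lt h
  rw [Real.sqrt_lt' hc] at h
  rcases hV.eq_or_lt with rfl | hV
  · refine ⟨(α + 1) / c, by positivity, ?_⟩
    rw [div_mul_cancel₀ _ hc.ne']
    linarith
  · refine ⟨c / V, by positivity, ?_⟩
    have : c / V * c - (c / V) ^ 2 / 2 * V = c ^ 2 / (2 * V) := by field_simp; ring
    rw [this, lt_div_iff₀ (by positivity)]
    linarith

theorem testSpace.expBound_halfspace (hb : Normalizing b) (hA : AssumptionA P b Pn Hn H)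
    (hB1 : AssumptionB1 P b Hn) (hν : 0 < ν)
    (hk : Tendsto (fun n : ℕ => (k n : ℝ) / (n : ℝ)) atTop (𝓝 ν)) {α c : ℝ} (hα : 0 ≤ α)
    (f g : testSpace P hb)
    (hc : √(2 * α * ((∫ x, (f : S → ℝ) x ^ 2 ∂(P : Measure S)) / ν
        + ∫ x, (g : S → ℝ) x ^ 2 ∂(P : Measure S))) < c) :
    ∃ a > α, ExpBound b (fun n => sampleLaw (Pn n) n (k n)
      {w | (c + sint (H : SignedMeasure S) g) * b n
        ≤ avg w.2 f - avg w.1 f + (avg w.1 g - ∫ x, (g : S → ℝ) x ∂(P : Measure S))}) a := by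
  obtain ⟨hf, F, hF, hF1, C, hC, hfC⟩ := f.2
  obtain ⟨hg, F', hF', hF1', C', hC', hgC⟩ := g.2
  have hM := Phi.sup hb hF hF'
  have hM1 : ∀ x, 1 ≤ max |F x| |F' x| := fun x =>
    le_max_of_le_left ((hF1 x).trans (le_abs_self _))
  have hfM : ∀ x, |(f : S → ℝ) x| ≤ max C C' * max |F x| |F' x| := fun x =>
    (hfC x).trans (mul_le_mul (le_max_left _ _) ((le_abs_self _).trans (le_max_left _ _))
      (zero_le_one.trans (hF1 x)) (hC.le.trans (le_max_left _ _)))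
  have hgM : ∀ x, |(g : S → ℝ) x| ≤ max C C' * max |F x| |F' x| := fun x =>
    (hgC x).trans (mul_le_mul (le_max_right _ _) ((le_abs_self _).trans (le_max_right _ _))
      (zero_le_one.trans (hF1' x)) (hC.le.trans (le_max_left _ _)))
  have hV : 0 ≤ (∫ x, (f : S → ℝ) x ^ 2 ∂(P : Measure S)) / ν
      + ∫ x, (g : S → ℝ) x ^ 2 ∂(P : Measure S) := by positivity
  obtain ⟨t, ht, htα⟩ := exists_lt_mul_sub hα hV hc
  obtain ⟨a, ha, hat⟩ := exists_between htα
  refine ⟨a, ha, (hA.regularArray hb hB1 hM hM1).halfspace_bound hf hg hfM hgM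
    (hA.tendsto_drift hb hM (fun x => zero_le_one.trans (hM1 x)) hg
      (hC.trans_le (le_max_left _ _)) hgM) hν hk ht ?_⟩
  rwa [add_sub_cancel_right]

theorem mul_sint_of_sub_eq {μ₂ μ₁ : Measure S} [IsFiniteMeasure μ₂] [IsFiniteMeasure μ₁]
    {G : SignedMeasure S} {β : ℝ} (h : μ₂.toSignedMeasure - μ₁.toSignedMeasure = β • G) {f : S → ℝ}
    (h₂ : Integrable f μ₂) (h₁ : Integrable f μ₁) :
    β * sint G f = ∫ x, f x ∂μ₂ - ∫ x, f x ∂μ₁ := by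
  rw [← sint_smul_left, ← h, sint_sub_left (by simpa using h₂) (by simpa using h₁),
    sint_toSignedMeasure, sint_toSignedMeasure]

theorem le_of_mem_deviationEvent (hb : Normalizing b) {β : ℝ} (hβ : 0 < β) {n k : ℕ}
    {Ω : Set (Lambda0 (Phi P b) × Lambda0 (Phi P b))} {w : (Fin n → S) × (Fin k → S)}
    (hw : w ∈ deviationEvent P β Ω n k) :
    ∃ G ∈ (fun G => G - (0, H)) '' Ω, ∀ (f g : testSpace P hb) (c : ℝ),
      c ≤ sint (G.1 : SignedMeasure S) f + sint (G.2 : SignedMeasure S) g →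
      (c + sint (H : SignedMeasure S) g) * β
        ≤ avg w.2 f - avg w.1 f + (avg w.1 g - ∫ x, (g : S → ℝ) x ∂(P : Measure S)) := by
  obtain ⟨G, hG, h₁, h₂⟩ := hw
  refine ⟨_, ⟨G, hG, rfl⟩, fun f g c hc => ?_⟩
  have e₁ := mul_sint_of_sub_eq h₁ (integrable_empirical _ f.2.1) (integrable_empirical _ f.2.1)
  have e₂ := mul_sint_of_sub_eq h₂ (integrable_empirical _ g.2.1)
    ((testSpace.memLp g).integrable (by norm_num))
  rw [integral_empirical _ f.2.1, integral_empirical _ f.2.1] at e₁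
  rw [integral_empirical _ g.2.1] at e₂
  have e₃ : sint ((G - (0, H)).2 : SignedMeasure S) g
      = sint (G.2 : SignedMeasure S) g - sint (H : SignedMeasure S) g :=
    sint_sub_left (testSpace.integrable_variation g G.2) (testSpace.integrable_variation g H)
  have e₄ : (G - (0, H)).1 = G.1 := sub_zero G.1
  rw [e₃, e₄] at hc
  rw [← e₁, ← e₂, ← mul_add, mul_comm]
  exact mul_le_mul_of_nonneg_left (by linarith) hβ.le

theorem limsup_scaledLog_le (hb : Normalizing b) (hA : AssumptionA P b Pn Hn H)
    (hB1 : AssumptionB1 P b Hn) (hν : 0 < ν)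
    (hk : Tendsto (fun n : ℕ => (k n : ℝ) / (n : ℝ)) atTop (𝓝 ν))
    (Ω : Set (Lambda0 (Phi P b) × Lambda0 (Phi P b))) :
    limsup (fun n : ℕ => scaledLog n (b n) (sampleLaw (Pn n) n (k n)
      (deviationEvent P (b n) Ω n (k n)))) atTop
        ≤ -((rho0bsqSet ν P (closure ((fun G => G - (0, H)) '' Ω)) : ℝ≥0∞) : EReal) := by
  rw [← EReal.le_of_forall_lt_iff_le]
  intro z hz
  suffices h : ExpBound b (fun n => sampleLaw (Pn n) n (k n)
      (deviationEvent P (b n) Ω n (k n))) (-z) by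
    refine limsup_le_of_le (by isBoundedDefault) ?_
    filter_upwards [h, hb.eventually_speed_pos] with n hn hpos
    rw [scaledLog_le_iff hpos]
    simpa using hn
  rcases le_or_gt 0 z with hz0 | hz0
  · refine Eventually.of_forall fun n => (sampleLaw_le_one _ _ _ _).trans ?_
    rw [neg_neg, ENNReal.one_le_ofReal, Real.one_le_exp_iff]
    positivity
  · have hα : ENNReal.ofReal (-z) < rho0bsqSet ν P (closure ((fun G => G - (0, H)) '' Ω)) := by
      rw [EReal.neg_lt_comm] at hz
      rw [← EReal.coe_ennreal_lt_coe_ennreal_iff, EReal.coe_ennreal_ofReal,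
        max_eq_left (by linarith)]
      simpa using hz
    obtain ⟨s, hs, hcover⟩ := exists_halfspace_cover hb hν (by linarith) isClosed_closure hα
    obtain ⟨a, ha, hbound⟩ := ExpBound.finset_sum hb s fun i hi =>
      testSpace.expBound_halfspace hb hA hB1 hν hk (by linarith) i.1 i.2.1 (hs i hi)
    refine (hbound.anti ha.le).mono ?_
    filter_upwards [hb.eventually_pos] with n hn
    refine (measure_mono fun w hw => ?_).trans (measure_biUnion_finset_le s _)
    obtain ⟨G, hG, hGle⟩ := le_of_mem_deviationEvent (H := H) hb hn hw
    obtain ⟨i, hi, hGi⟩ := hcover G (subset_closure hG)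
    exact Set.mem_iUnion₂.2 ⟨i, hi, hGle _ _ _ hGi⟩

end UpperBound

/-! ### Exponential tilting of product measures -/

theorem pi_tilted {N : ℕ} (Q : Measure S) [IsProbabilityMeasure Q] {h : S → ℝ}
    (hexp : Integrable (fun x => Real.exp (h x)) Q) :
    Measure.pi (fun _ : Fin N => Q.tilted h) = (Measure.pi fun _ : Fin N => Q).withDensity
      fun x => ENNReal.ofReal (∏ i, (Real.exp (h (x i)) / ∫ y, Real.exp (h y) ∂Q)) := by
  have := isProbabilityMeasure_tilted hexp
  have hZ : 0 ≤ ∫ y, Real.exp (h y) ∂Q := integral_nonneg fun y => (Real.exp_pos _).le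
  refine Measure.pi_eq fun s hs => ?_
  rw [withDensity_apply _ (MeasurableSet.univ_pi hs), Measure.restrict_pi_pi,
    ← ofReal_integral_eq_lintegral_ofReal]
  · rw [integral_fintype_prod_eq_prod
      (f := fun (_ : Fin N) y => Real.exp (h y) / ∫ y, Real.exp (h y) ∂Q),
      ENNReal.ofReal_prod_of_nonneg]
    · exact Finset.prod_congr rfl fun i _ => (tilted_apply_eq_ofReal_integral' h (hs i)).symm
    · exact fun i _ => integral_nonneg fun y => by positivity
  · exact Integrable.fintype_prod
      (f := fun (_ : Fin N) y => Real.exp (h y) / ∫ y, Real.exp (h y) ∂Q)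
      fun i => (hexp.div_const _).restrict
  · exact Eventually.of_forall fun x => Finset.prod_nonneg fun i _ => by positivity

theorem pi_tilted_le {N : ℕ} (Q : Measure S) [IsProbabilityMeasure Q] {h : S → ℝ}
    (hexp : Integrable (fun x => Real.exp (h x)) Q) {E : Set (Fin N → S)} (hE : MeasurableSet E)
    {R : ℝ} (hR : ∀ x ∈ E, ∑ i, h (x i) - N * Real.log (∫ y, Real.exp (h y) ∂Q) ≤ R) :
    Measure.pi (fun _ : Fin N => Q.tilted h) E
      ≤ ENNReal.ofReal (Real.exp R) * Measure.pi (fun _ : Fin N => Q) E := by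
  have hZ : 0 < ∫ y, Real.exp (h y) ∂Q := integral_exp_pos hexp
  rw [pi_tilted Q hexp, withDensity_apply _ hE, ← setLIntegral_const]
  refine setLIntegral_mono measurable_const fun x hx => ENNReal.ofReal_le_ofReal ?_
  rw [Finset.prod_div_distrib, ← Real.exp_sum, Finset.prod_const, Finset.card_univ,
    Fintype.card_fin, div_le_iff₀ (by positivity), ← Real.exp_log (pow_pos hZ N), ← Real.exp_add,
    Real.log_pow, Real.exp_le_exp]
  linarith [hR x hx]

theorem chebyshev_avg {N : ℕ} (hN : 1 ≤ N) (Q : Measure S) [IsProbabilityMeasure Q] {φ : S → ℝ}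
    (hφ : MemLp φ 2 Q) {t : ℝ} (ht : 0 < t) :
    Measure.pi (fun _ : Fin N => Q) {x | t ≤ |avg x φ - ∫ y, φ y ∂Q|}
      ≤ ENNReal.ofReal ((∫ y, φ y ^ 2 ∂Q) / (N * t ^ 2)) := by
  have hN0 : (0 : ℝ) < N := by positivity
  have hφi : ∀ i : Fin N, MemLp (fun x : Fin N → S => φ (x i)) 2 (Measure.pi fun _ => Q) :=
    fun i => hφ.comp_measurePreserving (measurePreserving_eval (fun _ : Fin N => Q) i)
  have hsum : MemLp (∑ i, fun x : Fin N → S => φ (x i)) 2 (Measure.pi fun _ => Q) :=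
    memLp_finsetSum' _ fun i _ => hφi i
  have hmean : ∫ x : Fin N → S, (∑ i, fun x : Fin N → S => φ (x i)) x ∂(Measure.pi fun _ => Q)
      = N * ∫ y, φ y ∂Q := by
    simp only [Finset.sum_apply]
    rw [integral_finsetSum _ fun i _ => (hφi i).integrable (by norm_num)]
    have : ∀ i : Fin N, ∫ x : Fin N → S, φ (x i) ∂(Measure.pi fun _ => Q) = ∫ y, φ y ∂Q :=
      fun i => by
        have hmp := measurePreserving_eval (fun _ : Fin N => Q) i
        have hmap := integral_map (μ := Measure.pi fun _ : Fin N => Q) (f := φ)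
          hmp.measurable.aemeasurable (by rw [hmp.map_eq]; exact hφ.aestronglyMeasurable)
        rw [hmp.map_eq] at hmap
        exact hmap.symm
    simp [this]
  have hvar := variance_sum_pi (μ := fun _ : Fin N => Q) (X := fun _ => φ) fun _ => hφ
  have h := meas_ge_le_variance_div_sq hsum (c := N * t) (by positivity)
  rw [hmean, hvar] at h
  refine (measure_mono fun x hx => ?_).trans (h.trans (ENNReal.ofReal_le_ofReal ?_))
  · have hx' : t ≤ |avg x φ - ∫ y, φ y ∂Q| := hx
    have e : (∑ i, fun x : Fin N → S => φ (x i)) x - N * ∫ y, φ y ∂Q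
        = N * (avg x φ - ∫ y, φ y ∂Q) := by
      rw [mul_sub, natCast_mul_avg hN]
      simp
    change N * t ≤ |_ - _|
    rw [e, abs_mul, abs_of_pos hN0]
    gcongr
  · have hv : variance φ Q ≤ ∫ y, φ y ^ 2 ∂Q := variance_le_expectation_sq hφ.aestronglyMeasurable
    have hv0 := variance_nonneg φ Q
    simp only [Finset.sum_const, Finset.card_univ, Fintype.card_fin, nsmul_eq_mul]
    calc N * variance φ Q / (N * t) ^ 2 = variance φ Q / (N * t ^ 2) := by
          field_simp
      _ ≤ _ := by gcongr

/-! ### Moments under a weakly tilted law -/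

section TiltedMoments

variable {Q : Measure S} {g φ : S → ℝ} {M β : ℝ}

theorem integrable_exp_mul [IsProbabilityMeasure Q] (hg : Measurable g) (hM : ∀ x, |g x| ≤ M)
    (hβ : 0 ≤ β) :
    Integrable (fun x => Real.exp (β * g x)) Q := by
  refine Integrable.of_bound (by fun_prop) (Real.exp (β * M)) (Eventually.of_forall fun x => ?_)
  rw [Real.norm_eq_abs, Real.abs_exp, Real.exp_le_exp]
  exact mul_le_mul_of_nonneg_left ((le_abs_self _).trans (hM x)) hβ

theorem integrable_mul_exp (hφ : Integrable φ Q) (hg : Measurable g) (hM : ∀ x, |g x| ≤ M)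
    (hβ : 0 ≤ β) : Integrable (fun x => Real.exp (β * g x) * φ x) Q := by
  refine hφ.bdd_mul (c := Real.exp (β * M)) (by fun_prop) (Eventually.of_forall fun x => ?_)
  rw [Real.norm_eq_abs, Real.abs_exp, Real.exp_le_exp]
  exact mul_le_mul_of_nonneg_left ((le_abs_self _).trans (hM x)) hβ

theorem abs_integral_exp_sub_le [IsProbabilityMeasure Q] (hg : Measurable g)
    (hM : ∀ x, |g x| ≤ M) (hβ : 0 ≤ β) (hβM : β * M ≤ 1) (h0 : ∫ x, g x ∂Q = 0) :
    |∫ x, Real.exp (β * g x) ∂Q - 1 - β ^ 2 / 2 * ∫ x, g x ^ 2 ∂Q|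
      ≤ (β * M) ^ 3 * Real.exp 1 := by
  have ig : Integrable g Q := Integrable.of_bound (by fun_prop) M (Eventually.of_forall hM)
  have ig2 : Integrable (fun x => g x ^ 2) Q := by
    refine Integrable.of_bound (by fun_prop) (M ^ 2) (Eventually.of_forall fun x => ?_)
    rw [Real.norm_eq_abs, abs_pow]
    exact pow_le_pow_left₀ (abs_nonneg _) (hM x) 2
  have ie := integrable_exp_mul (Q := Q) hg hM hβ
  have e : ∫ x, Real.exp (β * g x) ∂Q - 1 - β ^ 2 / 2 * ∫ x, g x ^ 2 ∂Q
      = ∫ x, (Real.exp (β * g x) - 1 - β * g x - (β * g x) ^ 2 / 2) ∂Q := by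
    have e2 : ∀ x, (β * g x) ^ 2 / 2 = β ^ 2 / 2 * g x ^ 2 := fun x => by ring
    simp only [e2]
    have i1 : Integrable (fun x => Real.exp (β * g x) - 1) Q := ie.sub (integrable_const 1)
    have i2 : Integrable (fun x => Real.exp (β * g x) - 1 - β * g x) Q := i1.sub (ig.const_mul β)
    rw [integral_sub i2 (ig2.const_mul _), integral_sub i1 (ig.const_mul β),
      integral_sub ie (integrable_const 1), integral_const_mul, integral_const_mul, h0]
    simp
  rw [e]
  have := norm_integral_le_of_norm_le_const (μ := Q) (C := (β * M) ^ 3 * Real.exp 1)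
    (f := fun x => Real.exp (β * g x) - 1 - β * g x - (β * g x) ^ 2 / 2)
    (Eventually.of_forall fun x => by
      refine (abs_exp_sub_quadratic_le _).trans ?_
      have hx : |β * g x| ≤ β * M := by
        rw [abs_mul, abs_of_nonneg hβ]
        exact mul_le_mul_of_nonneg_left (hM x) hβ
      have h0 : 0 ≤ β * M := (abs_nonneg _).trans hx
      gcongr
      exact hx.trans hβM)
  simpa using this

theorem abs_integral_exp_mul_sub_le [IsProbabilityMeasure Q] (hφ : Integrable φ Q) (hg : Measurable g)
    (hM : ∀ x, |g x| ≤ M) (hβ : 0 ≤ β) (hβM : β * M ≤ 1) :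
    |∫ x, Real.exp (β * g x) * φ x ∂Q - ∫ x, φ x ∂Q - β * ∫ x, φ x * g x ∂Q|
      ≤ (β * M) ^ 2 * Real.exp 1 * ∫ x, |φ x| ∂Q := by
  have ie := integrable_mul_exp hφ hg hM hβ
  have ig : Integrable (fun x => φ x * g x) Q :=
    hφ.mul_bdd (c := M) (by fun_prop) (Eventually.of_forall hM)
  have e : ∫ x, Real.exp (β * g x) * φ x ∂Q - ∫ x, φ x ∂Q - β * ∫ x, φ x * g x ∂Q
      = ∫ x, (Real.exp (β * g x) - 1 - β * g x) * φ x ∂Q := by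
    have e2 : ∀ x, (Real.exp (β * g x) - 1 - β * g x) * φ x
      = Real.exp (β * g x) * φ x - φ x - β * (φ x * g x) := fun x => by ring
    simp only [e2]
    have i1 : Integrable (fun x => Real.exp (β * g x) * φ x - φ x) Q := ie.sub hφ
    rw [integral_sub i1 (ig.const_mul β), integral_sub ie hφ, integral_const_mul]
  rw [e, ← integral_const_mul, ← Real.norm_eq_abs]
  refine norm_integral_le_of_norm_le (hφ.abs.const_mul _) (Eventually.of_forall fun x => ?_)
  rw [norm_mul, Real.norm_eq_abs, Real.norm_eq_abs]
  have hx : |β * g x| ≤ β * M := by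
    rw [abs_mul, abs_of_nonneg hβ]
    exact mul_le_mul_of_nonneg_left (hM x) hβ
  have h0 : 0 ≤ β * M := (abs_nonneg _).trans hx
  refine mul_le_mul_of_nonneg_right ((abs_exp_sub_one_sub_le _).trans ?_) (abs_nonneg _)
  rw [← sq_abs (β * g x)]
  gcongr
  exact hx.trans hβM

theorem one_le_integral_exp [IsProbabilityMeasure Q] (hg : Measurable g) (hM : ∀ x, |g x| ≤ M)
    (hβ : 0 ≤ β) (h0 : ∫ x, g x ∂Q = 0) : 1 ≤ ∫ x, Real.exp (β * g x) ∂Q := by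
  have ig : Integrable g Q := Integrable.of_bound (by fun_prop) M (Eventually.of_forall hM)
  calc (1 : ℝ) = ∫ x, (β * g x + 1) ∂Q := by
        rw [integral_add (ig.const_mul β) (integrable_const 1), integral_const_mul, h0]
        simp
    _ ≤ _ := integral_mono ((ig.const_mul β).add (integrable_const 1))
        (integrable_exp_mul hg hM hβ) fun x => Real.add_one_le_exp _

theorem integral_tilted_eq (g φ : S → ℝ) (β : ℝ) : ∫ x, φ x ∂(Q.tilted fun x => β * g x)
    = (∫ x, Real.exp (β * g x) * φ x ∂Q) / ∫ x, Real.exp (β * g x) ∂Q := by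
  rw [integral_tilted, ← integral_div]
  refine integral_congr_ae (Eventually.of_forall fun x => ?_)
  simp only [smul_eq_mul]
  ring

theorem memLp_tilted [IsProbabilityMeasure Q] (hφ : MemLp φ 2 Q) (hg : Measurable g) (hM : ∀ x, |g x| ≤ M) (hβ : 0 ≤ β) :
    MemLp φ 2 (Q.tilted fun x => β * g x) := by
  have hm : AEStronglyMeasurable φ (Q.tilted fun x => β * g x) :=
    hφ.aestronglyMeasurable.mono_ac (tilted_absolutelyContinuous _ _)
  rw [memLp_two_iff_integrable_sq hm, integrable_tilted_iff (integrable_exp_mul hg hM hβ)]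
  simpa using integrable_mul_exp hφ.integrable_sq hg hM hβ

theorem integral_sq_tilted_le [IsProbabilityMeasure Q] (hφ : MemLp φ 2 Q) (hg : Measurable g) (hM : ∀ x, |g x| ≤ M)
    (hβ : 0 ≤ β) (hβM : β * M ≤ 1) (h0 : ∫ x, g x ∂Q = 0) :
    ∫ x, φ x ^ 2 ∂(Q.tilted fun x => β * g x) ≤ Real.exp 1 * ∫ x, φ x ^ 2 ∂Q := by
  rw [integral_tilted_eq]
  refine (div_le_self (integral_nonneg fun x => by positivity)
    (one_le_integral_exp hg hM hβ h0)).trans ?_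
  rw [← integral_const_mul]
  refine integral_mono (integrable_mul_exp hφ.integrable_sq hg hM hβ)
    (hφ.integrable_sq.const_mul _) fun x => ?_
  refine mul_le_mul_of_nonneg_right (Real.exp_le_exp.2 ?_) (sq_nonneg _)
  exact (mul_le_mul_of_nonneg_left ((le_abs_self _).trans (hM x)) hβ).trans hβM

end TiltedMoments

/-! ### A lower bound for moderate deviations of empirical means -/

/-- A family of laws `Q i` tilted by `exp (β i * g i)`, where `g i` is bounded and centred. -/
structure TiltScheme {ι : Type*} (l : Filter ι) (N : ι → ℕ) (β : ι → ℝ) (Q : ι → Measure S)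
    (g : ι → S → ℝ) (M σsq : ℝ) : Prop where
  pos : ∀ᶠ i in l, 0 < β i
  zero : Tendsto β l (𝓝 0)
  speed : Tendsto (fun i => (N i : ℝ) * β i ^ 2) l atTop
  prob : ∀ᶠ i in l, IsProbabilityMeasure (Q i)
  meas : ∀ i, Measurable (g i)
  bound : ∀ᶠ i in l, ∀ x, |g i x| ≤ M
  mean : ∀ᶠ i in l, ∫ x, g i x ∂Q i = 0
  var : Tendsto (fun i => ∫ x, g i x ^ 2 ∂Q i) l (𝓝 σsq)

/-- The asymptotics of the first two moments of the functions `φ i` under the laws of a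
tilting scheme. -/
structure TiltObservable {ι : Type*} (l : Filter ι) (β : ι → ℝ) (Q : ι → Measure S)
    (g : ι → S → ℝ) (φ : ι → S → ℝ) (a : ι → ℝ) (A s c v : ℝ) : Prop where
  meas : ∀ i, Measurable (φ i)
  memLp : ∀ᶠ i in l, MemLp (φ i) 2 (Q i)
  drift : Tendsto (fun i => (∫ x, φ i x ∂Q i - a i) / β i) l (𝓝 s)
  center : Tendsto a l (𝓝 A)
  cov : Tendsto (fun i => ∫ x, φ i x * g i x ∂Q i) l (𝓝 c)
  second : Tendsto (fun i => ∫ x, φ i x ^ 2 ∂Q i) l (𝓝 v)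

namespace TiltScheme

variable {ι : Type*} {l : Filter ι} {N : ι → ℕ} {β : ι → ℝ} {Q : ι → Measure S}
  {g : ι → S → ℝ} {M σsq : ℝ} {φ : ι → S → ℝ} {a : ι → ℝ} {A s c v : ℝ}

theorem eventually_mul_le_one (h : TiltScheme l N β Q g M σsq) : ∀ᶠ i in l, β i * M ≤ 1 := by
  have : Tendsto (fun i => β i * M) l (𝓝 0) := by simpa using h.zero.mul_const M
  exact this.eventually_le_const one_pos

theorem eventually_one_le (h : TiltScheme l N β Q g M σsq) : ∀ᶠ i in l, 1 ≤ N i := by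
  filter_upwards [h.speed.eventually_gt_atTop 0] with i hi
  rcases Nat.eq_zero_or_pos (N i) with h0 | h0
  · simp [h0] at hi
  · exact h0

theorem tendsto_mass (h : TiltScheme l N β Q g M σsq) :
    Tendsto (fun i => (∫ x, Real.exp (β i * g i x) ∂Q i - 1) / β i ^ 2) l (𝓝 (σsq / 2)) := by
  have hlim : Tendsto (fun i => (∫ x, g i x ^ 2 ∂Q i) / 2) l (𝓝 (σsq / 2)) := h.var.div_const 2
  have herr : Tendsto (fun i => β i * M ^ 3 * Real.exp 1) l (𝓝 0) := by
    simpa using (h.zero.mul_const (M ^ 3)).mul_const (Real.exp 1)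
  refine tendsto_of_tendsto_of_dist hlim (squeeze_zero' (Eventually.of_forall fun i =>
    dist_nonneg) ?_ herr)
  filter_upwards [h.pos, h.prob, h.bound, h.mean, h.eventually_mul_le_one] with i hβ hQ hM h0 h1
  have hle := abs_integral_exp_sub_le (h.meas i) hM hβ.le h1 h0
  have e : (∫ x, g i x ^ 2 ∂Q i) / 2 - (∫ x, Real.exp (β i * g i x) ∂Q i - 1) / β i ^ 2
      = -(∫ x, Real.exp (β i * g i x) ∂Q i - 1 - β i ^ 2 / 2 * ∫ x, g i x ^ 2 ∂Q i)
        / β i ^ 2 := by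
    field_simp
    ring
  rw [Real.dist_eq, e, abs_div, abs_neg, abs_of_pos (pow_pos hβ 2), div_le_iff₀ (by positivity)]
  refine hle.trans (le_of_eq ?_)
  ring

theorem tendsto_mass_one (h : TiltScheme l N β Q g M σsq) :
    Tendsto (fun i => ∫ x, Real.exp (β i * g i x) ∂Q i) l (𝓝 1) := by
  have h1 := ((h.zero.pow 2).mul h.tendsto_mass).const_add 1
  simp only [ne_eq, OfNat.ofNat_ne_zero, not_false_eq_true, zero_pow, zero_mul, add_zero] at h1
  refine h1.congr' ?_
  filter_upwards [h.pos] with i hi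
  field_simp
  ring

theorem eventually_le_log_mass (h : TiltScheme l N β Q g M σsq) {δ : ℝ} (hδ : 0 < δ) :
    ∀ᶠ i in l, β i ^ 2 * (σsq / 2 - δ) ≤ Real.log (∫ x, Real.exp (β i * g i x) ∂Q i) := by
  have h1 := h.tendsto_mass.div h.tendsto_mass_one one_ne_zero
  rw [div_one] at h1
  filter_upwards [h1.eventually_const_le (u := σsq / 2 - δ) (by linarith), h.pos,
    h.tendsto_mass_one.eventually_const_lt one_half_lt_one] with i hi hβ hZ
  have hZ0 : 0 < ∫ x, Real.exp (β i * g i x) ∂Q i := by linarith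
  refine le_trans ?_ (Real.one_sub_inv_le_log_of_pos hZ0)
  have hi' : σsq / 2 - δ ≤ (∫ x, Real.exp (β i * g i x) ∂Q i - 1) / β i ^ 2
    / ∫ x, Real.exp (β i * g i x) ∂Q i := hi
  calc β i ^ 2 * (σsq / 2 - δ) ≤ β i ^ 2 * ((∫ x, Real.exp (β i * g i x) ∂Q i - 1) / β i ^ 2
        / ∫ x, Real.exp (β i * g i x) ∂Q i) := by gcongr
    _ = _ := by field_simp

theorem tendsto_tilted_mean (h : TiltScheme l N β Q g M σsq)
    (hφ : TiltObservable l β Q g φ a A s c v) :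
    Tendsto (fun i => (∫ x, φ i x ∂((Q i).tilted fun x => β i * g i x) - a i) / β i) l
      (𝓝 (s + c)) := by
  have hcov : Tendsto (fun i => (∫ x, Real.exp (β i * g i x) * φ i x ∂Q i
      - ∫ x, φ i x ∂Q i) / β i) l (𝓝 c) := by
    have herr : Tendsto (fun i => β i * (M ^ 2 * Real.exp 1 * (1 + ∫ x, φ i x ^ 2 ∂Q i))) l
        (𝓝 0) := by
      simpa using h.zero.mul ((hφ.second.const_add 1).const_mul (M ^ 2 * Real.exp 1))
    refine tendsto_of_tendsto_of_dist hφ.cov (squeeze_zero' (Eventually.of_forall fun i =>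
      dist_nonneg) ?_ herr)
    filter_upwards [h.pos, h.prob, h.bound, hφ.memLp, h.eventually_mul_le_one]
      with i hβ hQ hM hL h1
    have hi : Integrable (φ i) (Q i) := hL.integrable (by norm_num)
    have hle := abs_integral_exp_mul_sub_le hi (h.meas i) hM hβ.le h1
    have habs : ∫ x, |φ i x| ∂Q i ≤ 1 + ∫ x, φ i x ^ 2 ∂Q i := by
      have : ∫ x, (1 + φ i x ^ 2) ∂Q i = 1 + ∫ x, φ i x ^ 2 ∂Q i := by
        rw [integral_add (integrable_const _) hL.integrable_sq]
        simp
      rw [← this]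
      refine integral_mono hi.abs ((integrable_const 1).add hL.integrable_sq) fun x => ?_
      change |φ i x| ≤ 1 + φ i x ^ 2
      nlinarith [sq_nonneg (|φ i x| - 1), sq_abs (φ i x), abs_nonneg (φ i x)]
    have e : ∫ x, φ i x * g i x ∂Q i - (∫ x, Real.exp (β i * g i x) * φ i x ∂Q i
        - ∫ x, φ i x ∂Q i) / β i = -(∫ x, Real.exp (β i * g i x) * φ i x ∂Q i
        - ∫ x, φ i x ∂Q i - β i * ∫ x, φ i x * g i x ∂Q i) / β i := by
      field_simp
      ring
    rw [Real.dist_eq, e, abs_div, abs_neg, abs_of_pos hβ, div_le_iff₀ hβ]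
    calc _ ≤ (β i * M) ^ 2 * Real.exp 1 * ∫ x, |φ i x| ∂Q i := hle
      _ ≤ (β i * M) ^ 2 * Real.exp 1 * (1 + ∫ x, φ i x ^ 2 ∂Q i) := by gcongr
      _ = _ := by ring
  have hlim := ((hcov.add hφ.drift).sub ((hφ.center.mul h.zero).mul h.tendsto_mass)).div
    h.tendsto_mass_one one_ne_zero
  have e : (c + s - A * 0 * (σsq / 2)) / 1 = s + c := by ring
  rw [e] at hlim
  refine hlim.congr' ?_
  filter_upwards [h.pos, h.tendsto_mass_one.eventually_const_lt one_half_lt_one] with i hβ hZ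
  have hZ0 : ∫ x, Real.exp (β i * g i x) ∂Q i ≠ 0 := by linarith
  simp only [Pi.div_apply]
  rw [integral_tilted_eq]
  generalize (∫ x, Real.exp (β i * g i x) ∂Q i) = Z at *
  field_simp
  ring

/-- Under the tilted law, the empirical means obey a law of large numbers at the scale `β`. -/
theorem eventually_pi_tilted_le (h : TiltScheme l N β Q g M σsq)
    (hφ : TiltObservable l β Q g φ a A s c v) {ε δ : ℝ} (hε : 0 < ε) (hδ : 0 < δ) :
    ∀ᶠ i in l, Measure.pi (fun _ : Fin (N i) => (Q i).tilted fun x => β i * g i x)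
      {x | ε * β i < |avg x (φ i) - a i - β i * (s + c)|} ≤ ENNReal.ofReal δ := by
  have hvar : Tendsto (fun i => Real.exp 1 * (∫ x, φ i x ^ 2 ∂Q i) / (ε / 2) ^ 2
      / ((N i : ℝ) * β i ^ 2)) l (𝓝 0) :=
    ((hφ.second.const_mul _).div_const _).div_atTop h.speed
  filter_upwards [h.pos, h.prob, h.bound, h.mean, h.eventually_mul_le_one, hφ.memLp,
    h.eventually_one_le, hvar.eventually_le_const hδ,
    Metric.tendsto_nhds.1 (h.tendsto_tilted_mean hφ) (ε / 2) (half_pos hε)]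
    with i hβ hQ hM h0 h1 hL hN hδi hmean
  have := isProbabilityMeasure_tilted (integrable_exp_mul (Q := Q i) (h.meas i) hM hβ.le)
  have hN0 : (0 : ℝ) < N i := by positivity
  have hcheb := chebyshev_avg hN _ (memLp_tilted hL (h.meas i) hM hβ.le)
    (t := ε / 2 * β i) (by positivity)
  refine (measure_mono fun x hx => ?_).trans (hcheb.trans (ENNReal.ofReal_le_ofReal ?_))
  · have hx' : ε * β i < |avg x (φ i) - a i - β i * (s + c)| := hx
    rw [Real.dist_eq] at hmean
    set m := ∫ x, φ i x ∂((Q i).tilted fun x => β i * g i x)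
    have hm : |m - a i - β i * (s + c)| < ε / 2 * β i := by
      have e : m - a i - β i * (s + c) = ((m - a i) / β i - (s + c)) * β i := by field_simp
      rw [e, abs_mul, abs_of_pos hβ]
      exact mul_lt_mul_of_pos_right hmean hβ
    have htri := abs_sub_abs_le_abs_sub (avg x (φ i) - a i - β i * (s + c))
      (m - a i - β i * (s + c))
    have e : avg x (φ i) - a i - β i * (s + c) - (m - a i - β i * (s + c))
        = avg x (φ i) - m := by ring
    rw [e] at htri
    change ε / 2 * β i ≤ |avg x (φ i) - m|
    linarith
  · refine le_trans ?_ hδi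
    have hle := integral_sq_tilted_le hL (h.meas i) hM hβ.le h1 h0
    calc _ ≤ Real.exp 1 * (∫ x, φ i x ^ 2 ∂Q i) / (N i * (ε / 2 * β i) ^ 2) := by gcongr
      _ = _ := by field_simp

theorem observable_self (h : TiltScheme l N β Q g M σsq) :
    TiltObservable l β Q g g (fun _ => 0) 0 0 σsq σsq where
  meas := h.meas
  memLp := by
    filter_upwards [h.prob, h.bound] with i hQ hM
    exact MemLp.of_bound (h.meas i).aestronglyMeasurable M (Eventually.of_forall hM)
  drift := by
    refine tendsto_const_nhds.congr' ?_
    filter_upwards [h.mean] with i hi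
    simp [hi]
  center := tendsto_const_nhds
  cov := by simpa only [sq] using h.var
  second := h.var

theorem le_pi_avg (h : TiltScheme l N β Q g M σsq) {κ : Type*} (J : Finset κ)
    {φ : κ → ι → S → ℝ} {a : κ → ι → ℝ} {A s c v : κ → ℝ}
    (hφ : ∀ j ∈ J, TiltObservable l β Q g (φ j) (a j) (A j) (s j) (c j) (v j))
    {ε : ℝ} (hε : 0 < ε) :
    ∀ᶠ i in l, ENNReal.ofReal (Real.exp (-(N i * β i ^ 2 * (σsq / 2 + ε))))
      ≤ Measure.pi (fun _ : Fin (N i) => Q i)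
        {x | ∀ j ∈ J, |avg x (φ j i) - a j i - β i * (s j + c j)| ≤ ε * β i} := by
  have hε4 : 0 < ε / 4 := by linarith
  set δ : ℝ := 2⁻¹ * ((J.card : ℝ) + 1)⁻¹ with hδ
  have hδ0 : 0 < δ := by positivity
  have hall : ∀ᶠ i in l, ∀ j ∈ J,
      Measure.pi (fun _ : Fin (N i) => (Q i).tilted fun x => β i * g i x)
      {x | ε / 4 * β i < |avg x (φ j i) - a j i - β i * (s j + c j)|} ≤ ENNReal.ofReal δ :=
    (eventually_all_finset J).2 fun j hj => h.eventually_pi_tilted_le (hφ j hj) hε4 hδ0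
  filter_upwards [hall, h.eventually_pi_tilted_le h.observable_self hε4 hδ0, h.pos, h.prob,
    h.bound, h.eventually_le_log_mass hε4, h.eventually_one_le,
    h.speed.eventually_ge_atTop (Real.log 2 / (ε / 2))] with i hJ hself hβ hQ hM hlog hN hspeed
  have hexp := integrable_exp_mul (Q := Q i) (h.meas i) hM hβ.le
  have := isProbabilityMeasure_tilted hexp
  set μ := Measure.pi (fun _ : Fin (N i) => (Q i).tilted fun x => β i * g i x) with hμ
  set B : Set (Fin (N i) → S) :=
    {x | ε / 4 * β i < |avg x (g i) - 0 - β i * (0 + σsq)|} with hB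
  set U : Set (Fin (N i) → S) :=
    ⋃ j ∈ J, {x | ε / 4 * β i < |avg x (φ j i) - a j i - β i * (s j + c j)|} with hU
  have hmeas : ∀ {f : S → ℝ}, Measurable f → ∀ a c : ℝ,
      MeasurableSet {x : Fin (N i) → S | ε / 4 * β i < |avg x f - a - c|} := fun hf a c =>
    measurableSet_lt measurable_const (((measurable_avg hf).sub_const a).sub_const c).abs
  have hBUm : MeasurableSet (B ∪ U) := (hmeas (h.meas i) _ _).union
    (Finset.measurableSet_biUnion J fun j hj => hmeas ((hφ j hj).meas i) _ _)
  have hBU : μ (B ∪ U) ≤ ENNReal.ofReal 2⁻¹ := by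
    calc μ (B ∪ U) ≤ ENNReal.ofReal δ + ∑ _j ∈ J, ENNReal.ofReal δ :=
          (measure_union_le _ _).trans (add_le_add hself
            ((measure_biUnion_finset_le J _).trans (Finset.sum_le_sum hJ)))
      _ = ENNReal.ofReal 2⁻¹ := by
          rw [Finset.sum_const, nsmul_eq_mul, ← ENNReal.ofReal_natCast,
            ← ENNReal.ofReal_mul (Nat.cast_nonneg _), ← ENNReal.ofReal_add hδ0.le (by positivity),
            hδ]
          congr 1
          field_simp
          ring
  have hhalf : ENNReal.ofReal 2⁻¹ ≤ μ (B ∪ U)ᶜ := by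
    have h1 : μ (B ∪ U)ᶜ = 1 - μ (B ∪ U) := prob_compl_eq_one_sub hBUm
    rw [h1]
    refine le_trans ?_ (tsub_le_tsub_left hBU 1)
    rw [← ENNReal.ofReal_one, ← ENNReal.ofReal_sub _ (by norm_num)]
    norm_num
  set R : ℝ := N i * β i ^ 2 * (σsq / 2 + ε / 2) with hR
  have hle : μ (B ∪ U)ᶜ ≤ ENNReal.ofReal (Real.exp R)
      * Measure.pi (fun _ : Fin (N i) => Q i) (B ∪ U)ᶜ := by
    refine pi_tilted_le (Q i) hexp hBUm.compl fun x hx => ?_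
    have hxB : |avg x (g i) - 0 - β i * (0 + σsq)| ≤ ε / 4 * β i :=
      not_lt.1 fun hlt => hx (Or.inl hlt)
    have h1 : avg x (g i) ≤ β i * (σsq + ε / 4) := by
      have := (abs_le.1 hxB).2
      linarith
    rw [← Finset.mul_sum, ← natCast_mul_avg hN]
    have h2 : β i * (N i * avg x (g i)) ≤ β i * (N i * (β i * (σsq + ε / 4))) := by gcongr
    have h3 : (N i : ℝ) * (β i ^ 2 * (σsq / 2 - ε / 4))
        ≤ N i * Real.log (∫ y, Real.exp (β i * g i y) ∂Q i) := by gcongr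
    rw [hR]
    nlinarith
  have hsplit : Real.exp (-(N i * β i ^ 2 * (σsq / 2 + ε))) ≤ Real.exp (-R) * 2⁻¹ := by
    have h1 : Real.log 2 ≤ N i * β i ^ 2 * (ε / 2) := by
      rwa [div_le_iff₀ (by linarith)] at hspeed
    rw [← Real.exp_log (x := 2⁻¹) (by norm_num), ← Real.exp_add, Real.exp_le_exp, Real.log_inv, hR]
    linarith
  calc ENNReal.ofReal (Real.exp (-(N i * β i ^ 2 * (σsq / 2 + ε))))
      ≤ ENNReal.ofReal (Real.exp (-R)) * ENNReal.ofReal 2⁻¹ := by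
        rw [← ENNReal.ofReal_mul (Real.exp_pos _).le]
        exact ENNReal.ofReal_le_ofReal hsplit
    _ ≤ ENNReal.ofReal (Real.exp (-R)) * (ENNReal.ofReal (Real.exp R)
        * Measure.pi (fun _ : Fin (N i) => Q i) (B ∪ U)ᶜ) := by
        gcongr
        exact hhalf.trans hle
    _ = Measure.pi (fun _ : Fin (N i) => Q i) (B ∪ U)ᶜ := by
        rw [← mul_assoc, ← ENNReal.ofReal_mul (Real.exp_pos _).le, ← Real.exp_add, neg_add_cancel,
          Real.exp_zero, ENNReal.ofReal_one, one_mul]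
    _ ≤ _ := by
        refine measure_mono fun x hx j hj => ?_
        have h1 : |avg x (φ j i) - a j i - β i * (s j + c j)| ≤ ε / 4 * β i :=
          not_lt.1 fun hlt => hx (Or.inr (Set.mem_iUnion₂.2 ⟨j, hj, hlt⟩))
        refine h1.trans ?_
        gcongr
        linarith

end TiltScheme

/-! ### The two sampling stages -/

section Centering

variable {ι : Type*} {l : Filter ι} {N : ι → ℕ} {β : ι → ℝ} {Q : ι → Measure S}
  {g : S → ℝ} {M σsq : ℝ} {φ : ι → S → ℝ} {a : ι → ℝ} {A s c v : ℝ}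

theorem TiltScheme.of_tendsto_zero (hpos : ∀ᶠ i in l, 0 < β i) (hzero : Tendsto β l (𝓝 0))
    (hspeed : Tendsto (fun i => (N i : ℝ) * β i ^ 2) l atTop)
    (hQ : ∀ᶠ i in l, IsProbabilityMeasure (Q i)) (hg : Measurable g) (hM : ∀ x, |g x| ≤ M)
    (hmean : Tendsto (fun i => ∫ x, g x ∂Q i) l (𝓝 0))
    (hvar : Tendsto (fun i => ∫ x, g x ^ 2 ∂Q i) l (𝓝 σsq)) :
    TiltScheme l N β Q (fun i x => g x - ∫ y, g y ∂Q i) (2 * M) σsq where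
  pos := hpos
  zero := hzero
  speed := hspeed
  prob := hQ
  meas _ := hg.sub_const _
  bound := by
    filter_upwards [hQ] with i hi x
    have h1 := norm_integral_le_of_norm_le_const (μ := Q i) (f := g) (Eventually.of_forall hM)
    rw [probReal_univ, mul_one, Real.norm_eq_abs] at h1
    exact (abs_sub _ _).trans (by linarith [hM x])
  mean := by
    filter_upwards [hQ] with i hi
    have ig : Integrable g (Q i) := Integrable.of_bound (by fun_prop) M (Eventually.of_forall hM)
    rw [integral_sub ig (integrable_const _)]
    simp
  var := by
    have h := hvar.sub (hmean.pow 2)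
    rw [zero_pow two_ne_zero, sub_zero] at h
    refine h.congr' ?_
    filter_upwards [hQ] with i hi
    have mg : MemLp g 2 (Q i) :=
      MemLp.of_bound hg.aestronglyMeasurable M (Eventually.of_forall hM)
    rw [← variance_eq_integral hg.aemeasurable, variance_eq_sub mg]
    simp

theorem TiltObservable.of_tendsto (hpos : ∀ᶠ i in l, 0 < β i) (hzero : Tendsto β l (𝓝 0))
    (hg : Measurable g) (hM : ∀ x, |g x| ≤ M)
    (hQ : ∀ᶠ i in l, IsProbabilityMeasure (Q i))
    (hmean : Tendsto (fun i => ∫ x, g x ∂Q i) l (𝓝 0))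
    (hφ : ∀ i, Measurable (φ i)) (hL : ∀ᶠ i in l, MemLp (φ i) 2 (Q i))
    (hdrift : Tendsto (fun i => (∫ x, φ i x ∂Q i - a i) / β i) l (𝓝 s))
    (hcenter : Tendsto a l (𝓝 A))
    (hcov : Tendsto (fun i => ∫ x, φ i x * g x ∂Q i) l (𝓝 c))
    (hsecond : Tendsto (fun i => ∫ x, φ i x ^ 2 ∂Q i) l (𝓝 v)) :
    TiltObservable l β Q (fun i x => g x - ∫ y, g y ∂Q i) φ a A s c v where
  meas := hφ
  memLp := hL
  drift := hdrift
  center := hcenter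
  cov := by
    have h1 : Tendsto (fun i => ∫ x, φ i x ∂Q i) l (𝓝 A) := by
      have h := hcenter.add (hzero.mul hdrift)
      rw [zero_mul, add_zero] at h
      refine h.congr' ?_
      filter_upwards [hpos] with i hi
      field_simp
      ring
    have h2 := hcov.sub (h1.mul hmean)
    rw [mul_zero, sub_zero] at h2
    refine h2.congr' ?_
    filter_upwards [hQ, hL] with i hi hLi
    have iφ : Integrable (φ i) (Q i) := hLi.integrable (by norm_num)
    have ig : Integrable (fun x => φ i x * g x) (Q i) :=
      iφ.mul_bdd (c := M) (by fun_prop) (Eventually.of_forall hM)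
    simp only [mul_sub]
    rw [integral_sub ig (iφ.mul_const _), integral_mul_const]
  second := hsecond

end Centering

namespace RegularArray

variable {P : Measure S} {b : ℕ → ℝ} {Q : ℕ → Measure S} {F : S → ℝ}

theorem abs_mul_le_sq (h : RegularArray P b Q F) {f g : S → ℝ} {M : ℝ} (hf : ∀ x, |f x| ≤ F x)
    (hM : ∀ x, |g x| ≤ M) (x : S) : |f x * g x| ≤ M * F x ^ 2 := by
  have hM0 : 0 ≤ M := (abs_nonneg _).trans (hM x)
  rw [abs_mul, mul_comm]
  exact mul_le_mul (hM x) ((hf x).trans (h.le_sq x)) (abs_nonneg _) hM0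

theorem sq_le_sq (h : RegularArray P b Q F) {f : S → ℝ} (hf : ∀ x, |f x| ≤ F x) (x : S) :
    |f x ^ 2| ≤ 1 * F x ^ 2 := by
  have := h.one_le x
  rw [one_mul, abs_pow]
  exact pow_le_pow_left₀ (abs_nonneg _) (hf x) 2

variable [IsProbabilityMeasure P] [∀ n, IsProbabilityMeasure (Q n)]

theorem tendsto_setIntegral_const (h : RegularArray P b Q F) {ψ : S → ℝ} {C : ℝ}
    (hψm : Measurable ψ) (hψ : ∀ x, |ψ x| ≤ C * F x ^ 2) :
    Tendsto (fun n => ∫ x in {x | F x ≤ (b n)⁻¹}, ψ x ∂Q n) atTop (𝓝 (∫ x, ψ x ∂P)) :=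
  h.tendsto_setIntegral (ψ := fun _ => ψ) (fun _ => hψm) hψm
    (Eventually.of_forall fun _ x _ => hψ x) hψ
    fun T ε hε => Eventually.of_forall fun n x _ => by simpa using hε.le

/-- The lower bound for the first sample. -/
theorem le_pi_sample (h : RegularArray P b Q F) (J : Finset (S → ℝ)) (hJm : ∀ f ∈ J, Measurable f)
    (hJF : ∀ f ∈ J, ∀ x, |f x| ≤ F x) {D : (S → ℝ) → ℝ}
    (hD : ∀ f ∈ J, Tendsto (fun n => (∫ x in {x | F x ≤ (b n)⁻¹}, f x ∂Q n
      - ∫ x, f x ∂P) / b n) atTop (𝓝 (D f)))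
    {g : S → ℝ} {M : ℝ} (hg : Measurable g) (hM : ∀ x, |g x| ≤ M) (h0 : ∫ x, g x ∂P = 0)
    {ε : ℝ} (hε : 0 < ε) :
    ∀ᶠ n : ℕ in atTop,
      ENNReal.ofReal (Real.exp (-(n * b n ^ 2 * ((∫ x, g x ^ 2 ∂P) / 2 + ε))))
        ≤ Measure.pi (fun _ : Fin n => Q n)
          {x | ∀ f ∈ J, |avg x ({x | F x ≤ (b n)⁻¹}.indicator f) - ∫ x, f x ∂P
            - b n * (D f + ∫ x, f x * g x ∂P)| ≤ ε * b n} := by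
  have hmean : Tendsto (fun n => ∫ x, g x ∂Q n) atTop (𝓝 0) := h0 ▸ h.bdd g hg ⟨M, hM⟩
  have hvar := h.bdd (fun x => g x ^ 2) (hg.pow_const 2) ⟨M ^ 2, fun x => by
    rw [abs_pow]
    exact pow_le_pow_left₀ (abs_nonneg _) (hM x) 2⟩
  have hQ : ∀ᶠ n in atTop, IsProbabilityMeasure (Q n) := Eventually.of_forall inferInstance
  have hscheme := TiltScheme.of_tendsto_zero (N := fun n : ℕ => n) h.normalizing.eventually_pos
    h.normalizing.zero h.normalizing.speed hQ hg hM hmean hvar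
  refine hscheme.le_pi_avg J (φ := fun f n => {x | F x ≤ (b n)⁻¹}.indicator f)
    (a := fun f _ => ∫ x, f x ∂P) (A := fun f => ∫ x, f x ∂P) (s := D)
    (c := fun f => ∫ x, f x * g x ∂P) (v := fun f => ∫ x, f x ^ 2 ∂P) (fun f hf => ?_) hε
  have hT := h.measurableSet_trunc
  refine TiltObservable.of_tendsto h.normalizing.eventually_pos h.normalizing.zero hg hM hQ hmean
    (fun n => (hJm f hf).indicator (hT n)) ?_ ?_ tendsto_const_nhds ?_ ?_
  · filter_upwards [h.normalizing.eventually_pos] with n hn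
    refine MemLp.of_bound ((hJm f hf).indicator (hT n)).aestronglyMeasurable (b n)⁻¹
      (Eventually.of_forall fun x => ?_)
    by_cases hx : x ∈ {x | F x ≤ (b n)⁻¹}
    · rw [Set.indicator_of_mem hx]
      exact (hJF f hf x).trans hx
    · rw [Set.indicator_of_notMem hx, norm_zero]
      positivity
  · simpa only [integral_indicator (hT _)] using hD f hf
  · have := h.tendsto_setIntegral_const ((hJm f hf).mul hg) (h.abs_mul_le_sq (hJF f hf) hM)
    refine this.congr fun n => ?_
    rw [← integral_indicator (hT n)]
    refine integral_congr_ae (Eventually.of_forall fun x => ?_)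
    exact Set.indicator_mul_left (s := {x | F x ≤ (b n)⁻¹}) (f := f) (g := g)
  · have := h.tendsto_setIntegral_const ((hJm f hf).pow_const 2) (h.sq_le_sq (hJF f hf))
    refine this.congr fun n => ?_
    rw [← integral_indicator (hT n)]
    refine integral_congr_ae (Eventually.of_forall fun x => ?_)
    by_cases hx : x ∈ {x | F x ≤ (b n)⁻¹}
    · simp only [Set.indicator_of_mem hx]
    · simp only [Set.indicator_of_notMem hx]
      norm_num

/-- The lower bound for the bootstrap sample, valid for superexponentially likely samples. -/
theorem le_pi_bootstrap (h : RegularArray P b Q F) {k : ℕ → ℕ} {ν : ℝ} (hν : 0 < ν)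
    (hk : Tendsto (fun n : ℕ => (k n : ℝ) / (n : ℝ)) atTop (𝓝 ν))
    (J : Finset (S → ℝ)) (hJm : ∀ f ∈ J, Measurable f) (hJF : ∀ f ∈ J, ∀ x, |f x| ≤ F x)
    {g : S → ℝ} {M : ℝ} (hg : Measurable g) (hM : ∀ x, |g x| ≤ M) (h0 : ∫ x, g x ∂P = 0)
    {ε : ℝ} (hε : 0 < ε) :
    ∀ᶠ w in superexp Q h.normalizing,
      ENNReal.ofReal (Real.exp (-(k w.1 * b w.1 ^ 2 * ((∫ x, g x ^ 2 ∂P) / 2 + ε))))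
        ≤ Measure.pi (fun _ : Fin (k w.1) => empirical w.2)
          {y | ∀ f ∈ J, |avg y f - avg w.2 f - b w.1 * (0 + ∫ x, f x * g x ∂P)|
            ≤ ε * b w.1} := by
  have hfst := tendsto_fst_superexp Q h.normalizing
  have hM' : ∀ x, |g x| ≤ |M| * F x ^ 2 := fun x => by
    have h1 := (hM x).trans (le_abs_self M)
    nlinarith [h.one_le_sq x, abs_nonneg M]
  have hmean : Tendsto (fun w : Σ n, Fin n → S => ∫ x, g x ∂empirical w.2)
      (superexp Q h.normalizing) (𝓝 0) := by
    simp only [integral_empirical _ hg]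
    exact h0 ▸ h.tendsto_avg_const hg hM'
  have hvar : Tendsto (fun w : Σ n, Fin n → S => ∫ x, g x ^ 2 ∂empirical w.2)
      (superexp Q h.normalizing) (𝓝 (∫ x, g x ^ 2 ∂P)) := by
    simp only [integral_empirical _ (hg.pow_const 2)]
    refine h.tendsto_avg_const (hg.pow_const 2) (C := M ^ 2) fun x => ?_
    rw [abs_pow]
    have h1 := pow_le_pow_left₀ (abs_nonneg _) (hM x) 2
    nlinarith [h.one_le_sq x, sq_nonneg M]
  have hQ : ∀ᶠ w in superexp Q h.normalizing, IsProbabilityMeasure (empirical w.2) := by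
    filter_upwards [hfst.eventually (eventually_ge_atTop 1)] with w hw
    have : NeZero w.1 := ⟨by omega⟩
    infer_instance
  have hspeed : Tendsto (fun n : ℕ => (k n : ℝ) * b n ^ 2) atTop atTop := by
    refine (hk.pos_mul_atTop hν h.normalizing.speed).congr' ?_
    filter_upwards [eventually_ge_atTop 1] with n hn
    have : (n : ℝ) ≠ 0 := by positivity
    field_simp
  have hpos := hfst.eventually h.normalizing.eventually_pos
  have hzero := h.normalizing.zero.comp hfst
  have hscheme := TiltScheme.of_tendsto_zero (N := fun w : Σ n, Fin n → S => k w.1)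
    (β := fun w => b w.1) hpos hzero (hspeed.comp hfst) hQ hg hM hmean hvar
  refine hscheme.le_pi_avg J (φ := fun f _ => f) (a := fun f w => avg w.2 f)
    (A := fun f => ∫ x, f x ∂P) (s := fun _ => 0)
    (c := fun f => ∫ x, f x * g x ∂P) (v := fun f => ∫ x, f x ^ 2 ∂P) (fun f hf => ?_) hε
  refine TiltObservable.of_tendsto hpos hzero hg hM hQ hmean (fun _ => hJm f hf)
    (Eventually.of_forall fun w => ?_) ?_ ?_ ?_ ?_
  · rw [memLp_two_iff_integrable_sq (hJm f hf).aestronglyMeasurable]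
    exact integrable_empirical w.2 ((hJm f hf).pow_const 2)
  · simpa [integral_empirical _ (hJm f hf)] using tendsto_const_nhds
  · exact h.tendsto_avg_const (hJm f hf) (C := 1) fun x => by
      rw [one_mul]
      exact (hJF f hf x).trans (h.le_sq x)
  · have hfg : Measurable fun x => f x * g x := (hJm f hf).mul hg
    simp only [integral_empirical _ hfg]
    exact h.tendsto_avg_const hfg (h.abs_mul_le_sq (hJF f hf) hM)
  · simp only [integral_empirical _ ((hJm f hf).pow_const 2)]
    exact h.tendsto_avg_const ((hJm f hf).pow_const 2) (h.sq_le_sq (hJF f hf))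

end RegularArray

/-! ### The lower bound -/

section LowerBound

variable {P : ProbabilityMeasure S} {b : ℕ → ℝ} {Pn : ℕ → ProbabilityMeasure S}
  {Hn : ℕ → Lambda0 (Phi P b)} {H : Lambda0 (Phi P b)} {k : ℕ → ℕ} {ν : ℝ}

theorem exists_pos_rate_lt {ν x y I ε : ℝ} (hI : ν * x + y < I) (hε : 0 < ε) :
    ∃ η, 0 < η ∧ η ≤ ε ∧ (ν + η) * (x + η) + (y + 2 * η) < I := by
  have hc : Tendsto (fun η : ℝ => (ν + η) * (x + η) + (y + 2 * η)) (𝓝[>] 0)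
      (𝓝 ((ν + 0) * (x + 0) + (y + 2 * 0))) :=
    (Continuous.tendsto (by fun_prop) 0).mono_left nhdsWithin_le_nhds
  simp only [add_zero, mul_zero] at hc
  obtain ⟨η, ⟨h1, h2⟩, h3⟩ := (((hc.eventually_lt_const hI).and
    (Ioc_mem_nhdsGT hε)).and self_mem_nhdsWithin).exists
  exact ⟨η, h3, h2.2, h1⟩

/-- A lower bound for mixtures: if the first sample satisfies `A` with probability at least
`exp (- r₁ n b²)` and, outside a superexponentially small set, each such sample gives conditional
probability at least `p` to the section of `W`, then `W` is not too unlikely. -/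
theorem le_sampleLaw (hb : Normalizing b) {W : ∀ n, Set ((Fin n → S) × (Fin (k n) → S))}
    (hW : ∀ n, MeasurableSet (W n)) {A : ∀ n, Set (Fin n → S)} {p : ℕ → ℝ≥0∞} {r₁ η : ℝ}
    (hη : 0 < η)
    (hA : ∀ᶠ n : ℕ in atTop, ENNReal.ofReal (Real.exp (-(n * b n ^ 2 * r₁)))
      ≤ Measure.pi (fun _ : Fin n => (Pn n : Measure S)) (A n))
    (hgood : ∀ᶠ w in superexp (fun n => (Pn n : Measure S)) hb,
      w.2 ∈ A w.1 → p w.1 ≤ Measure.pi (fun _ : Fin (k w.1) => empirical w.2)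
        (Prod.mk w.2 ⁻¹' W w.1)) :
    ∀ᶠ n : ℕ in atTop, p n * ENNReal.ofReal (Real.exp (-(n * b n ^ 2 * (r₁ + η))))
      ≤ sampleLaw (Pn n) n (k n) (W n) := by
  rw [eventually_superexp_iff] at hgood
  filter_upwards [hA, hgood (r₁ + η), hb.speed.eventually_ge_atTop (Real.log 2 / η)]
    with n hAn hbad hspeed
  set T : ℝ := n * b n ^ 2
  have hT : Real.log 2 ≤ T * η := by rwa [div_le_iff₀ hη] at hspeed
  set μ := Measure.pi (fun _ : Fin n => (Pn n : Measure S))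
  have hκ : Measurable fun x : Fin n → S =>
      bootstrapKernel S n (k n) x (Prod.mk x ⁻¹' W n) :=
    Kernel.measurable_kernel_prodMk_left (hW n)
  have hle : ENNReal.ofReal (Real.exp (-(T * (r₁ + η))))
      ≤ μ {x | p n ≤ bootstrapKernel S n (k n) x (Prod.mk x ⁻¹' W n)} := by
    have h1 : ENNReal.ofReal (Real.exp (-(T * r₁)))
        ≤ μ {x | p n ≤ bootstrapKernel S n (k n) x (Prod.mk x ⁻¹' W n)}
          + ENNReal.ofReal (Real.exp (-(T * (r₁ + η)))) := by
      refine hAn.trans ((measure_mono fun x hx => ?_).trans ((measure_union_le _ _).trans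
        (add_le_add le_rfl (hbad.trans (le_of_eq ?_)))))
      · by_cases hp : p n ≤ bootstrapKernel S n (k n) x (Prod.mk x ⁻¹' W n)
        · exact Or.inl hp
        · exact Or.inr fun himp => hp (himp hx)
      · rw [mul_neg]
    have h2 : ENNReal.ofReal (Real.exp (-(T * (r₁ + η))))
        + ENNReal.ofReal (Real.exp (-(T * (r₁ + η)))) ≤ ENNReal.ofReal (Real.exp (-(T * r₁))) := by
      rw [← ENNReal.ofReal_add (Real.exp_pos _).le (Real.exp_pos _).le]
      refine ENNReal.ofReal_le_ofReal ?_
      rw [← two_mul, ← Real.exp_log (two_pos : (0 : ℝ) < 2), ← Real.exp_add, Real.exp_le_exp]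
      linarith
    exact (ENNReal.add_le_add_iff_right ENNReal.ofReal_ne_top).1 (h2.trans h1)
  rw [sampleLaw, Measure.compProd_apply (hW n)]
  refine le_trans ?_ (mul_meas_ge_le_lintegral hκ (p n))
  gcongr

/-- The pairs of samples whose rescaled deviations are close to prescribed values. -/
def nearSet (J : Finset (S → ℝ)) (P : Measure S) (β ε : ℝ) (d₂ d₁ : (S → ℝ) → ℝ) (n k : ℕ) :
    Set ((Fin n → S) × (Fin k → S)) :=
  {w | ∀ f ∈ J, |avg w.2 f - avg w.1 f - β * d₂ f| ≤ ε * β ∧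
    |avg w.1 f - ∫ x, f x ∂P - β * d₁ f| ≤ ε * β}

theorem measurableSet_nearSet {J : Finset (S → ℝ)} (hJ : ∀ f ∈ J, Measurable f) (P : Measure S)
    (β ε : ℝ) (d₂ d₁ : (S → ℝ) → ℝ) (n k : ℕ) : MeasurableSet (nearSet J P β ε d₂ d₁ n k) := by
  have : nearSet J P β ε d₂ d₁ n k = ⋂ f ∈ J, {w | |avg w.2 f - avg w.1 f - β * d₂ f| ≤ ε * β ∧
    |avg w.1 f - ∫ x, f x ∂P - β * d₁ f| ≤ ε * β} := by
    ext w
    simp [nearSet]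
  rw [this]
  refine Finset.measurableSet_biInter J fun f hf => ?_
  have h1 : Measurable fun w : (Fin n → S) × (Fin k → S) => avg w.1 f :=
    (measurable_avg (hJ f hf)).comp measurable_fst
  have h2 : Measurable fun w : (Fin n → S) × (Fin k → S) => avg w.2 f :=
    (measurable_avg (hJ f hf)).comp measurable_snd
  exact (measurableSet_le ((h2.sub h1).sub_const _).abs measurable_const).inter
    (measurableSet_le ((h1.sub_const _).sub_const _).abs measurable_const)

theorem le_sampleLaw_nearSet (hb : Normalizing b) (hA : AssumptionA P b Pn Hn H)
    (hB1 : AssumptionB1 P b Hn) (hν : 0 < ν)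
    (hk : Tendsto (fun n : ℕ => (k n : ℝ) / (n : ℝ)) atTop (𝓝 ν))
    {J : Finset (S → ℝ)} (hJ : ∀ f ∈ J, f ∈ Phi P b) {g₂ g₁ : S → ℝ} {M : ℝ}
    (hg₂ : Measurable g₂) (hM₂ : ∀ x, |g₂ x| ≤ M) (h₂ : ∫ x, g₂ x ∂(P : Measure S) = 0)
    (hg₁ : Measurable g₁) (hM₁ : ∀ x, |g₁ x| ≤ M) (h₁ : ∫ x, g₁ x ∂(P : Measure S) = 0)
    {I ε : ℝ} (hε : 0 < ε) (hI : ν * ((∫ x, g₂ x ^ 2 ∂(P : Measure S)) / 2)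
      + (∫ x, g₁ x ^ 2 ∂(P : Measure S)) / 2 < I) :
    ∀ᶠ n : ℕ in atTop, ENNReal.ofReal (Real.exp (n * b n ^ 2 * (-I)))
      ≤ sampleLaw (Pn n) n (k n) (nearSet J P (b n) ε
        (fun f => ∫ x, f x * g₂ x ∂(P : Measure S))
        (fun f => sint (H : SignedMeasure S) f + ∫ x, f x * g₁ x ∂(P : Measure S)) n (k n)) := by
  obtain ⟨F, hF, hF1, hJF⟩ := Phi.exists_dominating hb J hJ
  have h := hA.regularArray hb hB1 hF hF1
  have hJm : ∀ f ∈ J, Measurable f := fun f hf => ((mem_Phi_iff hb).1 (hJ f hf)).1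
  obtain ⟨η, hη, hηε, hηI⟩ := exists_pos_rate_lt hI hε
  have stage₁ := h.le_pi_sample J hJm hJF (D := fun f => sint (H : SignedMeasure S) f)
    (fun f hf => hA.tendsto_drift hb hF (fun x => zero_le_one.trans (hF1 x)) (hJm f hf) one_pos
      (by simpa using hJF f hf)) hg₁ hM₁ h₁ hη
  have stage₂ := h.le_pi_bootstrap hν hk J hJm hJF hg₂ hM₂ h₂ hη
  have hpos := (tendsto_fst_superexp (fun n => (Pn n : Measure S)) h.normalizing).eventually
    hb.eventually_pos
  have key := le_sampleLaw (k := k) hb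
    (fun n => measurableSet_nearSet hJm P (b n) ε (fun f => ∫ x, f x * g₂ x ∂(P : Measure S))
        (fun f => sint (H : SignedMeasure S) f + ∫ x, f x * g₁ x ∂(P : Measure S)) n (k n))
    (p := fun n => ENNReal.ofReal (Real.exp
      (-(k n * b n ^ 2 * ((∫ x, g₂ x ^ 2 ∂(P : Measure S)) / 2 + η))))) hη stage₁ (by
      filter_upwards [stage₂, h.eventually_trunc, hpos] with w hw htr hβ hwA
      refine hw.trans (measure_mono fun y hy f hf => ⟨?_, ?_⟩)
      · have := hy f hf
        rw [zero_add] at this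
        exact this.trans (by gcongr)
      · have := hwA f hf
        rw [avg_congr (g := f) fun i => Set.indicator_of_mem (s := {x | F x ≤ (b w.1)⁻¹}) (htr i) f]
          at this
        exact this.trans (by gcongr))
  filter_upwards [key, hk.eventually_le_const (lt_add_of_pos_right ν hη), eventually_ge_atTop 1]
    with n hn hkn hn1
  refine le_trans ?_ hn
  rw [← ENNReal.ofReal_mul (Real.exp_pos _).le, ← Real.exp_add]
  refine ENNReal.ofReal_le_ofReal (Real.exp_le_exp.2 ?_)
  have hn0 : (0 : ℝ) < n := by positivity
  have hk' : (k n : ℝ) ≤ (ν + η) * n := by rwa [div_le_iff₀ hn0] at hkn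
  have i2 : 0 ≤ ∫ x, g₂ x ^ 2 ∂(P : Measure S) := integral_nonneg fun _ => sq_nonneg _
  have e1 : k n * b n ^ 2 * ((∫ x, g₂ x ^ 2 ∂(P : Measure S)) / 2 + η)
      ≤ (ν + η) * n * b n ^ 2 * ((∫ x, g₂ x ^ 2 ∂(P : Measure S)) / 2 + η) := by gcongr
  have e2 : n * b n ^ 2 * ((ν + η) * ((∫ x, g₂ x ^ 2 ∂(P : Measure S)) / 2 + η)
      + ((∫ x, g₁ x ^ 2 ∂(P : Measure S)) / 2 + 2 * η)) ≤ n * b n ^ 2 * I := by gcongr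
  nlinarith

theorem exists_bounded_approx {μ : Measure S} [IsProbabilityMeasure μ] {g : S → ℝ}
    (hg : Measurable g) (hgL : MemLp g 2 μ) (h0 : ∫ x, g x ∂μ = 0) (J : Finset (S → ℝ))
    (hJ : ∀ f ∈ J, MemLp f 2 μ) {δ : ℝ} (hδ : 0 < δ) :
    ∃ g' : S → ℝ, Measurable g' ∧ (∃ M, ∀ x, |g' x| ≤ M) ∧ ∫ x, g' x ∂μ = 0 ∧
      ∫ x, g' x ^ 2 ∂μ ≤ ∫ x, g x ^ 2 ∂μ ∧
      ∀ f ∈ J, |∫ x, f x * g' x ∂μ - ∫ x, f x * g x ∂μ| < δ := by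
  set t : ℕ → S → ℝ := fun n x => max (-n) (min (g x) n) with ht
  have htm : ∀ n, Measurable (t n) := fun n => measurable_const.max (hg.min measurable_const)
  have htn : ∀ n x, |t n x| ≤ n := fun n x => by
    rw [abs_le]
    refine ⟨le_max_left _ _, max_le ?_ (min_le_right _ _)⟩
    linarith [(Nat.cast_nonneg n : (0 : ℝ) ≤ n)]
  have htg : ∀ n x, |t n x| ≤ |g x| := fun n x => by
    have hn : (0 : ℝ) ≤ n := Nat.cast_nonneg n
    rw [abs_le]
    refine ⟨le_max_of_le_right (le_min (neg_abs_le _) ?_), max_le ?_ ?_⟩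
    · linarith [abs_nonneg (g x)]
    · linarith [abs_nonneg (g x)]
    · exact (min_le_left _ _).trans (le_abs_self _)
  have hlim : ∀ x, Tendsto (fun n => t n x) atTop (𝓝 (g x)) := fun x => by
    refine tendsto_const_nhds.congr' ?_
    filter_upwards [tendsto_natCast_atTop_atTop.eventually_ge_atTop |g x|] with n hn
    have := abs_le.1 hn
    simp only [ht]
    rw [min_eq_left this.2, max_eq_right this.1]
  have hgi : Integrable g μ := hgL.integrable (by norm_num)
  have hpair : ∀ f : S → ℝ, MemLp f 2 μ → Tendsto (fun n => ∫ x, f x * t n x ∂μ) atTop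
      (𝓝 (∫ x, f x * g x ∂μ)) := fun f hf => by
    refine tendsto_integral_of_dominated_convergence (fun x => |f x * g x|)
      (fun n => hf.aestronglyMeasurable.mul (htm n).aestronglyMeasurable)
      (hf.integrable_mul hgL).abs (fun n => Eventually.of_forall fun x => ?_)
      (Eventually.of_forall fun x => (hlim x).const_mul _)
    rw [Real.norm_eq_abs, abs_mul, abs_mul]
    exact mul_le_mul_of_nonneg_left (htg n x) (abs_nonneg _)
  have hmean : Tendsto (fun n => ∫ x, t n x ∂μ) atTop (𝓝 0) := by
    have := hpair (fun _ => 1) (memLp_const 1)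
    simpa only [one_mul, h0] using this
  have hti : ∀ n, Integrable (t n) μ := fun n =>
    Integrable.of_bound (htm n).aestronglyMeasurable n (Eventually.of_forall (htn n))
  have hconv : ∀ f ∈ J, Tendsto (fun n => ∫ x, f x * (t n x - ∫ y, t n y ∂μ) ∂μ) atTop
      (𝓝 (∫ x, f x * g x ∂μ)) := fun f hf => by
    have hfi : Integrable f μ := (hJ f hf).integrable (by norm_num)
    have h1 := (hpair f (hJ f hf)).sub (hmean.const_mul (∫ x, f x ∂μ))
    rw [mul_zero, sub_zero] at h1
    refine h1.congr fun n => ?_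
    have hft : Integrable (fun x => f x * t n x) μ :=
      hfi.mul_bdd (c := n) (htm n).aestronglyMeasurable (Eventually.of_forall (htn n))
    simp only [mul_sub]
    rw [integral_sub hft (hfi.mul_const _), integral_mul_const]
  have hev : ∀ᶠ n in atTop, ∀ f ∈ J,
      |∫ x, f x * (t n x - ∫ y, t n y ∂μ) ∂μ - ∫ x, f x * g x ∂μ| < δ :=
    (eventually_all_finset J).2 fun f hf => Metric.tendsto_nhds.1 (hconv f hf) δ hδ
  obtain ⟨n, hn⟩ := hev.exists
  refine ⟨fun x => t n x - ∫ y, t n y ∂μ, (htm n).sub_const _,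
    ⟨n + |∫ y, t n y ∂μ|, fun x => (abs_sub _ _).trans (by linarith [htn n x])⟩, ?_, ?_, hn⟩
  · rw [integral_sub (hti n) (integrable_const _)]
    simp
  · rw [← variance_eq_integral (htm n).aemeasurable]
    refine (variance_le_expectation_sq (htm n).aestronglyMeasurable).trans ?_
    refine integral_mono_of_nonneg (Eventually.of_forall fun x => sq_nonneg _) hgL.integrable_sq
      (Eventually.of_forall fun x => ?_)
    exact sq_le_sq.2 (htg n x)

end LowerBound

theorem exists_density_of_rho0sq_ne_top {P : ProbabilityMeasure S} {G : SignedMeasure S}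
    (h : rho0sq G P ≠ ⊤) : ∃ g : S → ℝ, Measurable g ∧ MemLp g 2 (P : Measure S) ∧
      G = (P : Measure S).withDensityᵥ g := by
  have hac : G ≪ᵥ (P : Measure S).toENNRealVectorMeasure := by
    by_contra hac
    exact h (if_neg hac)
  rw [rho0sq, if_pos hac] at h
  have hm := SignedMeasure.measurable_rnDeriv G (P : Measure S)
  refine ⟨G.rnDeriv (P : Measure S), hm, ?_, (SignedMeasure.withDensityᵥ_rnDeriv_eq _ _ hac).symm⟩
  rw [memLp_two_iff_integrable_sq hm.aestronglyMeasurable]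
  refine ⟨(hm.pow_const 2).aestronglyMeasurable, ?_⟩
  rw [hasFiniteIntegral_iff_ofReal (Eventually.of_forall fun x => sq_nonneg _)]
  refine lt_top_iff_ne_top.2 fun htop => h ?_
  rw [htop]
  exact ENNReal.mul_top (by simp)

section LowerBound

variable {P : ProbabilityMeasure S} {b : ℕ → ℝ} {Pn : ℕ → ProbabilityMeasure S}
  {Hn : ℕ → Lambda0 (Phi P b)} {H : Lambda0 (Phi P b)} {k : ℕ → ℕ} {ν : ℝ}

theorem exists_finset_of_mem_nhds {Φ : Set (S → ℝ)} {G₀ : Lambda0 Φ} {U : Set (Lambda0 Φ)}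
    (hU : U ∈ 𝓝 G₀) : ∃ J : Finset (S → ℝ), (∀ f ∈ J, f ∈ Φ) ∧ ∃ ε > 0, ∀ G : Lambda0 Φ,
      (∀ f ∈ J, |sint (G : SignedMeasure S) f - sint (G₀ : SignedMeasure S) f| < ε) → G ∈ U := by
  classical
  rw [nhds_induced, nhds_pi] at hU
  obtain ⟨⟨I, r⟩, ⟨hI, hr⟩, hIU⟩ :=
    ((hasBasis_pi fun f : Φ => Metric.nhds_basis_ball (x := pairing Φ G₀ f)).comap
      (pairing Φ)).mem_iff.1 hU
  obtain ⟨ε, hε, hεr⟩ : ∃ ε > 0, ∀ f ∈ I, ε ≤ r f := by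
    rcases hI.toFinset.eq_empty_or_nonempty with h | h
    · exact ⟨1, one_pos, fun f hf => absurd (hI.mem_toFinset.2 hf) (by simp [h])⟩
    · obtain ⟨f₀, hf₀, hmin⟩ := hI.toFinset.exists_min_image r h
      exact ⟨r f₀, hr f₀ (hI.mem_toFinset.1 hf₀), fun f hf => hmin f (hI.mem_toFinset.2 hf)⟩
  refine ⟨hI.toFinset.image Subtype.val, fun f hf => ?_, ε, hε, fun G hG => hIU fun f hf => ?_⟩
  · obtain ⟨f', _, rfl⟩ := Finset.mem_image.1 hf
    exact f'.2
  · exact (hG f (Finset.mem_image_of_mem _ (hI.mem_toFinset.2 hf))).trans_le (hεr f hf)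

theorem exists_finset_of_mem_nhds_prod {Φ : Set (S → ℝ)} {G₀ : Lambda0 Φ × Lambda0 Φ}
    {U : Set (Lambda0 Φ × Lambda0 Φ)} (hU : U ∈ 𝓝 G₀) :
    ∃ J : Finset (S → ℝ), (∀ f ∈ J, f ∈ Φ) ∧ ∃ ε > 0, ∀ G : Lambda0 Φ × Lambda0 Φ,
      (∀ f ∈ J, |sint (G.1 : SignedMeasure S) f - sint (G₀.1 : SignedMeasure S) f| < ε ∧
        |sint (G.2 : SignedMeasure S) f - sint (G₀.2 : SignedMeasure S) f| < ε) → G ∈ U := by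
  classical
  obtain ⟨U₂, hU₂, U₁, hU₁, hsub⟩ := mem_nhds_prod_iff.1 hU
  obtain ⟨J₂, hJ₂, ε₂, hε₂, h₂⟩ := exists_finset_of_mem_nhds hU₂
  obtain ⟨J₁, hJ₁, ε₁, hε₁, h₁⟩ := exists_finset_of_mem_nhds hU₁
  refine ⟨J₂ ∪ J₁, fun f hf => (Finset.mem_union.1 hf).elim (hJ₂ f) (hJ₁ f), min ε₂ ε₁,
    lt_min hε₂ hε₁, fun G hG => hsub ⟨h₂ _ fun f hf => ?_, h₁ _ fun f hf => ?_⟩⟩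
  · exact (hG f (Finset.mem_union_left _ hf)).1.trans_le (min_le_left _ _)
  · exact (hG f (Finset.mem_union_right _ hf)).2.trans_le (min_le_right _ _)

theorem exists_Lambda0_of_sub {Φ : Set (S → ℝ)} {μ₂ μ₁ : Measure S} [IsProbabilityMeasure μ₂]
    [IsProbabilityMeasure μ₁] (h₂ : ∀ f ∈ Φ, Integrable f μ₂) (h₁ : ∀ f ∈ Φ, Integrable f μ₁)
    {β : ℝ} (hβ : β ≠ 0) :
    ∃ G : Lambda0 Φ, μ₂.toSignedMeasure - μ₁.toSignedMeasure = β • (G : SignedMeasure S) := by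
  have hmem : μ₂.toSignedMeasure - μ₁.toSignedMeasure ∈ Lambda0 Φ := by
    refine ⟨by simp, fun f hf => ?_⟩
    have i₂ : Integrable f μ₂.toSignedMeasure.variation := by simpa using h₂ f hf
    have i₁ : Integrable f μ₁.toSignedMeasure.variation := by simpa using h₁ f hf
    exact VectorMeasure.Integrable.sub_vectorMeasure i₂ i₁
  exact ⟨β⁻¹ • ⟨_, hmem⟩, by simp [smul_smul, hβ]⟩

theorem abs_sint_sub_le {μ₂ μ₁ : Measure S} [IsFiniteMeasure μ₂] [IsFiniteMeasure μ₁]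
    {G : SignedMeasure S} {β : ℝ} (hβ : 0 < β)
    (h : μ₂.toSignedMeasure - μ₁.toSignedMeasure = β • G) {f : S → ℝ}
    (h₂ : Integrable f μ₂) (h₁ : Integrable f μ₁) {d ε : ℝ}
    (hd : |∫ x, f x ∂μ₂ - ∫ x, f x ∂μ₁ - β * d| ≤ ε * β) : |sint G f - d| ≤ ε := by
  rw [← mul_sint_of_sub_eq h h₂ h₁, ← mul_sub, abs_mul, abs_of_pos hβ, mul_comm] at hd
  exact le_of_mul_le_mul_right hd hβ

theorem nearSet_subset_deviationEvent (hb : Normalizing b) {J : Finset (S → ℝ)}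
    (hJ : ∀ f ∈ J, f ∈ Phi P b) {β ε : ℝ} (hβ : 0 < β) {d₂ d₁ : (S → ℝ) → ℝ} {n k : ℕ}
    (hn : 1 ≤ n) (hk : 1 ≤ k) {Ω : Set (Lambda0 (Phi P b) × Lambda0 (Phi P b))}
    (hΩ : ∀ G : Lambda0 (Phi P b) × Lambda0 (Phi P b),
      (∀ f ∈ J, |sint (G.1 : SignedMeasure S) f - d₂ f| ≤ ε ∧
        |sint (G.2 : SignedMeasure S) f - d₁ f| ≤ ε) → G ∈ Ω) :
    nearSet J (P : Measure S) β ε d₂ d₁ n k ⊆ deviationEvent P β Ω n k := by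
  intro w hw
  have : NeZero n := ⟨by omega⟩
  have : NeZero k := ⟨by omega⟩
  have hm : ∀ f ∈ Phi P b, Measurable f := fun f hf => ((mem_Phi_iff hb).1 hf).1
  obtain ⟨G₂, hG₂⟩ := exists_Lambda0_of_sub (Φ := Phi P b)
    (fun f hf => integrable_empirical w.2 (hm f hf))
    (fun f hf => integrable_empirical w.1 (hm f hf)) hβ.ne'
  obtain ⟨G₁, hG₁⟩ := exists_Lambda0_of_sub (Φ := Phi P b)
    (fun f hf => integrable_empirical w.1 (hm f hf))
    (fun f hf => integrable_of_mem_Phi hb hf) hβ.ne'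
  refine ⟨(G₂, G₁), hΩ _ fun f hf => ⟨?_, ?_⟩, hG₂, hG₁⟩
  · have hfm := hm f (hJ f hf)
    refine abs_sint_sub_le hβ hG₂ (integrable_empirical _ hfm) (integrable_empirical _ hfm) ?_
    rw [integral_empirical _ hfm, integral_empirical _ hfm]
    exact (hw f hf).1
  · have hfm := hm f (hJ f hf)
    refine abs_sint_sub_le hβ hG₁ (integrable_empirical _ hfm)
      (integrable_of_mem_Phi hb (hJ f hf)) ?_
    rw [integral_empirical _ hfm]
    exact (hw f hf).2

/-- An interior point of finite rate gives a lower bound for the probabilities. -/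
theorem eventually_le_sampleLaw (hb : Normalizing b) (hA : AssumptionA P b Pn Hn H)
    (hB1 : AssumptionB1 P b Hn) (hν : 0 < ν)
    (hk : Tendsto (fun n : ℕ => (k n : ℝ) / (n : ℝ)) atTop (𝓝 ν))
    {Ω : Set (Lambda0 (Phi P b) × Lambda0 (Phi P b))} {G : Lambda0 (Phi P b) × Lambda0 (Phi P b)}
    (hG : G ∈ interior ((fun G => G - (0, H)) '' Ω)) {I : ℝ}
    (hI : rho0bsq ν P G < ENNReal.ofReal I) :
    ∀ᶠ n : ℕ in atTop, ENNReal.ofReal (Real.exp (n * b n ^ 2 * (-I)))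
      ≤ sampleLaw (Pn n) n (k n) (deviationEvent P (b n) Ω n (k n)) := by
  have hfin : ENNReal.ofReal ν * rho0sq (G.1 : SignedMeasure S) P
      + rho0sq (G.2 : SignedMeasure S) P ≠ ⊤ := (hI.trans ENNReal.ofReal_lt_top).ne
  obtain ⟨hfin₂, hfin₁⟩ := ENNReal.add_ne_top.1 hfin
  obtain ⟨g₂, hg₂, hL₂, hd₂⟩ := exists_density_of_rho0sq_ne_top (P := P)
    (G := (G.1 : SignedMeasure S)) fun htop => hfin₂ (by
      rw [htop]
      exact ENNReal.mul_top (by simpa using hν))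
  obtain ⟨g₁, hg₁, hL₁, hd₁⟩ := exists_density_of_rho0sq_ne_top hfin₁
  rw [rho0bsq_eq hν hL₂ hL₁ hd₂ hd₁] at hI
  have hI' := (ENNReal.ofReal_lt_ofReal_iff_of_nonneg (by positivity)).1 hI
  have hmean : ∀ (G : Lambda0 (Phi P b)) {g : S → ℝ}, MemLp g 2 (P : Measure S) →
      (G : SignedMeasure S) = (P : Measure S).withDensityᵥ g → ∫ x, g x ∂(P : Measure S) = 0 := by
    intro G g hg hGg
    have h0 := G.2.1
    rw [hGg, withDensityᵥ_apply (hg.integrable (by norm_num)) MeasurableSet.univ] at h0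
    simpa using h0
  obtain ⟨J, hJ, ε, hε, hnear⟩ := exists_finset_of_mem_nhds_prod (mem_interior_iff_mem_nhds.1 hG)
  have hJL : ∀ f ∈ J, MemLp f 2 (P : Measure S) := fun f hf => ((mem_Phi_iff hb).1 (hJ f hf)).2.1
  have hJm : ∀ f ∈ J, Measurable f := fun f hf => ((mem_Phi_iff hb).1 (hJ f hf)).1
  obtain ⟨g₂', hm₂, ⟨M₂, hM₂⟩, h0₂, hsq₂, hclose₂⟩ :=
    exists_bounded_approx hg₂ hL₂ (hmean G.1 hL₂ hd₂) J hJL (half_pos hε)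
  obtain ⟨g₁', hm₁, ⟨M₁, hM₁⟩, h0₁, hsq₁, hclose₁⟩ :=
    exists_bounded_approx hg₁ hL₁ (hmean G.2 hL₁ hd₁) J hJL (half_pos hε)
  have hrate : ν * ((∫ x, g₂' x ^ 2 ∂(P : Measure S)) / 2)
      + (∫ x, g₁' x ^ 2 ∂(P : Measure S)) / 2 < I := by
    have := mul_le_mul_of_nonneg_left hsq₂ hν.le
    linarith
  have hpair : ∀ f ∈ J, sint (G.1 : SignedMeasure S) f = ∫ x, f x * g₂ x ∂(P : Measure S) ∧
      sint (G.2 : SignedMeasure S) f = ∫ x, f x * g₁ x ∂(P : Measure S) := fun f hf => by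
    rw [hd₂, hd₁]
    exact ⟨sint_withDensity (hL₂.integrable (by norm_num)) (hJm f hf)
      ((hJL f hf).integrable_mul hL₂), sint_withDensity (hL₁.integrable (by norm_num)) (hJm f hf)
      ((hJL f hf).integrable_mul hL₁)⟩
  have hkpos : ∀ᶠ n in atTop, 1 ≤ k n := by
    filter_upwards [hk.eventually_const_lt hν] with n hn
    rcases Nat.eq_zero_or_pos (k n) with h0 | h0
    · simp [h0] at hn
    · exact h0
  filter_upwards [le_sampleLaw_nearSet hb hA hB1 hν hk hJ hm₂
    (fun x => (hM₂ x).trans (le_max_left M₂ M₁)) h0₂ hm₁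
    (fun x => (hM₁ x).trans (le_max_right M₂ M₁)) h0₁ (half_pos hε) hrate, hb.eventually_pos,
    hkpos, eventually_ge_atTop 1] with n hn hβ hkn hn1
  refine hn.trans (measure_mono (nearSet_subset_deviationEvent hb hJ hβ hn1 hkn fun G' hG' => ?_))
  obtain ⟨G'', hG'', heq⟩ := hnear (G' - (0, H)) fun f hf => by
    have e₂ : sint ((G' - (0, H)).2 : SignedMeasure S) f
        = sint (G'.2 : SignedMeasure S) f - sint (H : SignedMeasure S) f :=
      sint_sub_left (G'.2.2.2 f (hJ f hf)) (H.2.2 f (hJ f hf))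
    have e₁ : (G' - (0, H)).1 = G'.1 := sub_zero G'.1
    rw [e₁, e₂, (hpair f hf).1, (hpair f hf).2]
    have c₂ := hclose₂ f hf
    have c₁ := hclose₁ f hf
    obtain ⟨n₂, n₁⟩ := hG' f hf
    rw [abs_le] at n₂ n₁
    rw [abs_lt] at c₂ c₁ ⊢
    rw [abs_lt]
    refine ⟨⟨?_, ?_⟩, ?_, ?_⟩ <;> linarith
  have : G'' = G' := sub_left_injective heq
  rwa [← this]

theorem le_liminf_scaledLog (hb : Normalizing b) (hA : AssumptionA P b Pn Hn H)
    (hB1 : AssumptionB1 P b Hn) (hν : 0 < ν)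
    (hk : Tendsto (fun n : ℕ => (k n : ℝ) / (n : ℝ)) atTop (𝓝 ν))
    (Ω : Set (Lambda0 (Phi P b) × Lambda0 (Phi P b))) :
    -((rho0bsqSet ν P (interior ((fun G => G - (0, H)) '' Ω)) : ℝ≥0∞) : EReal)
      ≤ liminf (fun n : ℕ => scaledLog n (b n) (sampleLaw (Pn n) n (k n)
        (deviationEvent P (b n) Ω n (k n)))) atTop := by
  rw [← EReal.ge_of_forall_gt_iff_ge]
  intro z hz
  rw [EReal.lt_neg_comm, ← EReal.coe_neg] at hz
  have hz0 : 0 ≤ -z := EReal.coe_nonneg.1 ((EReal.coe_ennreal_nonneg _).trans hz.le)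
  have hlt : rho0bsqSet ν P (interior ((fun G => G - (0, H)) '' Ω)) < ENNReal.ofReal (-z) := by
    rwa [← EReal.coe_ennreal_lt_coe_ennreal_iff, EReal.coe_ennreal_ofReal, max_eq_left hz0]
  obtain ⟨G, hG, hGz⟩ : ∃ G ∈ interior ((fun G => G - (0, H)) '' Ω),
      rho0bsq ν P G < ENNReal.ofReal (-z) := by
    simpa only [rho0bsqSet, iInf_lt_iff, exists_prop] using hlt
  refine le_liminf_of_le (by isBoundedDefault) ?_
  filter_upwards [eventually_le_sampleLaw hb hA hB1 hν hk hG hGz, hb.eventually_speed_pos]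
    with n hn hpos
  rw [le_scaledLog_iff hpos]
  simpa using hn

end LowerBound

end BootstrapMDP

end

theorem mainTheorem2 {S : Type*} [MeasurableSpace S]
    (P : ProbabilityMeasure S)
    (b : ℕ → ℝ) (hb_pos : ∀ n, 1 ≤ n → 0 < b n)
    (hb_zero : Tendsto b atTop (𝓝 0))
    (hb_speed : Tendsto (fun n : ℕ => (n : ℝ) * b n ^ 2) atTop atTop)
    (hb_ratio : Tendsto (fun n : ℕ => b n / b (n + 1)) atTop (𝓝 1))
    (k : ℕ → ℕ) (ν : ℝ) (hν : 0 < ν)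
    (hk : Tendsto (fun n : ℕ => (k n : ℝ) / (n : ℝ)) atTop (𝓝 ν))
    (Pn : ℕ → ProbabilityMeasure S)
    (Hn : ℕ → BootstrapMDP.Lambda0 (BootstrapMDP.Phi P b))
    (H : BootstrapMDP.Lambda0 (BootstrapMDP.Phi P b))
    (hA : BootstrapMDP.AssumptionA P b Pn Hn H)
    (hB1 : BootstrapMDP.AssumptionB1 P b Hn)
    (Ω : Set (BootstrapMDP.Lambda0 (BootstrapMDP.Phi P b) ×
      BootstrapMDP.Lambda0 (BootstrapMDP.Phi P b)))
    (hΩ : MeasurableSet Ω) :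
    -((BootstrapMDP.rho0bsqSet ν P (interior ((fun G => G - (0, H)) '' Ω)) : ℝ≥0∞) : EReal)
        ≤ liminf (fun n : ℕ => BootstrapMDP.scaledLog n (b n)
            (BootstrapMDP.sampleLaw (Pn n) n (k n)
              (BootstrapMDP.deviationEvent P (b n) Ω n (k n)))) atTop ∧
    limsup (fun n : ℕ => BootstrapMDP.scaledLog n (b n)
            (BootstrapMDP.sampleLaw (Pn n) n (k n)
              (BootstrapMDP.deviationEvent P (b n) Ω n (k n)))) atTop
        ≤ -((BootstrapMDP.rho0bsqSet ν P (closure ((fun G => G - (0, H)) '' Ω)) : ℝ≥0∞) : EReal) := by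
  have hb : BootstrapMDP.Normalizing b := ⟨hb_pos, hb_zero, hb_speed⟩
  exact ⟨BootstrapMDP.le_liminf_scaledLog hb hA hB1 hν hk Ω, BootstrapMDP.limsup_scaledLog_le hb hA hB1 hν hk Ω⟩
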